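/- Let $d\in\mathbb N$ and $q\in[2,\infty]$. For $\Psi:\mathbb R^n\to\mathbb R\cup\{\infty\}$ measurable let $\mu_\Psi$ be the measure on $\mathbb R^n$ with Lebesgue density $e^{-\Psi}$ (where $e^{-\infty}=0$). Let $\Phi_1,\Phi_2:\mathbb R^d\to\mathbb R\cup\{\infty\}$ satisfy the following. Assumptions on $\Phi_1$: - $\Phi_1$ is bounded from below and $\{\Phi_1<\infty\}\ne\emptyset$; - $e^{-\Phi_1}$ is continuous on $\mathbb R^d$; - $\Phi_1$ is weakly differentiable on $\{\Phi_1<\infty\}$ and $\nabla\Phi_1\in L^q_{loc}(\mathbb R^d,\mu_{\Phi_1})$, that is, $\nabla\Phi_1\in L^q(K,\mu_{\Phi_1})$ for every compact $K\subset\mathbb R^d$. Assumptions on $\Phi_2$: - $\Phi_2$ is Borel measurable and $\{\Phi_2<\infty\}$ is open and non-empty; - $\Phi_2$ is bounded from below and locally integrable on $\{\Phi_2<\infty\}$; - for $i=1,\dots,d$ the distributional derivatives satisfy $\partial_i\Phi_2\in L^2_{loc}(\{\Phi_2<\infty\})$ and $\partial_i^2\Phi_2\in L^1_{loc}(\{\Phi_2<\infty\})$;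 - $(\Delta-\nabla\Phi_2\cdot\nabla,\ C_c^\infty(\{\Phi_2<\infty\}))$ is essentially self-adjoint on $L^2(\mathbb R^d,\mu_{\Phi_2})$; - there are $K\in(0,\infty)$ and $\alpha\in[1,2)$ with $|\Delta\Phi_2|\le K(1+|\nabla\Phi_2|^\alpha)$ a.e. on $\{\Phi_2<\infty\}$; - $\Phi_2(-v)=\Phi_2(v)$ for all $v\in\mathbb R^d$; - $\mu_{\Phi_2}(\mathbb R^d)<\infty$; - $\int_{\mathbb R^d}|\nabla\Phi_2|^2\,d\mu_{\Phi_2}<\infty$. Let $\mu_{\mathbf\Phi}$ be the measure on $\mathbb R^{2d}=\mathbb R^d\times\mathbb R^d$ with density $e^{-\Phi_1(x)-\Phi_2(v)}$ with respect to $dx\,dv$, put $\{\Phi_1,\Phi_2<\infty\}=\{(x,v):\Phi_1(x)<\infty,\ \Phi_2(v)<\infty\}$, and for $f\in C_c^\infty(\{\Phi_1,\Phi_2<\infty\})$ let $$L_{\mathbf\Phi}f=\Delta_vf-\nabla\Phi_2(v)\cdot\nabla_vf+\nabla\Phi_2(v)\cdot\nabla_xf-\nabla\Phi_1(x)\cdot\nabla_vf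 .$$ Assume in addition that $\mu_{\mathbf\Phi}$ is a finite measure or that $q>d$. Then $(L_{\mathbf\Phi},C_c^\infty(\{\Phi_1,\Phi_2<\infty\}))$ is a well-defined closable operator on $L^1(\mathbb R^{2d},\mu_{\mathbf\Phi})$, and its closure is the generator of a strongly continuous contraction semigroup $(T_t)_{t\ge0}$ on $L^1(\mathbb R^{2d},\mu_{\mathbf\Phi})$. This semigroup is sub-Markovian: if $0\le u\le1$ $\mu_{\mathbf\Phi}$-a.e., then $0\le T_tu\le1$ $\mu_{\mathbf\Phi}$-a.e. for all $t\ge0$. -/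

import Mathlib

open MeasureTheory Filter Topology
open scoped NNReal ENNReal ContDiff Gradient Laplacian

noncomputable section

namespace Langevin

/-- `ℝ^d` with its Euclidean norm. -/
abbrev Rd (d : ℕ) : Type := EuclideanSpace ℝ (Fin d)

/-- The measure `μ_Ψ` with Lebesgue density `e^{-Ψ}`, for an extended-real-valued `Ψ`
(with `e^{-∞} = 0`). -/
def expMeasure {X : Type*} [MeasureSpace X] (Ψ : X → EReal) : Measure X :=
  volume.withDensity fun x => EReal.exp (-Ψ x)

/-- The set `{Φ < ∞}`. -/
def finiteSet {d : ℕ} (Φ : Rd d → EReal) : Set (Rd d) := {x | Φ x < ⊤}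

/-- The set `{Φ₁, Φ₂ < ∞}` of all `(x, v)` with `Φ₁ x < ∞` and `Φ₂ v < ∞`. -/
def finiteSet₂ {d : ℕ} (Φ₁ Φ₂ : Rd d → EReal) : Set (Rd d × Rd d) :=
  {z | Φ₁ z.1 < ⊤ ∧ Φ₂ z.2 < ⊤}

/-- The measure `μ_𝚽` on `ℝ^d × ℝ^d` with density `e^{-Φ₁(x)-Φ₂(v)}`. -/
def phaseMeasure {d : ℕ} (Φ₁ Φ₂ : Rd d → EReal) : Measure (Rd d × Rd d) :=
  expMeasure fun z => Φ₁ z.1 + Φ₂ z.2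

section TestFunctions

variable {X : Type*} [NormedAddCommGroup X] [NormedSpace ℝ X]

/-- `C_c^∞(Ω)`: smooth real functions with compact support contained in `Ω`
(extended by zero). -/
def testFunctions (Ω : Set X) : Submodule ℝ (X → ℝ) where
  carrier := {f | ContDiff ℝ ∞ f ∧ HasCompactSupport f ∧ tsupport f ⊆ Ω}
  add_mem' := by
    rintro f g ⟨hf, hf', hf''⟩ ⟨hg, hg', hg''⟩
    exact ⟨hf.add hg, hf'.add hg', (tsupport_add f g).trans (Set.union_subset hf'' hg'')⟩
  zero_mem' := ⟨contDiff_const, HasCompactSupport.zero, by simp⟩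
  smul_mem' := by
    rintro c f ⟨hf, hf', hf''⟩
    exact ⟨hf.const_smul c, hf'.smul_left (f := fun _ => c),
      (tsupport_smul_subset_right (fun _ => c) f).trans hf''⟩

end TestFunctions

section LocalSpaces

variable {d : ℕ}

/-- `g ∈ L^p_loc(Ω, μ)`: `g` is in `L^p(K, μ)` for every compact `K ⊆ Ω`. -/
def MemLpLoc {F : Type*} [NormedAddCommGroup F] (g : Rd d → F) (p : ℝ≥0∞) (Ω : Set (Rd d))
    (μ : Measure (Rd d)) : Prop :=
  ∀ K : Set (Rd d), IsCompact K → K ⊆ Ω → MemLp g p (μ.restrict K)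

/-- On the set `Ω`, the locally integrable function `w` is the `i`-th weak (distributional) partial
derivative of the locally integrable function `u`. -/
def IsWeakPartial (Ω : Set (Rd d)) (i : Fin d) (u w : Rd d → ℝ) : Prop :=
  LocallyIntegrableOn u Ω ∧ LocallyIntegrableOn w Ω ∧
    ∀ φ ∈ testFunctions Ω,
      ∫ x in Ω, u x * fderiv ℝ φ x (EuclideanSpace.single i 1) = -∫ x in Ω, w x * φ x

/-- `G` is (a representative of) the weak gradient on `{Φ < ∞}` of the extended-real-valued
function `Φ`. -/
def IsWeakGradient (Φ : Rd d → EReal) (G : Rd d → Rd d) : Prop :=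
  ∀ i, IsWeakPartial (finiteSet Φ) i (fun x => (Φ x).toReal) fun x => G x i

end LocalSpaces

section Operators

variable {X : Type*} [MeasurableSpace X]

/-- The graph in `L^p(μ) × L^p(μ)` of an operator that is given on a space `D` of functions:
pairs of classes `([f], [L f])` with `f ∈ D`. -/
def operatorGraph (μ : Measure X) (p : ℝ≥0∞) [Fact (1 ≤ p)] (D : Submodule ℝ (X → ℝ))
    (L : D →ₗ[ℝ] (X → ℝ)) : Submodule ℝ (Lp ℝ p μ × Lp ℝ p μ) where
  carrier := {z | ∃ f : D, z.1 =ᵐ[μ] (f : X → ℝ) ∧ z.2 =ᵐ[μ] L f}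
  add_mem' := by
    rintro ⟨a, b⟩ ⟨a', b'⟩ ⟨f, hf, hf'⟩ ⟨g, hg, hg'⟩
    refine ⟨f + g, (Lp.coeFn_add a a').trans ?_, (Lp.coeFn_add b b').trans ?_⟩
    · exact hf.add hg
    · rw [map_add]; exact hf'.add hg'
  zero_mem' := ⟨0, Lp.coeFn_zero ℝ p μ, by rw [map_zero]; exact Lp.coeFn_zero ℝ p μ⟩
  smul_mem' := by
    rintro c ⟨a, b⟩ ⟨f, hf, hf'⟩
    refine ⟨c • f, (Lp.coeFn_smul c a).trans ?_, (Lp.coeFn_smul c b).trans ?_⟩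
    · exact hf.const_smul c
    · rw [map_smul]; exact hf'.const_smul c

/-- The operator `(L, D)` considered as an unbounded operator on `L^p(μ)`. -/
def lpOperator (μ : Measure X) (p : ℝ≥0∞) [Fact (1 ≤ p)] (D : Submodule ℝ (X → ℝ))
    (L : D →ₗ[ℝ] (X → ℝ)) : Lp ℝ p μ →ₗ.[ℝ] Lp ℝ p μ :=
  (operatorGraph μ p D L).toLinearPMap

end Operators

section DifferentialOperators

variable {d : ℕ}

lemma two_le_infty : (2 : WithTop ℕ∞) ≤ ((⊤ : ℕ∞) : WithTop ℕ∞) :=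
  WithTop.coe_le_coe.2 le_top

lemma gradient_add' {f g : Rd d → ℝ} {x : Rd d} (hf : DifferentiableAt ℝ f x)
    (hg : DifferentiableAt ℝ g x) : ∇ (f + g) x = ∇ f x + ∇ g x := by
  simp only [gradient]
  rw [fderiv_add hf hg, map_add]

lemma gradient_smul' {f : Rd d → ℝ} {x : Rd d} (c : ℝ) (hf : DifferentiableAt ℝ f x) :
    ∇ (c • f) x = c • ∇ f x := by
  simp only [gradient]
  rw [fderiv_const_smul hf c]
  simp

/-- The operator `f ↦ Δf - G₂ · ∇f` on `C_c^∞(Ω)`; here `G₂` stands for `∇Φ₂`. -/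
def velocityOperator (G₂ : Rd d → Rd d) (Ω : Set (Rd d)) :
    testFunctions Ω →ₗ[ℝ] (Rd d → ℝ) where
  toFun f v := Δ (f : Rd d → ℝ) v - inner ℝ (G₂ v) (∇ (f : Rd d → ℝ) v)
  map_add' f g := by
    funext v
    have hf : ContDiff ℝ ∞ (f : Rd d → ℝ) := f.2.1
    have hg : ContDiff ℝ ∞ (g : Rd d → ℝ) := g.2.1
    have e1 : ∇ ((f + g : testFunctions Ω) : Rd d → ℝ) v = ∇ (f : Rd d → ℝ) v + ∇ (g : Rd d → ℝ) v :=
      gradient_add' (hf.differentiable (by simp) v) (hg.differentiable (by simp) v)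
    have e2 : Δ ((f + g : testFunctions Ω) : Rd d → ℝ) v = Δ (f : Rd d → ℝ) v + Δ (g : Rd d → ℝ) v :=
      ContDiffAt.laplacian_add (hf.contDiffAt.of_le two_le_infty)
        (hg.contDiffAt.of_le two_le_infty)
    simp only [Pi.add_apply, e1, e2, inner_add_right]
    ring
  map_smul' c f := by
    funext v
    have hf : ContDiff ℝ ∞ (f : Rd d → ℝ) := f.2.1
    have e1 : ∇ ((c • f : testFunctions Ω) : Rd d → ℝ) v = c • ∇ (f : Rd d → ℝ) v :=
      gradient_smul' c (hf.differentiable (by simp) v)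
    have e2 : Δ ((c • f : testFunctions Ω) : Rd d → ℝ) v = c • Δ (f : Rd d → ℝ) v :=
      InnerProductSpace.laplacian_smul c (hf.contDiffAt.of_le two_le_infty)
    simp only [Pi.smul_apply, RingHom.id_apply, e1, e2, inner_smul_right, smul_eq_mul]
    ring

/-- `∇_x f (x, v)`. -/
def gradX (f : Rd d × Rd d → ℝ) (z : Rd d × Rd d) : Rd d := ∇ (fun x => f (x, z.2)) z.1

/-- `∇_v f (x, v)`. -/
def gradV (f : Rd d × Rd d → ℝ) (z : Rd d × Rd d) : Rd d := ∇ (fun v => f (z.1, v)) z.2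

/-- `Δ_v f (x, v)`. -/
def laplaceV (f : Rd d × Rd d → ℝ) (z : Rd d × Rd d) : ℝ := Δ (fun v => f (z.1, v)) z.2

/-- The operator `f ↦ Δ_v f - G₂(v) · ∇_v f + G₂(v) · ∇_x f - G₁(x) · ∇_v f` on `C_c^∞(Ω)`,
`Ω ⊆ ℝ^d × ℝ^d`; here `G₁`, `G₂` stand for `∇Φ₁`, `∇Φ₂`. -/
def langevinOperator (G₁ G₂ : Rd d → Rd d) (Ω : Set (Rd d × Rd d)) :
    testFunctions Ω →ₗ[ℝ] (Rd d × Rd d → ℝ) where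
  toFun f z := laplaceV f z - inner ℝ (G₂ z.2) (gradV f z) + inner ℝ (G₂ z.2) (gradX f z)
    - inner ℝ (G₁ z.1) (gradV f z)
  map_add' f g := by
    funext ⟨x, v⟩
    have hf : ContDiff ℝ ∞ (f : Rd d × Rd d → ℝ) := f.2.1
    have hg : ContDiff ℝ ∞ (g : Rd d × Rd d → ℝ) := g.2.1
    have hf1 : ContDiff ℝ ∞ fun x => (f : Rd d × Rd d → ℝ) (x, v) := hf.comp (contDiff_id.prodMk contDiff_const)
    have hf2 : ContDiff ℝ ∞ fun v => (f : Rd d × Rd d → ℝ) (x, v) := hf.comp (contDiff_const.prodMk contDiff_id)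
    have hg1 : ContDiff ℝ ∞ fun x => (g : Rd d × Rd d → ℝ) (x, v) := hg.comp (contDiff_id.prodMk contDiff_const)
    have hg2 : ContDiff ℝ ∞ fun v => (g : Rd d × Rd d → ℝ) (x, v) := hg.comp (contDiff_const.prodMk contDiff_id)
    have e1 : gradX (f + g : testFunctions Ω) (x, v) = gradX f (x, v) + gradX g (x, v) :=
      gradient_add' (hf1.differentiable (by simp) x) (hg1.differentiable (by simp) x)
    have e2 : gradV (f + g : testFunctions Ω) (x, v) = gradV f (x, v) + gradV g (x, v) :=
      gradient_add' (hf2.differentiable (by simp) v) (hg2.differentiable (by simp) v)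
    have e3 : laplaceV (f + g : testFunctions Ω) (x, v) = laplaceV f (x, v) + laplaceV g (x, v) :=
      ContDiffAt.laplacian_add (hf2.contDiffAt.of_le two_le_infty)
        (hg2.contDiffAt.of_le two_le_infty)
    simp only [Pi.add_apply, e1, e2, e3, inner_add_right]
    ring
  map_smul' c f := by
    funext ⟨x, v⟩
    have hf : ContDiff ℝ ∞ (f : Rd d × Rd d → ℝ) := f.2.1
    have hf1 : ContDiff ℝ ∞ fun x => (f : Rd d × Rd d → ℝ) (x, v) := hf.comp (contDiff_id.prodMk contDiff_const)
    have hf2 : ContDiff ℝ ∞ fun v => (f : Rd d × Rd d → ℝ) (x, v) := hf.comp (contDiff_const.prodMk contDiff_id)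
    have e1 : gradX (c • f : testFunctions Ω) (x, v) = c • gradX f (x, v) :=
      gradient_smul' c (hf1.differentiable (by simp) x)
    have e2 : gradV (c • f : testFunctions Ω) (x, v) = c • gradV f (x, v) :=
      gradient_smul' c (hf2.differentiable (by simp) v)
    have e3 : laplaceV (c • f : testFunctions Ω) (x, v) = c • laplaceV f (x, v) :=
      InnerProductSpace.laplacian_smul c (hf2.contDiffAt.of_le two_le_infty)
    simp only [Pi.smul_apply, RingHom.id_apply, e1, e2, e3, inner_smul_right,
      smul_eq_mul]
    ring

/-- The operator `(L_𝚽, C_c^∞({Φ₁, Φ₂ < ∞}))` on `L¹(μ_𝚽)`. -/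
def langevinOperatorL1 (Φ₁ Φ₂ : Rd d → EReal) (G₁ G₂ : Rd d → Rd d) :
    Lp ℝ 1 (phaseMeasure Φ₁ Φ₂) →ₗ.[ℝ] Lp ℝ 1 (phaseMeasure Φ₁ Φ₂) :=
  lpOperator (phaseMeasure Φ₁ Φ₂) 1 (testFunctions (finiteSet₂ Φ₁ Φ₂))
    (langevinOperator G₁ G₂ (finiteSet₂ Φ₁ Φ₂))

end DifferentialOperators

section Potentials

variable {d : ℕ}

/-- The assumptions on the position potential `Φ₁ : ℝ^d → ℝ ∪ {∞}`, where `G₁` is a representative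
of its weak gradient. -/
structure PositionPotential (q : ℝ≥0∞) (Φ₁ : Rd d → EReal) (G₁ : Rd d → Rd d) : Prop where
  bddBelow : ∃ c : ℝ, ∀ x, (c : EReal) ≤ Φ₁ x
  nonempty : (finiteSet Φ₁).Nonempty
  continuous_exp : Continuous fun x => EReal.exp (-Φ₁ x)
  weakGradient : IsWeakGradient Φ₁ G₁
  memLpLoc : MemLpLoc G₁ q Set.univ (expMeasure Φ₁)

/-- Essential self-adjointness of an operator on a real Hilbert space: its closure is
self-adjoint. -/
def IsEssentiallySelfAdjoint {H : Type*} [NormedAddCommGroup H] [InnerProductSpace ℝ H]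
    [CompleteSpace H] (A : H →ₗ.[ℝ] H) : Prop :=
  A.IsClosable ∧ IsSelfAdjoint A.closure

/-- The assumptions on the velocity potential `Φ₂ : ℝ^d → ℝ ∪ {∞}`, where `G₂` is a representative
of its weak gradient and `H₂ i` one of its second weak derivative `∂ᵢ²Φ₂`. -/
structure VelocityPotential (Φ₂ : Rd d → EReal) (G₂ : Rd d → Rd d) (H₂ : Fin d → Rd d → ℝ) :
    Prop where
  measurable : Measurable Φ₂
  isOpen : IsOpen (finiteSet Φ₂)
  nonempty : (finiteSet Φ₂).Nonempty
  bddBelow : ∃ c : ℝ, ∀ v, (c : EReal) ≤ Φ₂ v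
  locallyIntegrable : LocallyIntegrableOn (fun v => (Φ₂ v).toReal) (finiteSet Φ₂)
  weakGradient : IsWeakGradient Φ₂ G₂
  memLpLoc_two : MemLpLoc G₂ 2 (finiteSet Φ₂) volume
  weakSecond : ∀ i, IsWeakPartial (finiteSet Φ₂) i (fun v => G₂ v i) (H₂ i)
  memLpLoc_one : ∀ i, MemLpLoc (H₂ i) 1 (finiteSet Φ₂) volume
  essentiallySelfAdjoint : IsEssentiallySelfAdjoint
    (lpOperator (expMeasure Φ₂) 2 (testFunctions (finiteSet Φ₂))
      (velocityOperator G₂ (finiteSet Φ₂)))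
  laplacian_bound : ∃ K α : ℝ, 0 < K ∧ 1 ≤ α ∧ α < 2 ∧
    ∀ᵐ v ∂(volume.restrict (finiteSet Φ₂)), |∑ i, H₂ i v| ≤ K * (1 + ‖G₂ v‖ ^ α)
  symmetric : ∀ v, Φ₂ (-v) = Φ₂ v
  finite : IsFiniteMeasure (expMeasure Φ₂)
  gradient_memLp : MemLp G₂ 2 (expMeasure Φ₂)

end Potentials

section Semigroups

/-- Strongly continuous contraction semigroups on a real Banach space. -/
structure IsStronglyContinuousContractionSemigroup {B : Type*} [NormedAddCommGroup B]
    [NormedSpace ℝ B] (T : ℝ≥0 → B →L[ℝ] B) : Prop where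
  zero : T 0 = ContinuousLinearMap.id ℝ B
  add : ∀ s t, T (s + t) = (T s).comp (T t)
  contraction : ∀ t, ‖T t‖ ≤ 1
  tendsto : ∀ u, Tendsto (fun t => T t u) (𝓝 0) (𝓝 u)

/-- `A` is the infinitesimal generator of `T`: `u` is in its domain with `A u = w` exactly if
`(T t u - u) / t → w` as `t ↓ 0`. -/
def IsGenerator {B : Type*} [NormedAddCommGroup B] [NormedSpace ℝ B] (T : ℝ≥0 → B →L[ℝ] B)
    (A : B →ₗ.[ℝ] B) : Prop :=
  ∀ u w : B, (u, w) ∈ A.graph ↔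
    Tendsto (fun t : ℝ≥0 => (t : ℝ)⁻¹ • (T t u - u)) (𝓝[>] 0) (𝓝 w)

/-- Sub-Markovian: `0 ≤ u ≤ 1` a.e. implies `0 ≤ T t u ≤ 1` a.e. -/
def IsSubMarkovian {X : Type*} [MeasurableSpace X] {μ : Measure X}
    (T : ℝ≥0 → Lp ℝ 1 μ →L[ℝ] Lp ℝ 1 μ) : Prop :=
  ∀ (t : ℝ≥0) (u : Lp ℝ 1 μ), (∀ᵐ x ∂μ, 0 ≤ u x ∧ u x ≤ 1) → ∀ᵐ x ∂μ, 0 ≤ T t u x ∧ T t u x ≤ 1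

end Semigroups

end Langevin

end

/-! The argument is of Lumer–Phillips type on `L¹(μ)`, with `μ` the phase space measure. It needs a
dense domain, an order-sensitive form of dissipativity, and density of the range of `c - L` for
every `c > 0`; a Hille–Yosida theorem (`exists_semigroup`) then gives the semigroup and keeps every
closed convex set that is stable under the resolvents.

Dissipativity comes from invariance, `∫ L f dμ = 0`. Since `L` is of second order only in `v`,
applying this to `B ∘ f` with `B' = β` bounded and nondecreasing gives `∫ β(f) L f dμ = -∫ β'(f)
|∇_v f|² dμ ≤ 0`. With `β` tending to the indicator of `(c, ∞)` one gets `l ‖(f - c)⁺‖ ≤ ‖(l f - L f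
- l c)⁺‖` (`isSubMarkovianGraph_langevin`). The level `c = 0` yields dissipativity, hence
closability; the levels `0` and `1` together show that the resolvents preserve `{0 ≤ u ≤ 1}`.

By Hahn–Banach and `(L¹)' = L^∞`, density of the range means that a bounded `h` with `∫ h (c f - L
f) dμ = 0` for all test functions `f` vanishes (`ae_eq_zero_of_dual_equation`). Formally one tests
with `f = ψ(x)² h`: the first-order part of `L` is antisymmetric up to the term containing `∇ψ ·
∇Φ₂`, and one arrives at a Caccioppoli inequality in the position variable alone, `(c/2) ∫ ψ² m dμ₁
≤ K ∫ |∇ψ|² m dμ₁` with `m(x) = ∫ h(x,v)² dμ₂(v)` (`exists_caccioppoli`). As `h` has no regularity,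
two devices make this rigorous.

In `x`, the function `ψ e^{-Φ₁} h` is mollified, and `∇Φ₁` is frozen at the point under
consideration. The error is a commutator that vanishes in the limit because `∇Φ₁` is locally square
integrable. The two terms without a sign cancel after integration in `x` against the weight
`e^{Φ₁}`.

In `v`, each slice `u` is only a weak solution. Essential self-adjointness provides test functions
`f` with `f - s L_v f ≈ u`, which can be inserted into the equation in place of `u` and obey the
energy inequality up to `O(s)` (`exists_energy_approx`, `energy_estimate`). The remaining term
containing `∇Φ₂` is absorbed by the form bound `‖∇Φ₂ φ‖² ≤ C (‖∇φ‖² + ‖φ‖²)` (`exists_form_bound`),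
which follows from the growth condition on `ΔΦ₂` with `α < 2`.

Finally put `ν = m μ₁`. Cutoffs `F_n(Φ₁)` extend the Caccioppoli inequality from `ψ` supported in
`{Φ₁ < ∞}` to all of `C_c^∞(ℝ^d)`, because `∇Φ₁` is square integrable for `μ₁` up to the boundary of
that set. Rescaled bumps then give `R² ν(B_R) ≤ κ ν(B_{2R})`, while the bounded density of `ν` gives
`ν(B_R) ≤ D R^d`. Iterating the first bound makes `ν(B_R)` decay faster than any power, so `ν = 0`
(`eq_zero_of_caccioppoli`). -/

noncomputable section

namespace Langevin


/-! ### Exponentials of `c (J - 1)` for a contraction `J` -/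

section ContractionExponential

variable {B : Type*} [NormedAddCommGroup B] [NormedSpace ℝ B]

/-- The bounded generator `c (J - 1)` of the Poisson semigroup of `J`. -/
def poissonGenerator (c : ℝ) (J : B →L[ℝ] B) : B →L[ℝ] B := c • (J - 1)

variable [CompleteSpace B]

lemma exp_add_clm {X Y : B →L[ℝ] B} (h : Commute X Y) :
    NormedSpace.exp (X + Y) = NormedSpace.exp X * NormedSpace.exp Y := by
  let _ : NormedAlgebra ℚ (B →L[ℝ] B) := NormedAlgebra.restrictScalars ℚ ℝ _
  exact NormedSpace.exp_add_of_commute h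

/-- Since `e^{a(J-1)} = e^{-a} ∑ aⁿ/n! Jⁿ`, the vector is a Poisson average of the iterates `Jⁿ u`.
Renormalised partial sums are genuine convex combinations and converge to it. -/
lemma exp_smul_sub_one_mem {C : Set B} (hC : IsClosed C) (hconv : Convex ℝ C) {J : B →L[ℝ] B}
    (hJ : ∀ u ∈ C, J u ∈ C) {a : ℝ} (ha : 0 ≤ a) {u : B} (hu : u ∈ C) :
    NormedSpace.exp (a • (J - 1)) u ∈ C := by
  have hpow : ∀ n : ℕ, (J ^ n) u ∈ C := by
    intro n
    induction n with
    | zero => simpa using hu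
    | succ n ih => rw [pow_succ']; exact hJ _ ih
  have e1 : NormedSpace.exp (a • (J - 1)) u = Real.exp (-a) • NormedSpace.exp (a • J) u := by
    have e : a • (J - 1) = a • J + algebraMap ℝ (B →L[ℝ] B) (-a) := by
      rw [Algebra.algebraMap_eq_smul_one, smul_sub, neg_smul, sub_eq_add_neg]
    rw [e, exp_add_clm (show Commute (a • J) (algebraMap ℝ (B →L[ℝ] B) (-a)) from (Algebra.commutes (-a) (a • J)).symm),
      ← NormedSpace.algebraMap_exp_comm (𝕂 := ℝ), Algebra.algebraMap_eq_smul_one,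
      ← Real.exp_eq_exp_ℝ]
    simp
  have h1 : HasSum (fun n : ℕ => (a ^ n / n.factorial) • (J ^ n) u) (NormedSpace.exp (a • J) u) := by
    have := (NormedSpace.exp_series_hasSum_exp' (𝕂 := ℝ) (a • J)).mapL
      (ContinuousLinearMap.apply ℝ B u)
    simpa [smul_pow, smul_smul, div_eq_inv_mul] using this
  have h2 : HasSum (fun n : ℕ => a ^ n / n.factorial) (Real.exp a) := by
    rw [Real.exp_eq_exp_ℝ]
    exact NormedSpace.expSeries_div_hasSum_exp a
  have h3 : Tendsto (fun N => (Finset.range N).centerMass (fun n : ℕ => a ^ n / n.factorial)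
      (fun n => (J ^ n) u)) atTop (𝓝 (NormedSpace.exp (a • (J - 1)) u)) := by
    rw [e1, Real.exp_neg]
    exact (h2.tendsto_sum_nat.inv₀ (Real.exp_pos a).ne').smul h1.tendsto_sum_nat
  -- `N ≥ 1` is required: for `N = 0` the total weight is zero and `centerMass` is not a convex
  -- combination.
  refine hC.mem_of_tendsto h3 ((eventually_ge_atTop 1).mono fun N hN => ?_)
  refine hconv.centerMass_mem (fun i _ => by positivity) ?_ (fun i _ => hpow i)
  refine Finset.sum_pos' (fun i _ => by positivity) ⟨0, by simpa [Nat.pos_iff_ne_zero] using Nat.one_le_iff_ne_zero.1 hN, by simp⟩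

variable {c : ℝ} {J : B →L[ℝ] B}

/-- The invariance of closed convex sets, applied to the ball of radius `‖u‖`. -/
lemma norm_exp_poissonGenerator_apply_le (hc : 0 ≤ c) (hJ : ‖J‖ ≤ 1) {t : ℝ} (ht : 0 ≤ t) (u : B) :
    ‖NormedSpace.exp (t • poissonGenerator c J) u‖ ≤ ‖u‖ := by
  have := exp_smul_sub_one_mem (C := Metric.closedBall 0 ‖u‖) Metric.isClosed_closedBall
    (convex_closedBall _ _) (J := J) (fun v hv => by
      simp only [mem_closedBall_zero_iff] at hv ⊢
      exact (J.le_of_opNorm_le hJ v).trans (by simpa using hv)) (a := t * c) (mul_nonneg ht hc)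
      (u := u) (by simp)
  rw [poissonGenerator, smul_smul]
  simpa using this

lemma hasDerivAt_exp_smul_apply (X : B →L[ℝ] B) (u : B) (t : ℝ) :
    HasDerivAt (fun s : ℝ => NormedSpace.exp (s • X) u) (NormedSpace.exp (t • X) (X u)) t := by
  simpa using (hasDerivAt_exp_smul_const X t).clm_apply (hasDerivAt_const t u)

/-- Interpolate by `s ↦ e^{sX} e^{(t-s)Y} u`, whose derivative `e^{sX} e^{(t-s)Y} (X - Y) u` is
bounded by `‖X u - Y u‖`. This makes the Yosida approximations a Cauchy sequence. -/
lemma norm_exp_poissonGenerator_sub_le (hc : 0 ≤ c) (hJ : ‖J‖ ≤ 1) {c' : ℝ} {J' : B →L[ℝ] B}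
    (hc' : 0 ≤ c') (hJ' : ‖J'‖ ≤ 1) (hcomm : Commute J J') {t : ℝ} (ht : 0 ≤ t) (u : B) :
    ‖NormedSpace.exp (t • poissonGenerator c J) u - NormedSpace.exp (t • poissonGenerator c' J') u‖
      ≤ t * ‖poissonGenerator c J u - poissonGenerator c' J' u‖ := by
  set X := poissonGenerator c J
  set Y := poissonGenerator c' J'
  have hXY : Commute X Y := by
    refine Commute.smul_left (Commute.smul_right ?_ _) _
    exact (hcomm.sub_left (Commute.one_left _)).sub_right
      ((Commute.one_right J).sub_left (Commute.one_right 1))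
  -- As `X` and `Y` commute, the interpolation is one exponential in `s` after a fixed operator, so
  -- a single derivative formula suffices.
  have key : ∀ s : ℝ, NormedSpace.exp (s • X) (NormedSpace.exp ((t - s) • Y) u) =
      NormedSpace.exp (t • Y) (NormedSpace.exp (s • (X - Y)) u) := by
    intro s
    have e : s • X + (t - s) • Y = t • Y + s • (X - Y) := by module
    have c1 : Commute (s • X) ((t - s) • Y) := (hXY.smul_left s).smul_right _
    have c2 : Commute (t • Y) (s • (X - Y)) :=
      (((hXY.symm).sub_right (Commute.refl Y)).smul_left t).smul_right _
    rw [← mul_apply_eq_comp, ← mul_apply_eq_comp, ← exp_add_clm c1,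
      ← exp_add_clm c2, e]
  have hd : ∀ s : ℝ, HasDerivAt (fun s : ℝ => NormedSpace.exp (s • X) (NormedSpace.exp ((t - s) • Y) u))
      (NormedSpace.exp (s • X) (NormedSpace.exp ((t - s) • Y) (X u - Y u))) s := by
    intro s
    have h1 := ((NormedSpace.exp (t • Y)).hasFDerivAt).comp_hasDerivAt s
      (hasDerivAt_exp_smul_apply (X - Y) u s)
    have h2 : HasDerivAt (fun s : ℝ => NormedSpace.exp (t • Y) (NormedSpace.exp (s • (X - Y)) u))
      (NormedSpace.exp (t • Y) (NormedSpace.exp (s • (X - Y)) ((X - Y) u))) s := h1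
    have e : s • X + (t - s) • Y = t • Y + s • (X - Y) := by module
    have c1 : Commute (s • X) ((t - s) • Y) := (hXY.smul_left s).smul_right _
    have c2 : Commute (t • Y) (s • (X - Y)) :=
      (((hXY.symm).sub_right (Commute.refl Y)).smul_left t).smul_right _
    rw [← mul_apply_eq_comp, ← exp_add_clm c2, ← e, exp_add_clm c1] at h2
    simp only [mul_apply_eq_comp, ← key] at h2
    exact h2
  have := norm_image_sub_le_of_norm_deriv_le_segment' (a := 0) (b := t)
    (fun s _ => (hd s).hasDerivWithinAt) (C := ‖X u - Y u‖) (fun s hs => by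
      refine (norm_exp_poissonGenerator_apply_le hc hJ hs.1 _).trans
        (norm_exp_poissonGenerator_apply_le hc' hJ' (by linarith [hs.2]) _)) t ⟨ht, le_rfl⟩
  simpa [mul_comm] using this

lemma norm_exp_poissonGenerator_sub_self_le (hc : 0 ≤ c) (hJ : ‖J‖ ≤ 1) {t : ℝ} (ht : 0 ≤ t)
    (u : B) :
    ‖NormedSpace.exp (t • poissonGenerator c J) u - u‖ ≤ t * ‖poissonGenerator c J u‖ := by
  have := norm_exp_poissonGenerator_sub_le hc hJ le_rfl hJ (Commute.refl J) ht u
  simpa [poissonGenerator] using this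

/-- A first-order Taylor bound in which `w` plays the generator value at `u` and `w'` is a nearby
vector with controlled `X w'`. The right-hand side stays bounded along the Yosida approximation,
even though `X w` itself need not. -/
lemma norm_exp_poissonGenerator_sub_sub_le (hc : 0 ≤ c) (hJ : ‖J‖ ≤ 1) {t : ℝ} (ht : 0 ≤ t)
    (u w w' : B) :
    ‖NormedSpace.exp (t • poissonGenerator c J) u - u - t • w‖ ≤
      t * (‖poissonGenerator c J u - w‖ + 2 * ‖w - w'‖ + t * ‖poissonGenerator c J w'‖) := by
  set X := poissonGenerator c J
  have hd : ∀ s : ℝ, HasDerivAt (fun s : ℝ => NormedSpace.exp (s • X) u - s • w)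
      (NormedSpace.exp (s • X) (X u) - w) s := by
    intro s
    have := (hasDerivAt_exp_smul_apply X u s).sub ((hasDerivAt_id s).smul_const w)
    rw [one_smul] at this
    exact this
  have := norm_image_sub_le_of_norm_deriv_le_segment' (a := 0) (b := t)
    (fun s _ => (hd s).hasDerivWithinAt) (C := ‖X u - w‖ + 2 * ‖w - w'‖ + t * ‖X w'‖) (fun s hs => by
      have e : NormedSpace.exp (s • X) (X u) - w = NormedSpace.exp (s • X) (X u - w) +
          NormedSpace.exp (s • X) (w - w') + (NormedSpace.exp (s • X) w' - w') + (w' - w) := by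
        simp only [map_sub]; abel
      have h1 := norm_exp_poissonGenerator_apply_le hc hJ hs.1 (X u - w)
      have h2 := norm_exp_poissonGenerator_apply_le hc hJ hs.1 (w - w')
      have h3 := norm_exp_poissonGenerator_sub_self_le hc hJ hs.1 w'
      have h4 : s * ‖X w'‖ ≤ t * ‖X w'‖ := by gcongr; exact hs.2.le
      rw [e]
      refine (norm_add_le _ _).trans ?_
      refine (add_le_add (norm_add_le _ _) le_rfl).trans ?_
      refine (add_le_add (add_le_add (norm_add_le _ _) le_rfl) le_rfl).trans ?_
      rw [norm_sub_rev w' w]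
      linarith) t ⟨ht, le_rfl⟩
  have e : NormedSpace.exp (t • X) u - u - t • w = NormedSpace.exp (t • X) u - t • w - u := by abel
  rw [e]
  simpa [mul_comm] using this

end ContractionExponential

/-! ### Hille–Yosida theorem with invariant convex sets -/

section HilleYosida

variable {B : Type*} [NormedAddCommGroup B] [NormedSpace ℝ B]

/-- Dissipativity: `λ‖u‖ ≤ ‖λ u - A u‖` for all `λ > 0` and `u` in the domain of `A`. -/
def IsDissipative (A : B →ₗ.[ℝ] B) : Prop :=
  ∀ c : ℝ, 0 < c → ∀ p ∈ A.graph, c * ‖p.1‖ ≤ ‖c • p.1 - p.2‖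

variable {A : B →ₗ.[ℝ] B}

lemma IsDissipative.fst_eq (hA : IsDissipative A) {c : ℝ} (hc : 0 < c) {p p' : B × B}
    (hp : p ∈ A.graph) (hp' : p' ∈ A.graph) (h : c • p.1 - p.2 = c • p'.1 - p'.2) : p.1 = p'.1 := by
  have h1 := hA c hc (p - p') (A.graph.sub_mem hp hp')
  have e : c • (p - p').1 - (p - p').2 = 0 := by
    rw [Prod.fst_sub, Prod.snd_sub, smul_sub, sub_sub_sub_comm, h, sub_self]
  rw [e, norm_zero] at h1
  have : ‖(p - p').1‖ = 0 := le_antisymm (nonpos_of_mul_nonpos_right h1 hc) (norm_nonneg _)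
  exact sub_eq_zero.1 (norm_eq_zero.1 this)

/-- The contraction `λ (λ - A)⁻¹`. -/
lemma IsDissipative.exists_resolvent (hA : IsDissipative A) {c : ℝ} (hc : 0 < c)
    (hsurj : ∀ g : B, ∃ p ∈ A.graph, c • p.1 - p.2 = g) :
    ∃ J : B →L[ℝ] B, ‖J‖ ≤ 1 ∧ (∀ g, (J g, c • (J g - g)) ∈ A.graph) ∧
      ∀ p ∈ A.graph, J (c • p.1 - p.2) = c • p.1 := by
  choose r hr hr' using fun g => hsurj (c • g)
  have huniq : ∀ p ∈ A.graph, ∀ g, c • p.1 - p.2 = c • g → (r g).1 = p.1 := fun p hp g h =>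
    hA.fst_eq hc (hr g) hp ((hr' g).trans h.symm)
  let J₀ : B →ₗ[ℝ] B :=
    { toFun := fun g => (r g).1
      map_add' := fun g g' => huniq _ (A.graph.add_mem (hr g) (hr g')) _ (by
        rw [Prod.fst_add, Prod.snd_add, smul_add, smul_add, ← hr' g, ← hr' g']; abel)
      map_smul' := fun a g => huniq _ (A.graph.smul_mem a (hr g)) _ (by
        rw [Prod.smul_fst, Prod.smul_snd, smul_comm c a, ← smul_sub, hr' g, smul_comm]) }
  have hbd : ∀ g, ‖J₀ g‖ ≤ 1 * ‖g‖ := by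
    intro g
    have h1 := hA c hc (r g) (hr g)
    rw [hr' g, norm_smul, Real.norm_of_nonneg hc.le] at h1
    rw [one_mul]
    exact le_of_mul_le_mul_left h1 hc
  refine ⟨J₀.mkContinuous 1 hbd, LinearMap.mkContinuous_norm_le _ zero_le_one _, fun g => ?_,
    fun p hp => ?_⟩
  · have e : c • ((r g).1 - g) = (r g).2 := by rw [smul_sub, ← hr' g]; abel
    change ((r g).1, c • ((r g).1 - g)) ∈ A.graph
    rw [e]; exact hr g
  · change (r _).1 = c • p.1
    exact huniq (c • p) (A.graph.smul_mem c hp) _ (by simp [smul_sub])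

/-- The resolvent identity `(c - c') J J' = c J' - c' J`, written for `J = c (c - A)⁻¹`, has a
right-hand side that only changes sign when the roles are exchanged. For `c = c'` both operators
coincide. -/
lemma resolvent_commute (hA : IsDissipative A) {c c' : ℝ} (hc : 0 < c) (hc' : 0 < c')
    {J J' : B →L[ℝ] B} (hJ : ∀ g, (J g, c • (J g - g)) ∈ A.graph)
    (hJ' : ∀ g, (J' g, c' • (J' g - g)) ∈ A.graph) : Commute J J' := by
  have key : ∀ {c c' : ℝ}, 0 < c → 0 < c' → ∀ {J J' : B →L[ℝ] B},
      (∀ g, (J g, c • (J g - g)) ∈ A.graph) → (∀ g, (J' g, c' • (J' g - g)) ∈ A.graph) →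
      ∀ g, (c - c') • J (J' g) = c • J' g - c' • J g := by
    intro c c' hc hc' J J' hJ hJ' g
    have h := hA.fst_eq hc (p := ((c - c') • J (J' g) + c' • J g, _ + _))
      (p' := (c • J' g, c • (c' • (J' g - g))))
      (A.graph.add_mem (A.graph.smul_mem (c - c') (hJ (J' g))) (A.graph.smul_mem c' (hJ g)))
      (A.graph.smul_mem c (hJ' g)) (by simp only [Prod.smul_snd]; module)
    have h' : (c - c') • J (J' g) + c' • J g = c • J' g := h
    rw [← h', add_sub_cancel_right]
  rcases eq_or_ne c c' with rfl | hne
  · have : J = J' := by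
      ext g
      exact hA.fst_eq hc (hJ g) (hJ' g) (by simp only; module)
    rw [this]
  · ext g
    have h1 := key hc hc' hJ hJ' g
    have h2 := key hc' hc hJ' hJ g
    have h3 : (c - c') • J (J' g) = (c - c') • J' (J g) := by
      rw [h1, ← neg_sub c' c, neg_smul, h2]; abel
    exact smul_right_injective B (sub_ne_zero.2 hne) h3

lemma tendsto_clm_of_dense {ι : Type*} {l : Filter ι} {E : ι → B →L[ℝ] B} {F : B →L[ℝ] B}
    (hE : ∀ i, ‖E i‖ ≤ 1) (hF : ‖F‖ ≤ 1) {s : Set B} (hs : Dense s)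
    (h : ∀ u ∈ s, Tendsto (fun i => E i u) l (𝓝 (F u))) (u : B) :
    Tendsto (fun i => E i u) l (𝓝 (F u)) := by
  rw [Metric.tendsto_nhds]
  intro ε hε
  obtain ⟨v, hv, hv'⟩ := Metric.dense_iff.1 hs u (ε / 3) (by positivity)
  filter_upwards [Metric.tendsto_nhds.1 (h v hv') (ε / 3) (by positivity)] with i hi
  have h1 : ‖E i (u - v)‖ ≤ ‖u - v‖ := by simpa using (E i).le_of_opNorm_le (hE i) (u - v)
  have h2 : ‖F (v - u)‖ ≤ ‖v - u‖ := by simpa using F.le_of_opNorm_le hF (v - u)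
  rw [mem_ball_iff_norm] at hv
  rw [dist_eq_norm] at hi ⊢
  have e : E i u - F u = E i (u - v) + (E i v - F v) + F (v - u) := by simp only [map_sub]; abel
  rw [e]
  refine (norm_add₃_le).trans_lt ?_
  rw [norm_sub_rev] at h1
  linarith

variable [CompleteSpace B]

/-- The Hille-Yosida theorem for contraction semigroups. -/
theorem exists_semigroup (hdense : Dense (A.domain : Set B)) (hA : IsDissipative A)
    (hsurj : ∀ c : ℝ, 0 < c → ∀ g : B, ∃ p ∈ A.graph, c • p.1 - p.2 = g) :
    ∃ T : ℝ≥0 → B →L[ℝ] B, IsStronglyContinuousContractionSemigroup T ∧ IsGenerator T A ∧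
      ∀ C : Set B, IsClosed C → Convex ℝ C →
        (∀ c : ℝ, 0 < c → ∀ p ∈ A.graph, c⁻¹ • (c • p.1 - p.2) ∈ C → p.1 ∈ C) →
        ∀ t, ∀ u ∈ C, T t u ∈ C := by
  have hpos : ∀ n : ℕ, (0 : ℝ) < n + 1 := fun n => by positivity
  choose J hJ1 hJ2 hJ3 using fun n : ℕ => hA.exists_resolvent (hpos n) (hsurj _ (hpos n))
  have hcomm : ∀ m n, Commute (J m) (J n) := fun m n =>
    resolvent_commute hA (hpos m) (hpos n) (hJ2 m) (hJ2 n)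
  let X : ℕ → B →L[ℝ] B := fun n => poissonGenerator ((n : ℝ) + 1) (J n)
  -- Yosida approximation
  have hX : ∀ p ∈ A.graph, ∀ n, X n p.1 = J n p.2 := by
    intro p hp n
    have h1 := hJ3 n p hp
    rw [map_sub, map_smul] at h1
    change ((n : ℝ) + 1) • (J n p.1 - p.1) = _
    rw [smul_sub, ← h1]; abel
  -- On the domain, `J_n u - u = J_n (A u) / (n + 1)`; density and uniform contractivity do the
  -- rest.
  have hJlim : ∀ u, Tendsto (fun n => J n u) atTop (𝓝 u) := by
    refine tendsto_clm_of_dense (F := 1) hJ1 ContinuousLinearMap.norm_id_le hdense fun u hu => ?_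
    obtain ⟨w, hw⟩ := LinearPMap.mem_domain_iff.1 hu
    rw [tendsto_iff_norm_sub_tendsto_zero]
    have hlim : Tendsto (fun n : ℕ => ‖w‖ * (1 / ((n : ℝ) + 1))) atTop (𝓝 0) := by
      simpa using tendsto_one_div_add_atTop_nhds_zero_nat.const_mul ‖w‖
    refine squeeze_zero (fun n => norm_nonneg _) (fun n => ?_) hlim
    have h1 := hX _ hw n
    change ((n : ℝ) + 1) • (J n u - u) = J n w at h1
    have h2 : ‖((n : ℝ) + 1) • (J n u - u)‖ ≤ ‖w‖ := by
      rw [h1]; simpa using (J n).le_of_opNorm_le (hJ1 n) w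
    rw [norm_smul, Real.norm_of_nonneg (hpos n).le] at h2
    rw [mul_one_div, le_div_iff₀ (hpos n), mul_comm]
    exact h2
  have hXlim : ∀ p ∈ A.graph, Tendsto (fun n => X n p.1) atTop (𝓝 p.2) := fun p hp => by
    simpa only [hX p hp] using hJlim p.2
  let E : ℝ≥0 → ℕ → B →L[ℝ] B := fun t n => NormedSpace.exp ((t : ℝ) • X n)
  have hE1 : ∀ t n, ‖E t n‖ ≤ 1 := fun t n =>
    ContinuousLinearMap.opNorm_le_bound _ zero_le_one fun u => by
      rw [one_mul]
      exact norm_exp_poissonGenerator_apply_le (hpos n).le (hJ1 n) t.2 u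
  have hcauchy : ∀ t, ∀ u ∈ A.domain, CauchySeq fun n => E t n u := by
    intro t u hu
    obtain ⟨w, hw⟩ := LinearPMap.mem_domain_iff.1 hu
    have h1 := (hXlim _ hw).cauchySeq
    rw [Metric.cauchySeq_iff] at h1 ⊢
    intro ε hε
    obtain ⟨N, hN⟩ := h1 (ε / (t + 1)) (by positivity)
    refine ⟨N, fun m hm n hn => ?_⟩
    have h2 := norm_exp_poissonGenerator_sub_le (hpos m).le (hJ1 m) (hpos n).le (hJ1 n)
      (hcomm m n) t.2 u
    have h3 := hN m hm n hn
    rw [dist_eq_norm] at h3 ⊢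
    refine h2.trans_lt ?_
    rw [lt_div_iff₀ (by positivity)] at h3
    change (t : ℝ) * ‖X m u - X n u‖ < ε
    nlinarith [norm_nonneg (X m u - X n u), t.2]
  have hcauchy' : ∀ t u, CauchySeq fun n => E t n u := by
    intro t u
    rw [Metric.cauchySeq_iff]
    intro ε hε
    obtain ⟨v, hv, hv'⟩ := Metric.dense_iff.1 hdense u (ε / 3) (by positivity)
    obtain ⟨N, hN⟩ := Metric.cauchySeq_iff.1 (hcauchy t v hv') (ε / 3) (by positivity)
    refine ⟨N, fun m hm n hn => ?_⟩
    have h1 : ‖E t m (u - v)‖ ≤ ‖u - v‖ := by simpa using (E t m).le_of_opNorm_le (hE1 t m) (u - v)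
    have h2 : ‖E t n (v - u)‖ ≤ ‖v - u‖ := by simpa using (E t n).le_of_opNorm_le (hE1 t n) (v - u)
    have h3 := hN m hm n hn
    rw [mem_ball_iff_norm] at hv
    rw [dist_eq_norm] at h3 ⊢
    have e : E t m u - E t n u = E t m (u - v) + (E t m v - E t n v) + E t n (v - u) := by
      simp only [map_sub]; abel
    rw [e]
    refine (norm_add₃_le).trans_lt ?_
    rw [norm_sub_rev] at h1
    linarith
  choose f hf using fun t u => cauchySeq_tendsto_of_complete (hcauchy' t u)
  let T : ℝ≥0 → B →L[ℝ] B := fun t => continuousLinearMapOfTendsto (E t) (tendsto_pi_nhds.2 (hf t))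
  have hT : ∀ t u, Tendsto (fun n => E t n u) atTop (𝓝 (T t u)) := hf
  have hT1 : ∀ t, ‖T t‖ ≤ 1 := fun t =>
    ContinuousLinearMap.opNorm_le_bound _ zero_le_one fun u =>
      le_of_tendsto (hT t u).norm (Eventually.of_forall fun n => (E t n).le_of_opNorm_le (hE1 t n) u)
  have hTapply : ∀ t u, ‖T t u‖ ≤ ‖u‖ := fun t u => by simpa using (T t).le_of_opNorm_le (hT1 t) u
  have hTdom : ∀ t, ∀ p ∈ A.graph, ‖T t p.1 - p.1‖ ≤ t * ‖p.2‖ := fun t p hp =>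
    le_of_tendsto_of_tendsto' ((hT t p.1).sub_const p.1).norm
      (((hXlim p hp).norm).const_mul (t : ℝ)) fun n =>
        norm_exp_poissonGenerator_sub_self_le (hpos n).le (hJ1 n) t.2 p.1
  -- Quantitative right differentiability at `0`, inherited from the approximations; below `p'` is
  -- chosen with first component close to `A p.1`.
  have hTder : ∀ t, ∀ p ∈ A.graph, ∀ p' ∈ A.graph,
      ‖T t p.1 - p.1 - (t : ℝ) • p.2‖ ≤ t * (2 * ‖p.2 - p'.1‖ + t * ‖p'.2‖) := by
    intro t p hp p' hp'
    have h1 : Tendsto (fun n => (t : ℝ) * (‖X n p.1 - p.2‖ + 2 * ‖p.2 - p'.1‖ + t * ‖X n p'.1‖)) atTop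
        (𝓝 ((t : ℝ) * (‖p.2 - p.2‖ + 2 * ‖p.2 - p'.1‖ + t * ‖p'.2‖))) :=
      (((((hXlim p hp).sub_const p.2).norm).add_const _).add
        (((hXlim p' hp').norm).const_mul (t : ℝ))).const_mul (t : ℝ)
    simp only [sub_self, norm_zero, zero_add] at h1
    exact le_of_tendsto_of_tendsto' (((hT t p.1).sub_const p.1).sub_const _).norm h1 fun n =>
        norm_exp_poissonGenerator_sub_sub_le (hpos n).le (hJ1 n) t.2 p.1 p.2 p'.1
  have hgen1 : ∀ p ∈ A.graph,
      Tendsto (fun t : ℝ≥0 => (t : ℝ)⁻¹ • (T t p.1 - p.1)) (𝓝[>] 0) (𝓝 p.2) := by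
    intro p hp
    rw [Metric.tendsto_nhds]
    intro ε hε
    obtain ⟨w', hw1, hw2⟩ := Metric.dense_iff.1 hdense p.2 (ε / 4) (by positivity)
    obtain ⟨z, hz⟩ := LinearPMap.mem_domain_iff.1 hw2
    rw [mem_ball_iff_norm, norm_sub_rev] at hw1
    have hev : ∀ᶠ t : ℝ≥0 in 𝓝[>] 0, (t : ℝ) * ‖z‖ < ε / 2 := by
      have : Tendsto (fun t : ℝ≥0 => (t : ℝ) * ‖z‖) (𝓝[>] 0) (𝓝 0) := by
        have h0 : Continuous fun t : ℝ≥0 => (t : ℝ) * ‖z‖ := by fun_prop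
        simpa using (h0.tendsto 0).mono_left nhdsWithin_le_nhds
      exact this.eventually_lt_const (by positivity)
    filter_upwards [hev, self_mem_nhdsWithin] with t ht ht0
    have ht0' : (0 : ℝ) < t := ht0
    have h1 := hTder t p hp _ hz
    have e : (t : ℝ)⁻¹ • (T t p.1 - p.1) - p.2 = (t : ℝ)⁻¹ • (T t p.1 - p.1 - (t : ℝ) • p.2) := by
      rw [smul_sub _ _ ((t : ℝ) • p.2), inv_smul_smul₀ ht0'.ne']
    rw [dist_eq_norm, e, norm_smul, norm_inv, Real.norm_of_nonneg ht0'.le, inv_mul_lt_iff₀ ht0']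
    refine h1.trans_lt (mul_lt_mul_of_pos_left ?_ ht0')
    simp only at hw1 ⊢
    linarith
  refine ⟨T, ⟨?_, ?_, hT1, ?_⟩, ?_, ?_⟩
  · ext u
    refine tendsto_nhds_unique (hT 0 u) ?_
    simp [E]
  · intro s t
    ext u
    refine tendsto_nhds_unique (hT (s + t) u) ?_
    have h1 : ∀ n, E (s + t) n u = E s n (E t n u) := by
      intro n
      change NormedSpace.exp (((s + t : ℝ≥0) : ℝ) • X n) u = _
      rw [NNReal.coe_add, add_smul, exp_add_clm ((Commute.refl (X n)).smul_left _ |>.smul_right _)]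
      rfl
    simp only [h1]
    have h2 : Tendsto (fun n => E s n (E t n u - T t u)) atTop (𝓝 0) := by
      refine squeeze_zero_norm (fun n => ((E s n).le_of_opNorm_le (hE1 s n) _).trans_eq (one_mul _))
        (tendsto_iff_norm_sub_tendsto_zero.1 (hT t u))
    have h3 := h2.add (hT s (T t u))
    simpa using h3
  · refine tendsto_clm_of_dense (F := 1) hT1 ContinuousLinearMap.norm_id_le hdense fun u hu => ?_
    obtain ⟨w, hw⟩ := LinearPMap.mem_domain_iff.1 hu
    rw [tendsto_iff_norm_sub_tendsto_zero]
    refine squeeze_zero (fun t => norm_nonneg _) (fun t => hTdom t _ hw) ?_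
    have h0 : Continuous fun t : ℝ≥0 => (t : ℝ) * ‖w‖ := by fun_prop
    simpa using h0.tendsto 0
  · intro u w
    refine ⟨fun h => hgen1 _ h, fun h => ?_⟩
    -- Solve `(1 - A) p.1 = u - w` in the domain. The defect `z = u - p.1` then satisfies `(T_t z -
    -- z)/t → z`, so it would grow, which contractivity forbids unless `z = 0`.
    obtain ⟨p, hp, hp'⟩ := hsurj 1 one_pos (u - w)
    rw [one_smul] at hp'
    obtain ⟨z, hz⟩ : ∃ z, z = u - p.1 := ⟨_, rfl⟩
    have hzw : w - p.2 = z := by rw [hz, sub_eq_sub_iff_add_eq_add]; rw [sub_eq_sub_iff_add_eq_add] at hp'; rw [add_comm, ← hp', add_comm]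
    have h1 : Tendsto (fun t : ℝ≥0 => (t : ℝ)⁻¹ • (T t z - z)) (𝓝[>] 0) (𝓝 z) := by
      have := h.sub (hgen1 p hp)
      rw [hzw] at this
      refine this.congr fun t => ?_
      rw [hz, map_sub, ← smul_sub]; congr 1; abel
    have hz0 : z = 0 := by
      by_contra hne
      have hpos' : 0 < ‖z‖ := norm_pos_iff.2 hne
      have hneBot : (𝓝[>] (0 : ℝ≥0)).NeBot := inferInstance
      obtain ⟨t, ht, ht0⟩ := ((Metric.tendsto_nhds.1 h1 ‖z‖ hpos').and self_mem_nhdsWithin).exists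
      have ht0' : (0 : ℝ) < t := ht0
      rw [dist_eq_norm] at ht
      have e : (1 + (t : ℝ)) • z = T t z - (t : ℝ) • ((t : ℝ)⁻¹ • (T t z - z) - z) := by
        rw [smul_sub, smul_inv_smul₀ ht0'.ne']; module
      have h2 : ‖(1 + (t : ℝ)) • z‖ < ‖z‖ + t * ‖z‖ := by
        rw [e]
        refine (norm_sub_le _ _).trans_lt (add_lt_add_of_le_of_lt (hTapply t z) ?_)
        rw [norm_smul, Real.norm_of_nonneg ht0'.le]
        exact mul_lt_mul_of_pos_left ht ht0'
      rw [norm_smul, Real.norm_of_nonneg (by positivity)] at h2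
      linarith
    have hu : u = p.1 := sub_eq_zero.1 (hz ▸ hz0)
    have hw : w = p.2 := by rw [← sub_eq_zero, hzw, hz0]
    rw [hu, hw]
    exact hp
  · intro C hC hconv hres t u hu
    refine hC.mem_of_tendsto (hT t u) (Eventually.of_forall fun n => ?_)
    -- `J_n v` solves the resolvent equation with datum `v ∈ C`, so the hypothesis on `C` applies;
    -- the exponential of `J_n - 1` then preserves `C`.
    have hJC : ∀ v ∈ C, J n v ∈ C := by
      intro v hv
      refine hres _ (hpos n) _ (hJ2 n v) ?_
      have e : ((n : ℝ) + 1) • J n v - ((n : ℝ) + 1) • (J n v - v) = ((n : ℝ) + 1) • v := by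
        rw [smul_sub]; abel
      simp only
      rw [e, inv_smul_smul₀ (hpos n).ne']
      exact hv
    have := exp_smul_sub_one_mem hC hconv hJC (a := t * ((n : ℝ) + 1))
      (mul_nonneg t.2 (hpos n).le) hu
    rw [← smul_smul] at this
    exact this

end HilleYosida

/-! ### Dense range of `1 - s A` from essential self-adjointness -/

section SelfAdjoint

variable {H : Type*} [NormedAddCommGroup H] [InnerProductSpace ℝ H] [CompleteSpace H]

lemma IsEssentiallySelfAdjoint.dense_domain {A : H →ₗ.[ℝ] H} (hA : IsEssentiallySelfAdjoint A) :
    Dense (A.domain : Set H) := by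
  have h1 : Dense (A.closure.domain : Set H) := hA.2.dense_domain
  refine dense_closure.1 (h1.mono fun x hx => ?_)
  obtain ⟨w, hw⟩ := LinearPMap.mem_domain_iff.1 hx
  rw [← hA.1.graph_closure_eq_closure_graph] at hw
  have h2 : (x, w) ∈ closure (A.graph : Set (H × H)) := hw
  have h3 := image_closure_subset_closure_image continuous_fst (Set.mem_image_of_mem Prod.fst h2)
  refine closure_mono ?_ h3
  rintro _ ⟨p, hp, rfl⟩
  exact LinearPMap.mem_domain_iff.2 ⟨p.2, hp⟩

/-- A vector `y` orthogonal to the range of `1 - s A` lies in the domain of the adjoint of the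
closure, which is the closure itself, and is an eigenvector there with eigenvalue `s⁻¹ > 0`.
Negativity of the form excludes this unless `y = 0`. -/
lemma IsEssentiallySelfAdjoint.exists_resolvent_approx {A : H →ₗ.[ℝ] H}
    (hA : IsEssentiallySelfAdjoint A) (hneg : ∀ p ∈ A.graph, inner ℝ p.2 p.1 ≤ 0) {s : ℝ}
    (hs : 0 < s) (u : H) {ε : ℝ} (hε : 0 < ε) :
    ∃ p ∈ A.graph, ‖p.1 - s • p.2 - u‖ < ε := by
  have hgr : ∀ p ∈ A.closure.graph, p ∈ closure (A.graph : Set (H × H)) := by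
    intro p hp
    rw [← hA.1.graph_closure_eq_closure_graph] at hp
    exact hp
  have hneg' : ∀ p ∈ A.closure.graph, inner ℝ p.2 p.1 ≤ 0 := by
    intro p hp
    have hcl : IsClosed {p : H × H | inner ℝ p.2 p.1 ≤ 0} :=
      isClosed_le (by fun_prop) continuous_const
    exact closure_minimal (s := (A.graph : Set (H × H))) hneg hcl (hgr p hp)
  let M : H × H →ₗ[ℝ] H := LinearMap.fst ℝ H H - s • LinearMap.snd ℝ H H
  let R : Submodule ℝ H := A.graph.map M
  have hR : R.topologicalClosure = ⊤ := by
    rw [Submodule.topologicalClosure_eq_top_iff, Submodule.eq_bot_iff]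
    intro y hy
    have h1 : ∀ p ∈ A.closure.graph, inner ℝ y (p.1 - s • p.2) = 0 := by
      intro p hp
      have hcl : IsClosed {p : H × H | inner ℝ y (p.1 - s • p.2) = 0} :=
        isClosed_eq (by fun_prop) continuous_const
      refine closure_minimal (s := (A.graph : Set (H × H))) (fun q hq => ?_) hcl (hgr p hp)
      rw [Set.mem_ofPred_eq, real_inner_comm]
      exact (Submodule.mem_orthogonal R y).1 hy (M q) (Submodule.mem_map_of_mem hq)
    have h2 : ∀ x : A.closure.domain, inner ℝ (s⁻¹ • y) (x : H) = inner ℝ y (A.closure x) := by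
      intro x
      have h3 := h1 _ (A.closure.mem_graph x)
      simp only [inner_sub_right, inner_smul_right] at h3
      rw [real_inner_smul_left]
      field_simp
      linarith
    have hd := hA.2.dense_domain
    have hmem : y ∈ A.closure.adjoint.domain :=
      LinearPMap.mem_adjoint_domain_of_exists y ⟨s⁻¹ • y, h2⟩
    have hval : A.closure.adjoint ⟨y, hmem⟩ = s⁻¹ • y :=
      LinearPMap.adjoint_apply_eq hd _ h2
    have h4 : (y, s⁻¹ • y) ∈ A.closure.graph := by
      have h5 := A.closure.adjoint.mem_graph ⟨y, hmem⟩
      rw [hval] at h5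
      change (y, s⁻¹ • y) ∈ _ at h5
      rwa [LinearPMap.isSelfAdjoint_def.1 hA.2] at h5
    have h6 := hneg' _ h4
    simp only [real_inner_smul_left, real_inner_self_eq_norm_sq] at h6
    have h7 : ‖y‖ ^ 2 ≤ 0 := by
      by_contra hcon
      have : 0 < s⁻¹ * ‖y‖ ^ 2 := mul_pos (inv_pos.2 hs) (not_le.1 hcon)
      linarith
    have h8 : ‖y‖ = 0 := by nlinarith [norm_nonneg y]
    exact norm_eq_zero.1 h8
  have hu : u ∈ closure (R : Set H) := by
    rw [← Submodule.topologicalClosure_coe, hR]; trivial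
  obtain ⟨_, ⟨p, hp, rfl⟩, hr'⟩ := Metric.mem_closure_iff.1 hu ε hε
  refine ⟨p, hp, ?_⟩
  rw [dist_comm, dist_eq_norm] at hr'
  exact hr'

end SelfAdjoint

/-! ### Abstract energy estimate for weak solutions -/

section EnergyEstimate

variable {H H' D : Type*} [NormedAddCommGroup H] [InnerProductSpace ℝ H]
  [NormedAddCommGroup H'] [InnerProductSpace ℝ H'] [AddCommGroup D] [Module ℝ D]
  {ι σ : D →ₗ[ℝ] H} {δ γ : D →ₗ[ℝ] H'}

/-- Here `σ` is the velocity operator, `δ` the gradient and `γ` multiplication by `∇Φ₂`, all on test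
functions. A weak solution `u` cannot be used as its own test function; instead the equation is
tested with `f` solving `f - s σ f ≈ u`. Rewriting `u` through `f` produces the energy of `f` plus
terms of good sign and a small error. -/
lemma exists_energy_approx (hsymm : ∀ f, inner ℝ (σ f) (ι f) = -‖δ f‖ ^ 2)
    (hres : ∀ s : ℝ, 0 < s → ∀ (u : H) (ε : ℝ), 0 < ε → ∃ f, ‖ι f - s • σ f - u‖ < ε)
    (hdense : ∀ (u : H) (ε : ℝ), 0 < ε → ∃ f, ‖ι f - u‖ < ε)
    {c : ℝ} (hc : 0 < c) {u : H} {P Z : H'}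
    (heq : ∀ f, inner ℝ u (c • ι f - σ f) - inner ℝ P (γ f) + inner ℝ Z (δ f) = 0) :
    ∃ (f : ℕ → D) (e : ℕ → ℝ), Tendsto (fun n => ι (f n)) atTop (𝓝 u) ∧ Tendsto e atTop (𝓝 0) ∧
      ∀ n, c * ‖ι (f n)‖ ^ 2 + ‖δ (f n)‖ ^ 2 ≤ inner ℝ P (γ (f n)) - inner ℝ Z (δ (f n)) + e n := by
  have hbd : ∀ s : ℝ, 0 < s → ∀ f, ‖ι f‖ ≤ ‖ι f - s • σ f‖ := by
    intro s hs f
    have h1 : ‖ι f‖ ^ 2 ≤ inner ℝ (ι f - s • σ f) (ι f) := by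
      rw [inner_sub_left, real_inner_smul_left, hsymm, real_inner_self_eq_norm_sq]
      nlinarith [mul_nonneg hs.le (sq_nonneg ‖δ f‖)]
    have h2 := h1.trans (real_inner_le_norm _ _)
    rcases (norm_nonneg (ι f)).eq_or_lt with h | h
    · rw [← h]; exact norm_nonneg _
    · rw [sq] at h2
      exact le_of_mul_le_mul_right h2 h
  have hs : ∀ n : ℕ, (0 : ℝ) < 1 / ((n : ℝ) + 1) := fun n => by positivity
  have hs1 : ∀ n : ℕ, 1 / ((n : ℝ) + 1) ≤ 1 := fun n => by
    rw [div_le_one (by positivity)]; linarith [n.cast_nonneg (α := ℝ)]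
  have hlim := tendsto_one_div_add_atTop_nhds_zero_nat (𝕜 := ℝ)
  -- The tolerance is `s²` and not `s`: the residual is paired below with `c f - σ f`, whose norm is
  -- only `O(1/s)`.
  choose f hf using fun n : ℕ => hres _ (hs n) u ((1 / ((n : ℝ) + 1)) ^ 2) (by have := hs n; positivity)
  have hf1 : ∀ n, ‖ι (f n)‖ ≤ ‖u‖ + 1 := by
    intro n
    refine (hbd _ (hs n) _).trans ?_
    have h1 : (1 / ((n : ℝ) + 1)) ^ 2 ≤ 1 := pow_le_one₀ (hs n).le (hs1 n)
    have h2 := norm_add_le u (ι (f n) - (1 / ((n : ℝ) + 1)) • σ (f n) - u)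
    rw [add_sub_cancel] at h2
    linarith [hf n]
  refine ⟨f, fun n => (1 / ((n : ℝ) + 1)) * (c * (‖u‖ + 1) + 2 * (‖u‖ + 1)), ?_, ?_, ?_⟩
  · rw [Metric.tendsto_nhds]
    intro ε hε
    obtain ⟨θ, hθ⟩ := hdense u (ε / 4) (by positivity)
    have h1 : Tendsto (fun n : ℕ => (1 / ((n : ℝ) + 1)) ^ 2 + 1 / ((n : ℝ) + 1) * ‖σ θ‖) atTop
        (𝓝 0) := by simpa using (hlim.pow 2).add (hlim.mul_const ‖σ θ‖)
    filter_upwards [h1.eventually_lt_const (show (0 : ℝ) < ε / 4 by positivity)] with n hn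
    set s := 1 / ((n : ℝ) + 1)
    have h2 : ‖ι (f n) - ι θ‖ ≤ s ^ 2 + ‖ι θ - u‖ + s * ‖σ θ‖ := by
      have e : ι (f n - θ) - s • σ (f n - θ) =
          (ι (f n) - s • σ (f n) - u) - (ι θ - u) + s • σ θ := by
        simp only [map_sub, smul_sub]; abel
      have h3 := hbd s (hs n) (f n - θ)
      rw [e, map_sub] at h3
      refine h3.trans ((norm_add_le _ _).trans ?_)
      rw [norm_smul, Real.norm_of_nonneg (hs n).le]
      gcongr
      refine (norm_sub_le _ _).trans ?_
      gcongr
      exact (hf n).le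
    rw [dist_eq_norm]
    have h4 : ‖ι (f n) - u‖ ≤ ‖ι (f n) - ι θ‖ + ‖ι θ - u‖ := by
      simpa using norm_add_le (ι (f n) - ι θ) (ι θ - u)
    linarith
  · simpa using hlim.mul_const (c * (‖u‖ + 1) + 2 * (‖u‖ + 1))
  · intro n
    set s := 1 / ((n : ℝ) + 1)
    have hsn : 0 < s := hs n
    have hsn1 : s ≤ 1 := hs1 n
    set r := ι (f n) - s • σ (f n) - u with hr
    have hrn : ‖r‖ < s ^ 2 := hf n
    have hu : u = ι (f n) - s • σ (f n) - r := by rw [hr]; abel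
    have hσ : s * ‖c • ι (f n) - σ (f n)‖ ≤ c * (‖u‖ + 1) + 2 * (‖u‖ + 1) := by
      have e : s • (c • ι (f n) - σ (f n)) = (s * c) • ι (f n) + ((u + r) - ι (f n)) := by
        rw [hr, smul_sub, smul_smul]; abel
      have h1 : s * ‖c • ι (f n) - σ (f n)‖ = ‖s • (c • ι (f n) - σ (f n))‖ := by
        rw [norm_smul, Real.norm_of_nonneg hsn.le]
      rw [h1, e]
      refine (norm_add_le _ _).trans ?_
      have h2 : ‖(s * c) • ι (f n)‖ ≤ c * (‖u‖ + 1) := by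
        rw [norm_smul, Real.norm_of_nonneg (by positivity)]
        have := hf1 n
        calc s * c * ‖ι (f n)‖ ≤ 1 * c * (‖u‖ + 1) := by gcongr
          _ = _ := by ring
      have h3 : ‖u + r - ι (f n)‖ ≤ 2 * (‖u‖ + 1) := by
        refine (norm_sub_le _ _).trans ?_
        have h4 := norm_add_le u r
        have h5 : s ^ 2 ≤ 1 := pow_le_one₀ hsn.le hsn1
        linarith [hf1 n]
      linarith
    -- Substituting `u = f - s σ f - r`; the extra terms `s c ‖δ f‖²` and `s ‖σ f‖²` are nonnegative
    -- and are dropped at the end.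
    have hmain : inner ℝ u (c • ι (f n) - σ (f n)) =
        c * ‖ι (f n)‖ ^ 2 + (1 + s * c) * ‖δ (f n)‖ ^ 2 + s * ‖σ (f n)‖ ^ 2 -
          inner ℝ r (c • ι (f n) - σ (f n)) := by
      have hs2 : inner ℝ (ι (f n)) (σ (f n)) = -‖δ (f n)‖ ^ 2 := by rw [real_inner_comm, hsymm]
      conv_lhs => rw [hu]
      simp only [inner_sub_left, inner_sub_right, real_inner_smul_left, inner_smul_right, hsymm,
        real_inner_self_eq_norm_sq, hs2]
      ring
    have hr2 : inner ℝ r (c • ι (f n) - σ (f n)) ≤ s * (c * (‖u‖ + 1) + 2 * (‖u‖ + 1)) := by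
      refine (real_inner_le_norm _ _).trans ?_
      calc ‖r‖ * ‖c • ι (f n) - σ (f n)‖ ≤ s ^ 2 * ‖c • ι (f n) - σ (f n)‖ := by gcongr
        _ = s * (s * ‖c • ι (f n) - σ (f n)‖) := by ring
        _ ≤ _ := by gcongr
    have h1 := heq (f n)
    have h2 : 0 ≤ s * c * ‖δ (f n)‖ ^ 2 := by positivity
    have h3 : 0 ≤ s * ‖σ (f n)‖ ^ 2 := by positivity
    linarith

/-- The basic energy estimate; `τ` stands for multiplication by a constant vector, `γ` for
multiplication by a vector field that is form bounded. -/
lemma energy_estimate (hsymm : ∀ f, inner ℝ (σ f) (ι f) = -‖δ f‖ ^ 2)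
    (hres : ∀ s : ℝ, 0 < s → ∀ (u : H) (ε : ℝ), 0 < ε → ∃ f, ‖ι f - s • σ f - u‖ < ε)
    (hdense : ∀ (u : H) (ε : ℝ), 0 < ε → ∃ f, ‖ι f - u‖ < ε)
    {C : ℝ} (hC : 0 < C) (hkato : ∀ f, ‖γ f‖ ^ 2 ≤ C * (‖δ f‖ ^ 2 + ‖ι f‖ ^ 2))
    {c : ℝ} (hc : 0 < c) {κ : ℝ} (hκ : 0 < κ) (hκ1 : κ * C ≤ 1 / 2) (hκ2 : κ * C ≤ c / 2)
    {u : H} {Q R Z : H'}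
    (heq : ∀ f, inner ℝ u (c • ι f - σ f) - inner ℝ (Q - R) (γ f) + inner ℝ Z (δ f) = 0)
    {τ : H →L[ℝ] H'} (hτ : ∀ f, inner ℝ (τ (ι f)) (δ f) = 1 / 2 * inner ℝ (τ (ι f)) (γ f))
    {r t : H} (hr : ∀ f, inner ℝ R (γ f) = inner ℝ r (ι f))
    (ht : ∀ f, inner ℝ (τ u) (γ f) = inner ℝ t (ι f)) :
    c / 2 * ‖u‖ ^ 2 + inner ℝ r u + 1 / 2 * inner ℝ t u ≤
      1 / 2 * ‖Z - τ u‖ ^ 2 + 1 / (4 * κ) * ‖Q‖ ^ 2 := by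
  obtain ⟨f, e, hf, he, hineq⟩ := exists_energy_approx hsymm hres hdense hc heq
  have hfn : Tendsto (fun n => ‖ι (f n)‖) atTop (𝓝 ‖u‖) := hf.norm
  obtain ⟨M, hM⟩ : ∃ M, ∀ n, ‖ι (f n)‖ ^ 2 ≤ M :=
    (hfn.pow 2).bddAbove_range.imp fun M hM n => hM ⟨n, rfl⟩
  obtain ⟨E, hE⟩ : ∃ E, ∀ n, e n ≤ E := he.bddAbove_range.imp fun M hM n => hM ⟨n, rfl⟩
  have young : ∀ {k : ℝ}, 0 < k → ∀ x y : H', inner ℝ x y ≤ k * ‖y‖ ^ 2 + 1 / (4 * k) * ‖x‖ ^ 2 := by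
    intro k hk x y
    refine (real_inner_le_norm _ _).trans ?_
    have h1 : 0 ≤ (2 * k * ‖y‖ - ‖x‖) ^ 2 / (4 * k) := by positivity
    have h2 : (2 * k * ‖y‖ - ‖x‖) ^ 2 / (4 * k) =
        k * ‖y‖ ^ 2 + 1 / (4 * k) * ‖x‖ ^ 2 - ‖x‖ * ‖y‖ := by field_simp; ring
    linarith
  -- A crude bound first: with Young constants `1/(4C)` and `1/4` half of `‖δ f‖²` is absorbed.
  -- Boundedness of `δ (f n)` and `γ (f n)` is what allows `u` and `f n` to be interchanged in the
  -- limit.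
  have hδ : ∀ n, ‖δ (f n)‖ ^ 2 ≤ M + 2 * (C * ‖Q - R‖ ^ 2 + ‖Z‖ ^ 2 + E) := by
    intro n
    have h1 := young (show 0 < 1 / (4 * C) by positivity) (Q - R) (γ (f n))
    have h2 := young (show (0 : ℝ) < 1 / 4 by norm_num) (-Z) (δ (f n))
    have h3 : 1 / (4 * C) * ‖γ (f n)‖ ^ 2 ≤ 1 / 4 * (‖δ (f n)‖ ^ 2 + ‖ι (f n)‖ ^ 2) := by
      calc 1 / (4 * C) * ‖γ (f n)‖ ^ 2 ≤ 1 / (4 * C) * (C * (‖δ (f n)‖ ^ 2 + ‖ι (f n)‖ ^ 2)) := by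
            gcongr; exact hkato _
        _ = _ := by field_simp
    have h4 : 1 / (4 * (1 / (4 * C))) * ‖Q - R‖ ^ 2 = C * ‖Q - R‖ ^ 2 := by field_simp
    rw [norm_neg, inner_neg_left] at h2
    rw [h4] at h1
    have h5 := hineq n
    have h6 : 0 ≤ c * ‖ι (f n)‖ ^ 2 := by positivity
    linarith [hM n, hE n, sq_nonneg ‖ι (f n)‖]
  set M₁ := M + 2 * (C * ‖Q - R‖ ^ 2 + ‖Z‖ ^ 2 + E)
  have hγ : ∀ n, ‖γ (f n)‖ ^ 2 ≤ C * (M₁ + M) := fun n =>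
    (hkato _).trans (by have := hδ n; have := hM n; gcongr)
  have hzero : ∀ {b : ℕ → H'} {M : ℝ}, (∀ n, ‖b n‖ ^ 2 ≤ M) →
      Tendsto (fun n => inner ℝ (τ (u - ι (f n))) (b n)) atTop (𝓝 0) := by
    intro b M hb
    have h1 : Tendsto (fun n => ‖τ (u - ι (f n))‖ * √M) atTop (𝓝 0) := by
      have h2 : Tendsto (fun n => τ (u - ι (f n))) atTop (𝓝 (τ (u - u))) :=
        (τ.continuous.tendsto _).comp (hf.const_sub u)
      rw [sub_self, map_zero] at h2
      simpa using h2.norm.mul_const (√M)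
    refine squeeze_zero_norm (fun n => (norm_inner_le_norm _ _).trans ?_) h1
    gcongr
    exact Real.le_sqrt_of_sq_le (hb n)
  -- The term `⟨τ u, δ f⟩` has no sign. Up to errors tending to zero it is `⟨τ f, δ f⟩ = ½ ⟨τ f, γ
  -- f⟩`, and hence `½ ⟨t, f⟩`, which converges.
  have hlim : Tendsto (fun n => c / 2 * ‖ι (f n)‖ ^ 2 + inner ℝ r (ι (f n)) +
      1 / 2 * (inner ℝ t (ι (f n)) - inner ℝ (τ (u - ι (f n))) (γ (f n))) +
      inner ℝ (τ (u - ι (f n))) (δ (f n)) - e n) atTop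
      (𝓝 (c / 2 * ‖u‖ ^ 2 + inner ℝ r u + 1 / 2 * (inner ℝ t u - 0) + 0 - 0)) :=
    (((((hfn.pow 2).const_mul _).add (tendsto_const_nhds.inner hf)).add
      (((tendsto_const_nhds.inner hf).sub (hzero hγ)).const_mul _)).add (hzero hδ)).sub he
  simp only [sub_zero, add_zero] at hlim
  refine le_of_tendsto hlim (Eventually.of_forall fun n => ?_)
  have h1 := hineq n
  have h2 := young hκ Q (γ (f n))
  have h3 := young (show (0 : ℝ) < 1 / 2 by norm_num) (-(Z - τ u)) (δ (f n))
  have h4 := hτ (f n)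
  have h5 := ht (f n)
  -- The two conditions on `κ` split the form bound into half of the gradient energy and half of the
  -- zero-order term; the other half of `‖δ f‖²` absorbs `Z - τ u`.
  have h6 : κ * ‖γ (f n)‖ ^ 2 ≤ 1 / 2 * ‖δ (f n)‖ ^ 2 + c / 2 * ‖ι (f n)‖ ^ 2 := by
    calc κ * ‖γ (f n)‖ ^ 2 ≤ κ * (C * (‖δ (f n)‖ ^ 2 + ‖ι (f n)‖ ^ 2)) := by gcongr; exact hkato _
      _ = κ * C * ‖δ (f n)‖ ^ 2 + κ * C * ‖ι (f n)‖ ^ 2 := by ring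
      _ ≤ _ := by gcongr
  have h7 : (1 : ℝ) / (4 * (1 / 2)) = 1 / 2 := by norm_num
  rw [norm_neg, inner_neg_left, h7, inner_sub_left] at h3
  rw [inner_sub_left, hr] at h1
  simp only [map_sub, inner_sub_left] at *
  linarith

end EnergyEstimate

/-! ### Standard mollifiers on `ℝ^d` -/

section Mollification

variable {d : ℕ}

/-- The bump functions from which the standard mollifier is built. -/
def mollBump (d n : ℕ) : ContDiffBump (0 : Rd d) where
  rIn := 1 / (2 * ((n : ℝ) + 1))
  rOut := 1 / ((n : ℝ) + 1)
  rIn_pos := by positivity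
  rIn_lt_rOut := by
    apply one_div_lt_one_div_of_lt <;> linarith [n.cast_nonneg (α := ℝ)]

/-- The standard mollifier, supported in the ball of radius `1 / (n + 1)`. -/
def mollKernel (n : ℕ) : Rd d → ℝ := (mollBump d n).normed volume

lemma mollKernel_nonneg (n : ℕ) (x : Rd d) : 0 ≤ mollKernel n x := (mollBump d n).nonneg_normed x

lemma contDiff_mollKernel (n : ℕ) : ContDiff ℝ ∞ (mollKernel n : Rd d → ℝ) :=
  (mollBump d n).contDiff_normed

lemma continuous_mollKernel (n : ℕ) : Continuous (mollKernel n : Rd d → ℝ) :=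
  (contDiff_mollKernel n).continuous

lemma hasCompactSupport_mollKernel (n : ℕ) : HasCompactSupport (mollKernel n : Rd d → ℝ) :=
  (mollBump d n).hasCompactSupport_normed

lemma tsupport_mollKernel (n : ℕ) :
    tsupport (mollKernel n : Rd d → ℝ) = Metric.closedBall 0 (1 / ((n : ℝ) + 1)) :=
  (mollBump d n).tsupport_normed_eq

lemma integrable_mollKernel (n : ℕ) : Integrable (mollKernel n : Rd d → ℝ) :=
  (mollBump d n).integrable_normed

lemma integral_mollKernel (n : ℕ) : ∫ x : Rd d, mollKernel n x = 1 :=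
  (mollBump d n).integral_normed

lemma mollKernel_eq_zero {n : ℕ} {x : Rd d} (hx : 1 / ((n : ℝ) + 1) < ‖x‖) : mollKernel n x = 0 := by
  refine image_eq_zero_of_notMem_tsupport ?_
  rw [tsupport_mollKernel, mem_closedBall_zero_iff]
  exact not_le.2 hx

/-- Convolution with the standard mollifier. -/
def mollify (n : ℕ) (f : Rd d → ℝ) : Rd d → ℝ :=
  convolution (mollKernel n) f (ContinuousLinearMap.lsmul ℝ ℝ) volume

lemma mollify_apply (n : ℕ) (f : Rd d → ℝ) (x : Rd d) :
    mollify n f x = ∫ y, mollKernel n (x - y) * f y := by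
  rw [mollify, convolution_eq_swap]; rfl

/-- The probability measure whose density is the standard mollifier. -/
def mollMeasure (d n : ℕ) : Measure (Rd d) :=
  volume.withDensity fun z => ENNReal.ofReal (mollKernel n z)

instance (n : ℕ) : IsProbabilityMeasure (mollMeasure d n) where
  measure_univ := by
    rw [mollMeasure, withDensity_apply _ MeasurableSet.univ, Measure.restrict_univ,
      ← ofReal_integral_eq_lintegral_ofReal (integrable_mollKernel n)
        (Eventually.of_forall (mollKernel_nonneg n)), integral_mollKernel, ENNReal.ofReal_one]

lemma mollMeasure_absolutelyContinuous (n : ℕ) : mollMeasure d n ≪ volume :=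
  withDensity_absolutelyContinuous _ _

lemma measurable_ofReal_mollKernel (n : ℕ) :
    Measurable fun z : Rd d => ENNReal.ofReal (mollKernel n z) :=
  (continuous_mollKernel n).measurable.ennreal_ofReal

lemma ae_mollMeasure_norm_le (n : ℕ) : ∀ᵐ z ∂(mollMeasure d n), ‖z‖ ≤ 1 / ((n : ℝ) + 1) := by
  rw [mollMeasure, ae_withDensity_iff (measurable_ofReal_mollKernel n)]
  refine Eventually.of_forall fun z hz => ?_
  by_contra hcon
  exact hz (by rw [mollKernel_eq_zero (not_le.1 hcon), ENNReal.ofReal_zero])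

lemma integral_mollMeasure (n : ℕ) (g : Rd d → ℝ) :
    ∫ z, g z ∂(mollMeasure d n) = ∫ z, mollKernel n z * g z := by
  rw [mollMeasure, integral_withDensity_eq_integral_toReal_smul (measurable_ofReal_mollKernel n)
    (Eventually.of_forall fun _ => ENNReal.ofReal_lt_top)]
  simp [ENNReal.toReal_ofReal (mollKernel_nonneg n _)]

lemma mollify_eq_integral_mollMeasure (n : ℕ) (f : Rd d → ℝ) (x : Rd d) :
    mollify n f x = ∫ z, f (x - z) ∂(mollMeasure d n) := by
  rw [integral_mollMeasure]; rfl

lemma contDiff_mollify (n : ℕ) {f : Rd d → ℝ} (hf : LocallyIntegrable f) :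
    ContDiff ℝ ∞ (mollify n f) :=
  (hasCompactSupport_mollKernel n).contDiff_convolution_left _ (contDiff_mollKernel n) hf

lemma ae_tendsto_mollify {f : Rd d → ℝ} (hf : LocallyIntegrable f) :
    ∀ᵐ x, Tendsto (fun n => mollify n f x) atTop (𝓝 (f x)) := by
  -- `K = 2` is the ratio of the outer to the inner radius of the bumps.
  refine ContDiffBump.ae_convolution_tendsto_right_of_locallyIntegrable (K := 2)
    (φ := mollBump d) tendsto_one_div_add_atTop_nhds_zero_nat (Eventually.of_forall fun n => ?_) hf
  change 1 / ((n : ℝ) + 1) ≤ 2 * (1 / (2 * ((n : ℝ) + 1)))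
  rw [mul_one_div, mul_comm 2 ((n : ℝ) + 1), ← div_div]
  field_simp
  rfl

lemma fderiv_mollify (n : ℕ) {f : Rd d → ℝ} (hf : LocallyIntegrable f) (x e : Rd d) :
    fderiv ℝ (mollify n f) x e = ∫ y, fderiv ℝ (mollKernel n) (x - y) e * f y := by
  have h1 := (hasCompactSupport_mollKernel n).hasFDerivAt_convolution_left
    (ContinuousLinearMap.lsmul ℝ ℝ) ((contDiff_mollKernel (d := d) n).of_le (by simp)) hf x
  have h2 : Integrable fun y => (ContinuousLinearMap.precompL (Rd d) (ContinuousLinearMap.lsmul ℝ ℝ))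
      (fderiv ℝ (mollKernel n) (x - y)) (f y) := by
    have := ((hasCompactSupport_mollKernel (d := d) n).fderiv ℝ).convolutionExists_left
      (ContinuousLinearMap.precompL (Rd d) (ContinuousLinearMap.lsmul ℝ ℝ))
      ((contDiff_mollKernel n).continuous_fderiv (by simp)) hf x
    exact this.integrable_swap
  rw [mollify, h1.fderiv, convolution_eq_swap, ContinuousLinearMap.integral_apply h2]
  rfl

lemma tendsto_eLpNorm_translate {p : ℝ≥0∞} (hp : 1 ≤ p) (hp' : p ≠ ⊤) {f : Rd d → ℝ}
    (hf : MemLp f p) :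
    Tendsto (fun z => eLpNorm (fun x => f (x - z) - f x) p volume) (𝓝 0) (𝓝 0) := by
  have : Fact (1 ≤ p) := ⟨hp⟩
  have hmp : ∀ z : Rd d, MeasurePreserving (fun x => x - z) volume volume :=
    fun z => measurePreserving_sub_right volume z
  let g : Rd d → C(Rd d, Rd d) := fun z => ⟨fun x => x - z, by fun_prop⟩
  have hg : Continuous g := ContinuousMap.continuous_of_continuous_uncurry _ (by
    change Continuous fun q : Rd d × Rd d => q.2 - q.1
    fun_prop)
  have h1 := (tendsto_const_nhds (x := hf.toLp f)).compMeasurePreservingLp (hg.tendsto 0)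
    hmp (hmp 0) hp'
  have e0 : Lp.compMeasurePreserving (g 0) (hmp 0) (hf.toLp f) = hf.toLp f := by
    rw [Lp.toLp_compMeasurePreserving]
    exact MemLp.toLp_congr _ _ (Eventually.of_forall fun x => by simp [g])
  rw [e0, tendsto_iff_edist_tendsto_0] at h1
  refine h1.congr fun z => ?_
  rw [Lp.toLp_compMeasurePreserving, Lp.edist_toLp_toLp]
  rfl

lemma tendsto_lintegral_mollMeasure_of_tendsto {F : Rd d → ℝ≥0∞} (hF : Tendsto F (𝓝 0) (𝓝 0)) :
    Tendsto (fun n => ∫⁻ z, F z ∂(mollMeasure d n)) atTop (𝓝 0) := by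
  rw [ENNReal.tendsto_nhds_zero]
  intro ε hε
  obtain ⟨r, hr, hr'⟩ := Metric.eventually_nhds_iff.1 (ENNReal.tendsto_nhds_zero.1 hF ε hε)
  have h1 := (tendsto_one_div_add_atTop_nhds_zero_nat (𝕜 := ℝ)).eventually_lt_const hr
  filter_upwards [h1] with n hn
  calc ∫⁻ z, F z ∂(mollMeasure d n) ≤ ∫⁻ _, ε ∂(mollMeasure d n) := by
        refine lintegral_mono_ae ?_
        filter_upwards [ae_mollMeasure_norm_le n] with z hz
        exact hr' (by rw [dist_zero_right]; exact hz.trans_lt hn)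
    _ = ε := by simp

/-- The averaged translation error of an `L^p` function tends to zero. -/
lemma tendsto_lintegral_translate {p : ℝ≥0∞} (hp : 1 ≤ p) (hp' : p ≠ ⊤) {f : Rd d → ℝ}
    (hf : MemLp f p) :
    Tendsto (fun n => ∫⁻ x, ∫⁻ z, ‖f (x - z) - f x‖ₑ ^ p.toReal ∂(mollMeasure d n)) atTop (𝓝 0) := by
  have hp0 : p ≠ 0 := (one_pos.trans_le hp).ne'
  have hpr : 0 < p.toReal := ENNReal.toReal_pos hp0 hp'
  have h1 : Tendsto (fun z => eLpNorm (fun x => f (x - z) - f x) p volume ^ p.toReal) (𝓝 0) (𝓝 0) := by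
    have := (tendsto_eLpNorm_translate hp hp' hf).ennrpow_const p.toReal
    rwa [ENNReal.zero_rpow_of_pos hpr] at this
  have h2 := tendsto_lintegral_mollMeasure_of_tendsto h1
  refine h2.congr fun n => ?_
  rw [lintegral_lintegral_swap]
  · refine lintegral_congr fun z => ?_
    rw [eLpNorm_eq_lintegral_rpow_enorm_toReal hp0 hp', ← ENNReal.rpow_mul, one_div,
      inv_mul_cancel₀ hpr.ne', ENNReal.rpow_one]
  · have hm : AEStronglyMeasurable f volume := hf.1
    have hq : Measure.QuasiMeasurePreserving (fun q : Rd d × Rd d => q.1 - q.2)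
        (volume.prod (mollMeasure d n)) volume :=
      (quasiMeasurePreserving_sub volume volume).mono_left
        (Measure.AbsolutelyContinuous.rfl.prod (mollMeasure_absolutelyContinuous n))
    exact (((hm.comp_quasiMeasurePreserving hq).sub hm.comp_fst).enorm.pow_const _)

/-- Jensen's inequality: `mollify n f x - f x` is the mean of `f (x - z) - f x` under the
probability measure with density the mollifier, and `L^p` norms increase with `p` there. -/
lemma enorm_mollify_sub_rpow_le {p : ℝ≥0∞} (hp : 1 ≤ p) (hp' : p ≠ ⊤) (n : ℕ) {f : Rd d → ℝ}
    (hf : LocallyIntegrable f) (x : Rd d) :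
    ‖mollify n f x - f x‖ₑ ^ p.toReal ≤ ∫⁻ z, ‖f (x - z) - f x‖ₑ ^ p.toReal ∂(mollMeasure d n) := by
  have hp0 : p ≠ 0 := (one_pos.trans_le hp).ne'
  have hpr : 0 < p.toReal := ENNReal.toReal_pos hp0 hp'
  have hm : AEStronglyMeasurable (fun z => f (x - z) - f x) (mollMeasure d n) := by
    have h1 : AEStronglyMeasurable (fun z => f (x - z)) volume :=
      hf.aestronglyMeasurable.comp_measurePreserving (Measure.measurePreserving_sub_left volume x)
    exact (h1.mono_ac (mollMeasure_absolutelyContinuous n)).sub aestronglyMeasurable_const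
  have hint : Integrable (fun z => f (x - z)) (mollMeasure d n) := by
    rw [mollMeasure, integrable_withDensity_iff_integrable_smul₀'
      (measurable_ofReal_mollKernel n).aemeasurable (Eventually.of_forall fun _ => ENNReal.ofReal_lt_top)]
    have := (hasCompactSupport_mollKernel (d := d) n).convolutionExists_left
      (ContinuousLinearMap.lsmul ℝ ℝ) (continuous_mollKernel n) hf x
    refine this.congr (Eventually.of_forall fun z => ?_)
    simp [ENNReal.toReal_ofReal (mollKernel_nonneg n _)]
  have e : mollify n f x - f x = ∫ z, (f (x - z) - f x) ∂(mollMeasure d n) := by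
    rw [mollify_eq_integral_mollMeasure, integral_sub hint (integrable_const _)]; simp
  have h1 : ‖mollify n f x - f x‖ₑ ≤ eLpNorm (fun z => f (x - z) - f x) p (mollMeasure d n) := by
    rw [e]
    refine (enorm_integral_le_lintegral_enorm _).trans ?_
    rw [← eLpNorm_one_eq_lintegral_enorm]
    exact eLpNorm_le_eLpNorm_of_exponent_le hp hm
  refine (ENNReal.rpow_le_rpow h1 hpr.le).trans_eq ?_
  rw [eLpNorm_eq_lintegral_rpow_enorm_toReal hp0 hp', ← ENNReal.rpow_mul, one_div,
      inv_mul_cancel₀ hpr.ne', ENNReal.rpow_one]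

lemma tendsto_eLpNorm_mollify_sub {p : ℝ≥0∞} (hp : 1 ≤ p) (hp' : p ≠ ⊤) {f : Rd d → ℝ}
    (hf : MemLp f p) : Tendsto (fun n => eLpNorm (mollify n f - f) p volume) atTop (𝓝 0) := by
  have hp0 : p ≠ 0 := (one_pos.trans_le hp).ne'
  have hpr : 0 < p.toReal := ENNReal.toReal_pos hp0 hp'
  have h1 := (tendsto_lintegral_translate hp hp' hf).ennrpow_const (1 / p.toReal)
  rw [ENNReal.zero_rpow_of_pos (by positivity)] at h1
  refine tendsto_of_tendsto_of_tendsto_of_le_of_le tendsto_const_nhds h1 (fun _ => zero_le) fun n => ?_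
  rw [eLpNorm_eq_lintegral_rpow_enorm_toReal hp0 hp']
  refine ENNReal.rpow_le_rpow (lintegral_mono fun x => ?_) (by positivity)
  exact enorm_mollify_sub_rpow_le hp hp' n (hf.locallyIntegrable hp) x

end Mollification

/-! ### Products of boundedly and `L¹`-convergent sequences -/

section BoundedConvergence

variable {X : Type*} [MeasurableSpace X] {μ : Measure X}

/-- Write `a_n b_n = a_n b₀ + a_n (b_n - b₀)`: dominated convergence for the first term, the uniform
bound on `a_n` for the second. -/
lemma tendsto_integral_mul_of_bounded {a : ℕ → X → ℝ} {a₀ : X → ℝ} {b : ℕ → X → ℝ} {b₀ : X → ℝ}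
    {M : ℝ} (ha : ∀ n, AEStronglyMeasurable (a n) μ) (hM : ∀ᶠ n in atTop, ∀ᵐ x ∂μ, |a n x| ≤ M)
    (hlim : ∀ᵐ x ∂μ, Tendsto (fun n => a n x) atTop (𝓝 (a₀ x))) (hb₀ : Integrable b₀ μ)
    (hb : ∀ n, Integrable (b n) μ)
    (hb' : Tendsto (fun n => eLpNorm (b n - b₀) 1 μ) atTop (𝓝 0)) :
    Tendsto (fun n => ∫ x, a n x * b n x ∂μ) atTop (𝓝 (∫ x, a₀ x * b₀ x ∂μ)) := by
  have h1 : Tendsto (fun n => ∫ x, a n x * b₀ x ∂μ) atTop (𝓝 (∫ x, a₀ x * b₀ x ∂μ)) := by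
    refine tendsto_integral_filter_of_dominated_convergence (fun x => M * |b₀ x|)
      (Eventually.of_forall fun n => (ha n).mul hb₀.1) ?_ (hb₀.abs.const_mul M) ?_
    · filter_upwards [hM] with n hn
      filter_upwards [hn] with x hx
      rw [norm_mul, Real.norm_eq_abs, Real.norm_eq_abs]
      gcongr
    · filter_upwards [hlim] with x hx using hx.mul_const _
  have h2 : Tendsto (fun n => ∫ x, a n x * (b n x - b₀ x) ∂μ) atTop (𝓝 0) := by
    have h3 : Tendsto (fun n => |M| * ∫ x, |b n x - b₀ x| ∂μ) atTop (𝓝 0) := by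
      have h4 : Tendsto (fun n => (eLpNorm (b n - b₀) 1 μ).toReal) atTop (𝓝 0) := by
        exact (ENNReal.tendsto_toReal ENNReal.zero_ne_top).comp hb'
      have h5 : ∀ n, (eLpNorm (b n - b₀) 1 μ).toReal = ∫ x, |b n x - b₀ x| ∂μ := by
        intro n
        rw [eLpNorm_one_eq_lintegral_enorm, ← integral_norm_eq_lintegral_enorm ((hb n).sub hb₀).1]
        rfl
      simpa [h5] using h4.const_mul |M|
    refine squeeze_zero_norm' ?_ h3
    filter_upwards [hM] with n hn
    refine (norm_integral_le_integral_norm _).trans ?_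
    rw [← integral_const_mul]
    have hi : Integrable (fun x => |M| * |b n x - b₀ x|) μ := (((hb n).sub hb₀).abs).const_mul _
    refine integral_mono_of_nonneg (Eventually.of_forall fun x => norm_nonneg _) hi ?_
    filter_upwards [hn] with x hx
    simp only [norm_mul, Real.norm_eq_abs]
    exact mul_le_mul_of_nonneg_right (hx.trans (le_abs_self M)) (abs_nonneg _)
  have h3 := h1.add h2
  rw [add_zero] at h3
  refine h3.congr' ?_
  filter_upwards [hM] with n hn
  have hi : Integrable (fun x => a n x * b₀ x) μ := hb₀.bdd_mul (ha n) (c := M) hn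
  have hi' : Integrable (fun x => a n x * (b n x - b₀ x)) μ :=
    ((hb n).sub hb₀).bdd_mul (ha n) (c := M) hn
  rw [← integral_add hi hi']
  exact integral_congr_ae (Eventually.of_forall fun x => by ring)

end BoundedConvergence

/-! ### Chain and product rule for weak derivatives -/

section WeakDerivatives

variable {d : ℕ}

lemma setIntegral_eq_integral_of_tsupport_subset {Ω : Set (Rd d)} {g θ : Rd d → ℝ}
    (hθ : tsupport θ ⊆ Ω) : ∫ x in Ω, g x * θ x = ∫ x, g x * θ x :=
  setIntegral_eq_integral_of_forall_compl_eq_zero fun x hx => by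
    rw [image_eq_zero_of_notMem_tsupport fun h => hx (hθ h), mul_zero]

lemma tsupport_fderiv_apply_subset (φ : Rd d → ℝ) (e : Rd d) :
    tsupport (fun x => fderiv ℝ φ x e) ⊆ tsupport φ := by
  refine closure_minimal (fun x hx => ?_) (isClosed_tsupport φ)
  refine support_fderiv_subset ℝ fun h => hx ?_
  change fderiv ℝ φ x e = 0
  rw [h]; rfl

lemma IsWeakPartial.integral_eq {Ω : Set (Rd d)} {i : Fin d} {u w : Rd d → ℝ}
    (h : IsWeakPartial Ω i u w) {φ : Rd d → ℝ} (hφ : φ ∈ testFunctions Ω) :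
    ∫ x, u x * fderiv ℝ φ x (EuclideanSpace.single i 1) = -∫ x, w x * φ x := by
  rw [← setIntegral_eq_integral_of_tsupport_subset (hφ.2.2),
    ← setIntegral_eq_integral_of_tsupport_subset
      ((tsupport_fderiv_apply_subset φ _).trans hφ.2.2)]
  exact h.2.2 φ hφ

lemma LocallyIntegrableOn.integrable_indicator {Ω K : Set (Rd d)} {u : Rd d → ℝ}
    (hu : LocallyIntegrableOn u Ω) (hK : IsCompact K) (hKΩ : K ⊆ Ω) : Integrable (K.indicator u) :=
  (integrable_indicator_iff hK.measurableSet).2 (hu.integrableOn_compact_subset hKΩ hK)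

lemma integrable_mul_testFunction {Ω : Set (Rd d)} {u φ : Rd d → ℝ}
    (hu : LocallyIntegrableOn u Ω) (hφ : Continuous φ) (hφ' : HasCompactSupport φ)
    (hφΩ : tsupport φ ⊆ Ω) : Integrable fun x => u x * φ x := by
  have h1 := LocallyIntegrableOn.integrable_indicator hu hφ' hφΩ
  obtain ⟨C, hC⟩ := hφ.bounded_above_of_compact_support hφ'
  have h2 := h1.bdd_mul (f := φ) hφ.aestronglyMeasurable (c := C) (Eventually.of_forall hC)
  refine h2.congr (Eventually.of_forall fun x => ?_)
  by_cases hx : x ∈ tsupport φ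
  · simp [hx, mul_comm]
  · simp [image_eq_zero_of_notMem_tsupport hx]

lemma tendsto_mollRadius_le {δ : ℝ} (hδ : 0 < δ) : ∀ᶠ n : ℕ in atTop, 1 / ((n : ℝ) + 1) ≤ δ :=
  ((tendsto_one_div_add_atTop_nhds_zero_nat (𝕜 := ℝ)).eventually_lt_const hδ).mono fun _ h => h.le

lemma tsupport_mollKernel_sub_subset (n : ℕ) (x : Rd d) :
    tsupport (fun y => mollKernel n (x - y)) ⊆ Metric.closedBall x (1 / ((n : ℝ) + 1)) := by
  refine closure_minimal (fun y hy => ?_) Metric.isClosed_closedBall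
  by_contra hcon
  rw [Metric.mem_closedBall, dist_comm, dist_eq_norm, not_le] at hcon
  exact hy (mollKernel_eq_zero hcon)

lemma mollKernel_sub_mem_testFunctions {n : ℕ} {x : Rd d} {Ω : Set (Rd d)}
    (hx : Metric.closedBall x (1 / ((n : ℝ) + 1)) ⊆ Ω) :
    (fun y => mollKernel n (x - y)) ∈ testFunctions Ω := by
  refine ⟨(contDiff_mollKernel n).comp (contDiff_const.sub contDiff_id), ?_,
    (tsupport_mollKernel_sub_subset n x).trans hx⟩
  exact HasCompactSupport.of_support_subset_isCompact (isCompact_closedBall x (1 / ((n : ℝ) + 1)))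
    ((subset_tsupport _).trans (tsupport_mollKernel_sub_subset n x))

lemma fderiv_mollKernel_sub (n : ℕ) (x y e : Rd d) :
    fderiv ℝ (fun y => mollKernel n (x - y)) y e = -fderiv ℝ (mollKernel n) (x - y) e := by
  have h1 : HasFDerivAt (mollKernel n) (fderiv ℝ (mollKernel n) (x - y)) (x - y) :=
    ((contDiff_mollKernel (d := d) n).differentiable (by simp) _).hasFDerivAt
  have h2 := h1.comp y ((hasFDerivAt_id y).const_sub x)
  have h3 : HasFDerivAt (fun y => mollKernel n (x - y)) _ y := h2
  rw [h3.fderiv]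
  simp

/-- Mollification commutes with weak differentiation. -/
lemma IsWeakPartial.fderiv_mollify_indicator {Ω K : Set (Rd d)} {i : Fin d} {u w : Rd d → ℝ}
    (h : IsWeakPartial Ω i u w) (hK : IsCompact K) (hKΩ : K ⊆ Ω) {n : ℕ} {x : Rd d}
    (hx : Metric.closedBall x (1 / ((n : ℝ) + 1)) ⊆ K) :
    fderiv ℝ (mollify n (K.indicator u)) x (EuclideanSpace.single i 1) =
      mollify n (K.indicator w) x := by
  have hu := (LocallyIntegrableOn.integrable_indicator h.1 hK hKΩ).locallyIntegrable
  have h1 := h.integral_eq (mollKernel_sub_mem_testFunctions (hx.trans hKΩ))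
  have hts : ∀ y, y ∉ K → y ∉ tsupport (fun y => mollKernel n (x - y)) := fun y hy hy' =>
    hy (hx (tsupport_mollKernel_sub_subset n x hy'))
  rw [fderiv_mollify n hu, mollify_apply]
  have e1 : ∫ y, fderiv ℝ (mollKernel n) (x - y) (EuclideanSpace.single i 1) * K.indicator u y =
      -∫ y, u y * fderiv ℝ (fun y => mollKernel n (x - y)) y (EuclideanSpace.single i 1) := by
    rw [← integral_neg]
    refine integral_congr_ae (Eventually.of_forall fun y => ?_)
    simp only [fderiv_mollKernel_sub]
    by_cases hy : y ∈ K
    · simp [hy, mul_comm]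
    · have := image_eq_zero_of_notMem_tsupport fun hy' =>
        hts y hy (tsupport_fderiv_apply_subset _ (EuclideanSpace.single i 1) hy')
      rw [fderiv_mollKernel_sub] at this
      simp [hy, this]
  have e2 : ∫ y, mollKernel n (x - y) * K.indicator w y = ∫ y, w y * mollKernel n (x - y) := by
    refine integral_congr_ae (Eventually.of_forall fun y => ?_)
    by_cases hy : y ∈ K
    · simp [hy, mul_comm]
    · have := image_eq_zero_of_notMem_tsupport (hts y hy)
      simp [hy, this]
  rw [e1, h1, neg_neg, e2]

lemma integrable_comp_sub_mollMeasure (n : ℕ) {f : Rd d → ℝ} (hf : LocallyIntegrable f) (x : Rd d) :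
    Integrable (fun z => f (x - z)) (mollMeasure d n) := by
  rw [mollMeasure, integrable_withDensity_iff_integrable_smul₀'
    (measurable_ofReal_mollKernel n).aemeasurable (Eventually.of_forall fun _ => ENNReal.ofReal_lt_top)]
  have := (hasCompactSupport_mollKernel (d := d) n).convolutionExists_left
    (ContinuousLinearMap.lsmul ℝ ℝ) (continuous_mollKernel n) hf x
  refine this.congr (Eventually.of_forall fun z => ?_)
  simp [ENNReal.toReal_ofReal (mollKernel_nonneg n _)]

/-- Mollification averages the values of `u` over a ball inside `K`, so it stays in any closed
convex set of values. This lets the chain rule handle functions such as `exp` that are bounded only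
on the range of `u`. -/
lemma mollify_indicator_mem {K : Set (Rd d)} {I : Set ℝ} {u : Rd d → ℝ} (hI : IsClosed I)
    (hI' : Convex ℝ I) (huI : ∀ x ∈ K, u x ∈ I) (hu : Integrable (K.indicator u)) {n : ℕ} {x : Rd d}
    (hx : Metric.closedBall x (1 / ((n : ℝ) + 1)) ⊆ K) : mollify n (K.indicator u) x ∈ I := by
  rw [mollify_eq_integral_mollMeasure]
  refine hI'.integral_mem hI ?_ (integrable_comp_sub_mollMeasure n hu.locallyIntegrable x)
  filter_upwards [ae_mollMeasure_norm_le n] with z hz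
  have hxz : x - z ∈ K := hx (by simpa [Metric.mem_closedBall, dist_eq_norm] using hz)
  rw [Set.indicator_of_mem hxz]
  exact huI _ hxz

lemma integrable_mollify (n : ℕ) {f : Rd d → ℝ} (hf : Integrable f) : Integrable (mollify n f) :=
  (integrable_mollKernel n).integrable_convolution _ hf

lemma integral_mul_fderiv_testFunction {f φ : Rd d → ℝ} (hf : ContDiff ℝ 1 f)
    (hφ : ContDiff ℝ 1 φ) (hφ' : HasCompactSupport φ) (e : Rd d) :
    ∫ x, f x * fderiv ℝ φ x e = -∫ x, fderiv ℝ f x e * φ x := by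
  have c1 : Continuous fun x => fderiv ℝ f x e :=
    (hf.continuous_fderiv (by simp)).clm_apply continuous_const
  have c2 : Continuous fun x => fderiv ℝ φ x e :=
    (hφ.continuous_fderiv (by simp)).clm_apply continuous_const
  refine integral_mul_fderiv_eq_neg_fderiv_mul_of_integrable ?_ ?_ ?_ ?_ ?_
  · exact (c1.mul hφ.continuous).integrable_of_hasCompactSupport hφ'.mul_left
  · exact (hf.continuous.mul c2).integrable_of_hasCompactSupport (hφ'.fderiv_apply ℝ e).mul_left
  · exact (hf.continuous.mul hφ.continuous).integrable_of_hasCompactSupport hφ'.mul_left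
  · exact fun x _ => hf.differentiable (by simp) x
  · exact fun x _ => hφ.differentiable (by simp) x

lemma locallyIntegrableOn_of_bounded {Ω : Set (Rd d)} (hΩ : IsOpen Ω) {f : Rd d → ℝ}
    (hf : AEStronglyMeasurable f (volume.restrict Ω))
    (hb : ∀ K, IsCompact K → K ⊆ Ω → ∃ C, ∀ x ∈ K, |f x| ≤ C) : LocallyIntegrableOn f Ω := by
  rw [locallyIntegrableOn_iff hΩ.isLocallyClosed]
  intro K hKΩ hK
  obtain ⟨C, hC⟩ := hb K hK hKΩ
  refine IntegrableOn.of_bound hK.measure_lt_top (hf.mono_measure (Measure.restrict_mono hKΩ le_rfl))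
    C ?_
  exact (ae_restrict_iff' hK.measurableSet).2 (Eventually.of_forall hC)

/-- The chain rule for weak derivatives. -/
lemma IsWeakPartial.comp {Ω : Set (Rd d)} (hΩ : IsOpen Ω) {i : Fin d} {u w : Rd d → ℝ}
    (h : IsWeakPartial Ω i u w) {F F' : ℝ → ℝ} (hF : ∀ s, HasDerivAt F (F' s) s)
    (hF' : Continuous F')
    (hb : ∀ K, IsCompact K → K ⊆ Ω → ∃ I : Set ℝ, IsClosed I ∧ Convex ℝ I ∧ (∀ x ∈ K, u x ∈ I) ∧
      ∃ M, ∀ s ∈ I, |F s| ≤ M ∧ |F' s| ≤ M) :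
    IsWeakPartial Ω i (fun x => F (u x)) fun x => F' (u x) * w x := by
  have hFc : Continuous F := continuous_iff_continuousAt.2 fun s => (hF s).continuousAt
  have hF1 : ContDiff ℝ 1 F := contDiff_one_iff_deriv.2
    ⟨fun s => (hF s).differentiableAt, by rwa [show deriv F = F' from funext fun s => (hF s).deriv]⟩
  have hum : AEStronglyMeasurable u (volume.restrict Ω) := h.1.aestronglyMeasurable
  have hwm : AEStronglyMeasurable w (volume.restrict Ω) := h.2.1.aestronglyMeasurable
  have hloc : LocallyIntegrableOn (fun x => F' (u x) * w x) Ω := by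
    rw [locallyIntegrableOn_iff hΩ.isLocallyClosed]
    intro K hKΩ hK
    obtain ⟨I, -, -, hI, M, hM⟩ := hb K hK hKΩ
    refine (h.2.1.integrableOn_compact_subset hKΩ hK).bdd_mul (c := M)
      ((hF'.comp_aestronglyMeasurable hum).mono_measure (Measure.restrict_mono hKΩ le_rfl)) ?_
    exact (ae_restrict_iff' hK.measurableSet).2 (Eventually.of_forall fun x hx => (hM _ (hI x hx)).2)
  refine ⟨locallyIntegrableOn_of_bounded hΩ (hFc.comp_aestronglyMeasurable hum)
    fun K hK hKΩ => ?_, hloc, fun φ hφ => ?_⟩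
  · obtain ⟨I, -, -, hI, M, hM⟩ := hb K hK hKΩ
    exact ⟨M, fun x hx => (hM _ (hI x hx)).1⟩
  rw [setIntegral_eq_integral_of_tsupport_subset ((tsupport_fderiv_apply_subset φ _).trans hφ.2.2),
    setIntegral_eq_integral_of_tsupport_subset hφ.2.2]
  -- The thickening `K` ensures that, at points of the support of `φ`, small mollifiers see only
  -- values inside `K ⊆ Ω`.
  obtain ⟨δ, hδ, hδΩ⟩ := IsCompact.exists_cthickening_subset_open hφ.2.1 hΩ hφ.2.2
  set K := Metric.cthickening δ (tsupport φ) with hKdef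
  have hK : IsCompact K := IsCompact.cthickening hφ.2.1
  obtain ⟨I, hI1, hI2, hI3, M, hM⟩ := hb K hK hδΩ
  have hφK : tsupport φ ⊆ K := Metric.self_subset_cthickening _
  have hui := LocallyIntegrableOn.integrable_indicator h.1 hK hδΩ
  have hwi := LocallyIntegrableOn.integrable_indicator h.2.1 hK hδΩ
  have hball : ∀ᶠ n : ℕ in atTop, ∀ x ∈ tsupport φ, Metric.closedBall x (1 / ((n : ℝ) + 1)) ⊆ K := by
    filter_upwards [tendsto_mollRadius_le hδ] with n hn x hx
    exact (Metric.closedBall_subset_closedBall hn).trans (Metric.closedBall_subset_cthickening hx δ)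
  set e : Rd d := EuclideanSpace.single i 1
  have cφ : Continuous φ := hφ.1.continuous
  have cφ' : Continuous fun x => fderiv ℝ φ x e :=
    (hφ.1.continuous_fderiv (by simp)).clm_apply continuous_const
  obtain ⟨C, hC⟩ := cφ.bounded_above_of_compact_support hφ.2.1
  have hsm : ∀ n, ContDiff ℝ ∞ (mollify n (K.indicator u)) := fun n =>
    contDiff_mollify n hui.locallyIntegrable
  have hae := ae_tendsto_mollify hui.locallyIntegrable
  have hL : Tendsto (fun n => ∫ x, F (mollify n (K.indicator u) x) * fderiv ℝ φ x e) atTop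
      (𝓝 (∫ x, F (u x) * fderiv ℝ φ x e)) := by
    refine tendsto_integral_filter_of_dominated_convergence (fun x => M * |fderiv ℝ φ x e|)
      (Eventually.of_forall fun n => ?_) ?_ ?_ ?_
    · exact ((hFc.comp (hsm n).continuous).mul cφ').aestronglyMeasurable
    · filter_upwards [hball] with n hn
      refine Eventually.of_forall fun x => ?_
      rw [norm_mul, Real.norm_eq_abs, Real.norm_eq_abs]
      by_cases hx : x ∈ tsupport φ
      · gcongr
        exact (hM _ (mollify_indicator_mem hI1 hI2 hI3 hui (hn x hx))).1
      · have := image_eq_zero_of_notMem_tsupport fun hx' =>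
          hx (tsupport_fderiv_apply_subset φ e hx')
        simp [this]
    · exact ((cφ'.integrable_of_hasCompactSupport (hφ.2.1.fderiv_apply ℝ e)).abs).const_mul M
    · filter_upwards [hae] with x hx
      by_cases hxK : x ∈ tsupport φ
      · rw [Set.indicator_of_mem (hφK hxK)] at hx
        exact ((hFc.tendsto _).comp hx).mul_const _
      · have := image_eq_zero_of_notMem_tsupport fun hx' =>
          hxK (tsupport_fderiv_apply_subset φ e hx')
        simp [this]
  -- Here the factor `F'(u_n) φ` is bounded and converges a.e., while the mollified derivative
  -- converges in `L¹`.
  have hR : Tendsto (fun n => ∫ x, (F' (mollify n (K.indicator u) x) * φ x) *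
      mollify n (K.indicator w) x) atTop (𝓝 (∫ x, (F' (u x) * φ x) * K.indicator w x)) := by
    refine tendsto_integral_mul_of_bounded (M := |M| * C) (fun n => ?_) ?_ ?_ hwi
      (fun n => integrable_mollify n hwi)
      (tendsto_eLpNorm_mollify_sub le_rfl ENNReal.one_ne_top (memLp_one_iff_integrable.2 hwi))
    · exact ((hF'.comp (hsm n).continuous).mul cφ).aestronglyMeasurable
    · filter_upwards [hball] with n hn
      refine Eventually.of_forall fun x => ?_
      rw [abs_mul]
      by_cases hx : x ∈ tsupport φ
      · have h1 := (hM _ (mollify_indicator_mem hI1 hI2 hI3 hui (hn x hx))).2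
        exact mul_le_mul (h1.trans (le_abs_self M)) (hC x) (abs_nonneg _) (abs_nonneg _)
      · rw [image_eq_zero_of_notMem_tsupport hx, abs_zero, mul_zero]
        exact mul_nonneg (abs_nonneg _) ((norm_nonneg _).trans (hC x))
    · filter_upwards [hae] with x hx
      by_cases hxK : x ∈ tsupport φ
      · rw [Set.indicator_of_mem (hφK hxK)] at hx
        exact ((hF'.tendsto _).comp hx).mul_const _
      · simp [image_eq_zero_of_notMem_tsupport hxK]
  have hR' : Tendsto (fun n => -∫ x, (F' (mollify n (K.indicator u) x) * φ x) *
      mollify n (K.indicator w) x) atTop (𝓝 (-∫ x, F' (u x) * w x * φ x)) := by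
    refine hR.neg.trans (le_of_eq ?_)
    congr 2
    refine integral_congr_ae (Eventually.of_forall fun x => ?_)
    by_cases hxK : x ∈ tsupport φ
    · simp only [Set.indicator_of_mem (hφK hxK)]; ring
    · simp [image_eq_zero_of_notMem_tsupport hxK]
  -- For the mollified function the identity is the classical chain rule with integration by parts;
  -- the two limits carry it over to `u`.
  refine tendsto_nhds_unique hL (hR'.congr' ?_)
  filter_upwards [hball] with n hn
  refine Eq.trans ?_ (integral_mul_fderiv_testFunction (hF1.comp ((hsm n).of_le (by simp)))
    (hφ.1.of_le (by simp)) hφ.2.1 e).symm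
  congr 1
  refine integral_congr_ae (Eventually.of_forall fun x => ?_)
  by_cases hxK : x ∈ tsupport φ
  · have h1 : HasFDerivAt (mollify n (K.indicator u)) _ x :=
      ((hsm n).differentiable (by simp) x).hasFDerivAt
    have h2 := ((hF _).comp_hasFDerivAt x h1).fderiv
    simp only [h2, smul_apply, smul_eq_mul, e]
    rw [h.fderiv_mollify_indicator hK hδΩ (hn x hxK)]
    ring
  · simp [image_eq_zero_of_notMem_tsupport hxK]

/-- The product rule for weak derivatives. -/
lemma IsWeakPartial.mul {Ω : Set (Rd d)} (hΩ : IsOpen Ω) {i : Fin d} {a a' b b' : Rd d → ℝ}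
    (ha : IsWeakPartial Ω i a a') (hb : IsWeakPartial Ω i b b') {M : ℝ} (hM : ∀ x ∈ Ω, |a x| ≤ M)
    (ha2 : MemLpLoc a' 2 Ω volume) (hb2 : MemLpLoc b 2 Ω volume) :
    IsWeakPartial Ω i (fun x => a x * b x) fun x => a' x * b x + a x * b' x := by
  have hbdd : ∀ {g : Rd d → ℝ}, LocallyIntegrableOn g Ω → LocallyIntegrableOn (fun x => a x * g x) Ω := by
    intro g hg
    rw [locallyIntegrableOn_iff hΩ.isLocallyClosed]
    intro K hKΩ hK
    refine (hg.integrableOn_compact_subset hKΩ hK).bdd_mul (c := M)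
      (ha.1.aestronglyMeasurable.mono_measure (Measure.restrict_mono hKΩ le_rfl)) ?_
    exact (ae_restrict_iff' hK.measurableSet).2 (Eventually.of_forall fun x hx => hM x (hKΩ hx))
  have hloc : LocallyIntegrableOn (fun x => a' x * b x) Ω := by
    rw [locallyIntegrableOn_iff hΩ.isLocallyClosed]
    intro K hKΩ hK
    exact (ha2 K hK hKΩ).integrable_mul (hb2 K hK hKΩ)
  refine ⟨hbdd hb.1, hloc.add (hbdd hb.2.1), fun φ hφ => ?_⟩
  rw [setIntegral_eq_integral_of_tsupport_subset ((tsupport_fderiv_apply_subset φ _).trans hφ.2.2),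
    setIntegral_eq_integral_of_tsupport_subset hφ.2.2]
  obtain ⟨δ, hδ, hδΩ⟩ := IsCompact.exists_cthickening_subset_open hφ.2.1 hΩ hφ.2.2
  set K := Metric.cthickening δ (tsupport φ) with hKdef
  have hK : IsCompact K := IsCompact.cthickening hφ.2.1
  have hφK : tsupport φ ⊆ K := Metric.self_subset_cthickening _
  have hai := LocallyIntegrableOn.integrable_indicator ha.1 hK hδΩ
  have hball : ∀ᶠ n : ℕ in atTop, ∀ x ∈ tsupport φ, Metric.closedBall x (1 / ((n : ℝ) + 1)) ⊆ K := by
    filter_upwards [tendsto_mollRadius_le hδ] with n hn x hx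
    exact (Metric.closedBall_subset_closedBall hn).trans (Metric.closedBall_subset_cthickening hx δ)
  set e : Rd d := EuclideanSpace.single i 1
  have cφ : Continuous φ := hφ.1.continuous
  have cφ' : Continuous fun x => fderiv ℝ φ x e :=
    (hφ.1.continuous_fderiv (by simp)).clm_apply continuous_const
  have hφ'Ω : tsupport (fun x => fderiv ℝ φ x e) ⊆ Ω := (tsupport_fderiv_apply_subset φ e).trans hφ.2.2
  have hsm : ∀ n, ContDiff ℝ ∞ (mollify n (K.indicator a)) := fun n =>
    contDiff_mollify n hai.locallyIntegrable
  have hae := ae_tendsto_mollify hai.locallyIntegrable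
  have hM' : ∀ᶠ n : ℕ in atTop, ∀ x ∈ tsupport φ, |mollify n (K.indicator a) x| ≤ M := by
    filter_upwards [hball] with n hn x hx
    have := mollify_indicator_mem (I := Set.Icc (-M) M) isClosed_Icc (convex_Icc _ _)
      (fun x hx => abs_le.1 (hM x (hδΩ hx))) hai (hn x hx)
    exact abs_le.2 this
  -- convergence of integrals against the mollification of `a`
  have hconv : ∀ {g θ : Rd d → ℝ}, LocallyIntegrableOn g Ω → Continuous θ → tsupport θ ⊆ tsupport φ →
      Tendsto (fun n => ∫ x, mollify n (K.indicator a) x * (g x * θ x)) atTop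
        (𝓝 (∫ x, a x * (g x * θ x))) := by
    intro g θ hg hθ hθφ
    have hgi : Integrable fun x => g x * θ x := integrable_mul_testFunction hg hθ
      (hφ.2.1.mono' ((subset_tsupport _).trans hθφ)) (hθφ.trans hφ.2.2)
    refine tendsto_integral_filter_of_dominated_convergence (fun x => M * |g x * θ x|)
      (Eventually.of_forall fun n => (hsm n).continuous.aestronglyMeasurable.mul hgi.1) ?_
      (hgi.abs.const_mul M) ?_
    · filter_upwards [hM'] with n hn
      refine Eventually.of_forall fun x => ?_
      rw [norm_mul, Real.norm_eq_abs, Real.norm_eq_abs]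
      by_cases hx : x ∈ tsupport φ
      · gcongr; exact hn x hx
      · simp [image_eq_zero_of_notMem_tsupport fun hx' => hx (hθφ hx')]
    · filter_upwards [hae] with x hx
      by_cases hxK : x ∈ tsupport φ
      · rw [Set.indicator_of_mem (hφK hxK)] at hx
        exact hx.mul_const _
      · simp [image_eq_zero_of_notMem_tsupport fun hx' => hxK (hθφ hx')]
  have haK2 : MemLp (K.indicator a') 2 := (memLp_indicator_iff_restrict hK.measurableSet).2 (ha2 K hK hδΩ)
  have hbK2 : MemLp (K.indicator b) 2 := (memLp_indicator_iff_restrict hK.measurableSet).2 (hb2 K hK hδΩ)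
  have hlim2 := tendsto_eLpNorm_mollify_sub one_le_two ENNReal.ofNat_ne_top haK2
  have hmeas : ∀ n, AEStronglyMeasurable (mollify n (K.indicator a') - K.indicator a') volume := fun n =>
    (contDiff_mollify n (haK2.locallyIntegrable one_le_two)).continuous.aestronglyMeasurable.sub haK2.1
  obtain ⟨C, hC⟩ := cφ.bounded_above_of_compact_support hφ.2.1
  have hbφ : MemLp (fun x => K.indicator b x * φ x) 2 := by
    refine hbK2.of_le_mul (c := C) (hbK2.1.mul cφ.aestronglyMeasurable)
      (Eventually.of_forall fun x => ?_)
    rw [norm_mul, mul_comm]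
    gcongr
    exact hC x
  have hm2 : ∀ᶠ n : ℕ in atTop, MemLp (mollify n (K.indicator a')) 2 := by
    filter_upwards [hlim2.eventually_lt_const ENNReal.zero_lt_top] with n hn
    have := (show MemLp _ 2 volume from ⟨hmeas n, hn⟩).add haK2
    simpa using this
  -- Only the bounded factor `a` is mollified. The derivatives of its mollifications converge in
  -- `L²` near the support of `φ`, which is enough because `b φ` is square integrable.
  have hR : Tendsto (fun n => ∫ x, mollify n (K.indicator a') x * (K.indicator b x * φ x)) atTop
      (𝓝 (∫ x, K.indicator a' x * (K.indicator b x * φ x))) := by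
    refine tendsto_integral_of_L1' _ (haK2.1.mul hbφ.1) ?_ ?_
    · filter_upwards [hm2] with n hn using hn.integrable_mul hbφ
    · have h1 : Tendsto (fun n => eLpNorm (mollify n (K.indicator a') - K.indicator a') 2 volume *
          eLpNorm (fun x => K.indicator b x * φ x) 2 volume) atTop (𝓝 0) := by
        have := ENNReal.Tendsto.mul_const hlim2 (Or.inr hbφ.2.ne)
        rwa [zero_mul] at this
      refine tendsto_of_tendsto_of_tendsto_of_le_of_le tendsto_const_nhds h1 (fun _ => zero_le)
        fun n => ?_
      refine le_trans (le_of_eq ?_) (eLpNorm_smul_le_mul_eLpNorm (p := 2) (q := 2) (r := 1)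
        hbφ.1 (hmeas n))
      congr 1
      funext x
      simp only [Pi.sub_apply, Pi.smul_apply', Pi.mul_apply, smul_eq_mul]
      ring
  have h1 := hconv hb.1 cφ' (tsupport_fderiv_apply_subset φ e)
  have h2 := ((hconv hb.2.1 cφ subset_rfl).add hR).neg
  have e1 : ∫ x, a x * (b x * fderiv ℝ φ x e) = ∫ x, a x * b x * fderiv ℝ φ x e := by
    simp only [mul_assoc]
  have i1 : Integrable fun x => a x * (b' x * φ x) := by
    simpa only [mul_assoc] using integrable_mul_testFunction (hbdd hb.2.1) cφ hφ.2.1 hφ.2.2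
  have hab : Integrable fun x => K.indicator a' x * (K.indicator b x * φ x) :=
    haK2.integrable_mul hbφ
  have e2 : (∫ x, a x * (b' x * φ x)) + ∫ x, K.indicator a' x * (K.indicator b x * φ x) =
      ∫ x, (a' x * b x + a x * b' x) * φ x := by
    rw [← integral_add i1 hab]
    refine integral_congr_ae (Eventually.of_forall fun x => ?_)
    by_cases hx : x ∈ tsupport φ
    · simp only [Set.indicator_of_mem (hφK hx)]; ring
    · simp [image_eq_zero_of_notMem_tsupport hx]
  rw [e1] at h1
  rw [e2] at h2
  refine tendsto_nhds_unique h1 (h2.congr' ?_)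
  filter_upwards [hball, hm2] with n hn hn2
  set m := mollify n (K.indicator a) with hm
  -- The mollified factor is smooth, so it may be moved into the test function in the weak
  -- formulation for `b`.
  have hθ : (fun x => m x * φ x) ∈ testFunctions Ω := by
    refine ⟨(hsm n).mul hφ.1, hφ.2.1.mul_left, ?_⟩
    exact (tsupport_mul_subset_right (f := m) (g := φ)).trans hφ.2.2
  have h3 := hb.integral_eq hθ
  have hd : ∀ x, fderiv ℝ (fun x => m x * φ x) x e = m x * fderiv ℝ φ x e + fderiv ℝ m x e * φ x := by
    intro x
    have h4 : HasFDerivAt m _ x := ((hsm n).differentiable (by simp) x).hasFDerivAt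
    have h5 : HasFDerivAt φ _ x := (hφ.1.differentiable (by simp) x).hasFDerivAt
    have h6 : HasFDerivAt (fun x => m x * φ x) _ x := h4.mul h5
    rw [h6.fderiv]
    simp [mul_comm, hm]
  have e3 : ∫ x, b x * fderiv ℝ (fun x => m x * φ x) x e = (∫ x, m x * (b x * fderiv ℝ φ x e)) +
      ∫ x, mollify n (K.indicator a') x * (K.indicator b x * φ x) := by
    have cm : Continuous fun x => m x * fderiv ℝ φ x e := (hsm n).continuous.mul cφ'
    have i2 : Integrable fun x => m x * (b x * fderiv ℝ φ x e) := by
      have := integrable_mul_testFunction hb.1 cm ((hφ.2.1.fderiv_apply ℝ e).mul_left)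
        ((tsupport_mul_subset_right (f := m)).trans hφ'Ω)
      refine this.congr (Eventually.of_forall fun x => ?_)
      simp only; ring
    have i3 : Integrable fun x => mollify n (K.indicator a') x * (K.indicator b x * φ x) :=
      hn2.integrable_mul hbφ
    rw [← integral_add i2 i3]
    refine integral_congr_ae (Eventually.of_forall fun x => ?_)
    simp only [hd]
    by_cases hx : x ∈ tsupport φ
    · simp only [Set.indicator_of_mem (hφK hx)]
      rw [← ha.fderiv_mollify_indicator hK hδΩ (hn x hx)]; ring
    · have := image_eq_zero_of_notMem_tsupport fun hx' =>
        hx (tsupport_fderiv_apply_subset φ e hx')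
      simp [image_eq_zero_of_notMem_tsupport hx, this]
  have e4 : ∫ x, b' x * (m x * φ x) = ∫ x, m x * (b' x * φ x) :=
    integral_congr_ae (Eventually.of_forall fun x => by ring)
  rw [e3, e4] at h3
  linarith

end WeakDerivatives

/-! ### Measures with density `e^{-Ψ}` -/

section Densities

/-- The real-valued density `e^{-Ψ}`. -/
def dens {X : Type*} (Ψ : X → EReal) (x : X) : ℝ := (EReal.exp (-Ψ x)).toReal

/-- Extended-real-valued functions that are bounded below and measurable. -/
structure IsPotential {X : Type*} [MeasurableSpace X] (Ψ : X → EReal) : Prop where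
  measurable_exp : Measurable fun x => EReal.exp (-Ψ x)
  bddBelow : ∃ c : ℝ, ∀ x, (c : EReal) ≤ Ψ x

lemma dens_nonneg {X : Type*} (Ψ : X → EReal) (x : X) : 0 ≤ dens Ψ x := ENNReal.toReal_nonneg

namespace IsPotential

variable {X : Type*} [MeasureSpace X] {Ψ : X → EReal} (h : IsPotential Ψ)
include h

lemma ne_bot (x : X) : Ψ x ≠ ⊥ := by
  obtain ⟨c, hc⟩ := h.bddBelow
  exact ((EReal.bot_lt_coe c).trans_le (hc x)).ne'

lemma exp_ne_top (x : X) : EReal.exp (-Ψ x) ≠ ⊤ := by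
  rw [Ne, EReal.exp_eq_top_iff, EReal.neg_eq_top_iff]
  exact h.ne_bot x

lemma ofReal_dens (x : X) : ENNReal.ofReal (dens Ψ x) = EReal.exp (-Ψ x) :=
  ENNReal.ofReal_toReal (h.exp_ne_top x)

lemma measurable_dens : Measurable (dens Ψ) := h.measurable_exp.ennreal_toReal

lemma dens_of_lt_top {x : X} (hx : Ψ x < ⊤) : dens Ψ x = Real.exp (-(Ψ x).toReal) := by
  rw [dens, ← EReal.coe_toReal hx.ne (h.ne_bot x), ← EReal.coe_neg, EReal.exp_coe,
    ENNReal.toReal_ofReal (Real.exp_pos _).le, EReal.toReal_coe]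

omit [MeasureSpace X] h in
lemma _root_.Langevin.dens_of_eq_top {x : X} (hx : Ψ x = ⊤) : dens Ψ x = 0 := by simp [dens, hx]

lemma dens_pos_iff {x : X} : 0 < dens Ψ x ↔ Ψ x < ⊤ := by
  constructor
  · intro hx
    by_contra hcon
    rw [dens_of_eq_top (top_le_iff.1 (not_lt.1 hcon))] at hx
    exact lt_irrefl _ hx
  · intro hx
    rw [h.dens_of_lt_top hx]
    exact Real.exp_pos _

lemma exists_dens_le : ∃ M, ∀ x, dens Ψ x ≤ M := by
  obtain ⟨c, hc⟩ := h.bddBelow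
  refine ⟨Real.exp (-c), fun x => ?_⟩
  by_cases hx : Ψ x < ⊤
  · rw [h.dens_of_lt_top hx, Real.exp_le_exp, neg_le_neg_iff]
    have := EReal.toReal_le_toReal (hc x) (EReal.coe_ne_bot c) hx.ne
    simpa using this
  · rw [dens_of_eq_top (top_le_iff.1 (not_lt.1 hx))]
    exact (Real.exp_pos _).le

lemma expMeasure_eq : expMeasure Ψ = volume.withDensity fun x => ENNReal.ofReal (dens Ψ x) := by
  simp only [expMeasure, h.ofReal_dens]

lemma integral_expMeasure (f : X → ℝ) : ∫ x, f x ∂(expMeasure Ψ) = ∫ x, dens Ψ x * f x :=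
  integral_withDensity_eq_integral_toReal_smul h.measurable_exp
    (Eventually.of_forall fun x => (h.exp_ne_top x).lt_top) f

lemma integrable_expMeasure_iff {f : X → ℝ} :
    Integrable f (expMeasure Ψ) ↔ Integrable (fun x => dens Ψ x * f x) :=
  integrable_withDensity_iff_integrable_smul' h.measurable_exp
    (Eventually.of_forall fun x => (h.exp_ne_top x).lt_top)

lemma ae_expMeasure_iff {p : X → Prop} :
    (∀ᵐ x ∂(expMeasure Ψ), p x) ↔ ∀ᵐ x, Ψ x < ⊤ → p x := by
  rw [expMeasure, ae_withDensity_iff h.measurable_exp]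
  refine eventually_congr (Eventually.of_forall fun x => ?_)
  rw [Ne, EReal.exp_eq_zero_iff, EReal.neg_eq_bot_iff, lt_top_iff_ne_top]

lemma ae_lt_top : ∀ᵐ x ∂(expMeasure Ψ), Ψ x < ⊤ :=
  h.ae_expMeasure_iff.2 (Eventually.of_forall fun _ hx => hx)

lemma exists_expMeasure_le : ∃ c : ℝ≥0∞, c ≠ ⊤ ∧ expMeasure Ψ ≤ c • volume := by
  obtain ⟨M, hM⟩ := h.exists_dens_le
  refine ⟨ENNReal.ofReal M, ENNReal.ofReal_ne_top, ?_⟩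
  rw [← withDensity_const, h.expMeasure_eq]
  exact withDensity_mono (Eventually.of_forall fun x => ENNReal.ofReal_le_ofReal (hM x))

lemma memLp {f : X → ℝ} {p : ℝ≥0∞} (hf : MemLp f p) : MemLp f p (expMeasure Ψ) := by
  obtain ⟨c, hc, hle⟩ := h.exists_expMeasure_le
  exact hf.of_measure_le_smul hc hle

omit h in
lemma _root_.Langevin.expMeasure_absolutelyContinuous (Ψ : X → EReal) : expMeasure Ψ ≪ volume :=
  withDensity_absolutelyContinuous _ _

lemma sigmaFinite [SigmaFinite (volume : Measure X)] : SigmaFinite (expMeasure Ψ) := by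
  rw [h.expMeasure_eq]
  infer_instance

end IsPotential

end Densities

/-! ### Classical calculus on test functions in coordinates -/

section TestFunctionCalculus

variable {d : ℕ}

/-- The classical partial derivative. -/
def pd (i : Fin d) (f : Rd d → ℝ) (x : Rd d) : ℝ := fderiv ℝ f x (EuclideanSpace.single i 1)

lemma pd_mem_testFunctions {Ω : Set (Rd d)} {φ : Rd d → ℝ} (hφ : φ ∈ testFunctions Ω) (i : Fin d) :
    pd i φ ∈ testFunctions Ω :=
  ⟨(hφ.1.fderiv_right (m := ∞) (by simp)).clm_apply contDiff_const, hφ.2.1.fderiv_apply ℝ _,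
    (tsupport_fderiv_apply_subset φ _).trans hφ.2.2⟩

lemma mul_mem_testFunctions {Ω : Set (Rd d)} {φ χ : Rd d → ℝ} (hφ : φ ∈ testFunctions Ω)
    (hχ : ContDiff ℝ ∞ χ) : (fun x => χ x * φ x) ∈ testFunctions Ω :=
  ⟨hχ.mul hφ.1, hφ.2.1.mul_left, (tsupport_mul_subset_right (f := χ) (g := φ)).trans hφ.2.2⟩

lemma pd_mul {φ χ : Rd d → ℝ} {x : Rd d} (i : Fin d) (hφ : DifferentiableAt ℝ φ x)
    (hχ : DifferentiableAt ℝ χ x) : pd i (fun x => φ x * χ x) x = φ x * pd i χ x + pd i φ x * χ x := by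
  have h : HasFDerivAt (fun x => φ x * χ x) _ x := hφ.hasFDerivAt.mul hχ.hasFDerivAt
  rw [pd, h.fderiv]
  simp [pd, mul_comm]

lemma laplacian_eq_sum_pd {f : Rd d → ℝ} (hf : ContDiff ℝ 2 f) (x : Rd d) :
    Δ f x = ∑ i, pd i (pd i f) x := by
  rw [InnerProductSpace.laplacian_eq_iteratedFDeriv_orthonormalBasis f (EuclideanSpace.basisFun (Fin d) ℝ)]
  refine Finset.sum_congr rfl fun i _ => ?_
  rw [iteratedFDeriv_two_apply]
  have h1 : HasFDerivAt (fderiv ℝ f) (fderiv ℝ (fderiv ℝ f) x) x :=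
    ((hf.fderiv_right (m := 1) (by norm_num)).differentiable (by simp) x).hasFDerivAt
  have h2 := h1.clm_apply (hasFDerivAt_const (EuclideanSpace.single i (1 : ℝ)) x)
  change _ = fderiv ℝ (fun x => fderiv ℝ f x (EuclideanSpace.single i 1)) x _
  rw [h2.fderiv]
  simp

lemma fderiv_apply_eq_sum_pd (f : Rd d → ℝ) (x e : Rd d) : fderiv ℝ f x e = ∑ i, e i * pd i f x := by
  conv_lhs => rw [← (EuclideanSpace.basisFun (Fin d) ℝ).sum_repr e, map_sum]
  refine Finset.sum_congr rfl fun i _ => ?_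
  simp [pd]

lemma inner_gradient_eq_sum_pd (f : Rd d → ℝ) (x e : Rd d) :
    inner ℝ e (∇ f x) = ∑ i, e i * pd i f x := by
  rw [inner_gradient_right, ← fderiv_apply_eq_sum_pd]; rfl

lemma velocityOperator_apply (G : Rd d → Rd d) {Ω : Set (Rd d)} (f : testFunctions Ω) (v : Rd d) :
    velocityOperator G Ω f v =
      ∑ i, pd i (pd i (f : Rd d → ℝ)) v - ∑ i, G v i * pd i (f : Rd d → ℝ) v := by
  rw [← laplacian_eq_sum_pd (f.2.1.of_le two_le_infty), ← inner_gradient_eq_sum_pd]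
  rfl

lemma testFunction_bounded {Ω : Set (Rd d)} {φ : Rd d → ℝ} (hφ : φ ∈ testFunctions Ω) :
    ∃ C, ∀ x, |φ x| ≤ C := hφ.1.continuous.bounded_above_of_compact_support hφ.2.1

lemma testFunction_memLp {Ω : Set (Rd d)} {φ : Rd d → ℝ} (hφ : φ ∈ testFunctions Ω) (p : ℝ≥0∞) :
    MemLp φ p volume := hφ.1.continuous.memLp_of_hasCompactSupport hφ.2.1

lemma MemLp.coord {μ : Measure (Rd d)} {G : Rd d → Rd d} {p : ℝ≥0∞} (hG : MemLp G p μ) (i : Fin d) :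
    MemLp (fun x => G x i) p μ :=
  hG.of_le ((EuclideanSpace.proj (𝕜 := ℝ) i).continuous.comp_aestronglyMeasurable hG.1)
    (Eventually.of_forall fun x => PiLp.norm_apply_le (G x) i)

lemma IsWeakPartial.congr {Ω : Set (Rd d)} (hΩ : MeasurableSet Ω) {i : Fin d} {u u' w w' : Rd d → ℝ}
    (h : IsWeakPartial Ω i u w) (hu : ∀ x ∈ Ω, u x = u' x) (hw : ∀ x ∈ Ω, w x = w' x) :
    IsWeakPartial Ω i u' w' := by
  have hc : ∀ {f g : Rd d → ℝ}, (∀ x ∈ Ω, f x = g x) → LocallyIntegrableOn f Ω →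
      LocallyIntegrableOn g Ω := by
    intro f g hfg hf x hx
    obtain ⟨s, hs, hs'⟩ := hf x hx
    refine ⟨s ∩ Ω, inter_mem hs self_mem_nhdsWithin, ?_⟩
    have h1 := hs'.mono_set (Set.inter_subset_left (t := Ω))
    have h2 : IntegrableOn f (s ∩ Ω) := h1
    refine Integrable.congr h2 ?_
    have h3 : ∀ᵐ y ∂(volume.restrict Ω), f y = g y :=
      (ae_restrict_iff' hΩ).2 (Eventually.of_forall hfg)
    exact ae_mono (Measure.restrict_mono Set.inter_subset_right le_rfl) h3
  refine ⟨hc hu h.1, hc hw h.2.1, fun φ hφ => ?_⟩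
  have e1 := setIntegral_congr_fun (μ := volume) hΩ
    (f := fun x => u x * fderiv ℝ φ x (EuclideanSpace.single i 1))
    (g := fun x => u' x * fderiv ℝ φ x (EuclideanSpace.single i 1))
    (fun x hx => by simp only [hu x hx])
  have e2 := setIntegral_congr_fun (μ := volume) hΩ (f := fun x => w x * φ x)
    (g := fun x => w' x * φ x) (fun x hx => by simp only [hw x hx])
  rw [← e1, ← e2]
  exact h.2.2 φ hφ

end TestFunctionCalculus

/-! ### Integration by parts for `e^{-Φ} dx` -/

section WeightedIntegration

variable {d : ℕ} {Φ : Rd d → EReal} {G : Rd d → Rd d}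

lemma IsPotential.exists_toReal_ge (h : IsPotential Φ) :
    ∃ c : ℝ, ∀ x ∈ finiteSet Φ, c ≤ (Φ x).toReal := by
  obtain ⟨c, hc⟩ := h.bddBelow
  refine ⟨c, fun x hx => ?_⟩
  have := EReal.toReal_le_toReal (hc x) (EReal.coe_ne_bot c) (ne_of_lt hx)
  simpa using this

/-- The density `e^{-Φ}` has the weak gradient `-e^{-Φ} ∇Φ`. -/
lemma IsPotential.isWeakPartial_dens (h : IsPotential Φ) (hΩ : IsOpen (finiteSet Φ))
    (hG : IsWeakGradient Φ G) (i : Fin d) :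
    IsWeakPartial (finiteSet Φ) i (dens Φ) fun x => -(dens Φ x * G x i) := by
  obtain ⟨c, hc⟩ := h.exists_toReal_ge
  -- The lower bound of `Φ` confines its values to `[c, ∞)`, where `e^{-s}` and its derivative are
  -- bounded.
  have h1 := (hG i).comp hΩ (F := fun s => Real.exp (-s)) (F' := fun s => -Real.exp (-s))
    (fun s => by simpa using (hasDerivAt_neg s).exp) (by fun_prop) (fun K _ hKΩ =>
      ⟨Set.Ici c, isClosed_Ici, convex_Ici c, fun x hx => hc x (hKΩ hx), Real.exp (-c),
        fun s hs => by
          rw [abs_neg, abs_of_pos (Real.exp_pos _), Real.exp_le_exp, neg_le_neg_iff]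
          exact ⟨hs, hs⟩⟩)
  refine h1.congr hΩ.measurableSet (fun x hx => (h.dens_of_lt_top hx).symm) fun x hx => ?_
  rw [h.dens_of_lt_top hx]; ring

/-- Integration by parts with respect to the measure `e^{-Φ} dx`. -/
lemma IsPotential.integral_pd (h : IsPotential Φ) (hΩ : IsOpen (finiteSet Φ))
    (hG : IsWeakGradient Φ G) (i : Fin d) {θ : Rd d → ℝ} (hθ : θ ∈ testFunctions (finiteSet Φ)) :
    ∫ x, pd i θ x ∂(expMeasure Φ) = ∫ x, G x i * θ x ∂(expMeasure Φ) := by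
  rw [h.integral_expMeasure, h.integral_expMeasure]
  refine ((h.isWeakPartial_dens hΩ hG i).integral_eq hθ).trans ?_
  rw [← integral_neg]
  exact integral_congr_ae (Eventually.of_forall fun x => by ring)

lemma IsPotential.integrable_testFunction (h : IsPotential Φ) {Ω : Set (Rd d)} {θ : Rd d → ℝ}
    (hθ : θ ∈ testFunctions Ω) : Integrable θ (expMeasure Φ) :=
  memLp_one_iff_integrable.1 (h.memLp (testFunction_memLp hθ 1))

lemma IsPotential.integrable_grad_mul (h : IsPotential Φ) (hΩ : IsOpen (finiteSet Φ))
    (hG : IsWeakGradient Φ G) (i : Fin d) {θ : Rd d → ℝ} (hθ : θ ∈ testFunctions (finiteSet Φ)) :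
    Integrable (fun x => G x i * θ x) (expMeasure Φ) := by
  rw [h.integrable_expMeasure_iff]
  have := integrable_mul_testFunction (h.isWeakPartial_dens hΩ hG i).2.1 hθ.1.continuous hθ.2.1 hθ.2.2
  refine this.neg.congr (Eventually.of_forall fun x => ?_)
  simp only [Pi.neg_apply]; ring

end WeightedIntegration

/-! ### Scalar and vector-valued `L²` spaces -/

section L2Packaging

variable {X : Type*} [MeasurableSpace X] {μ : Measure X}

/-- A linear map into square integrable functions, as a map into `L²`. -/
def toL2 {D : Type*} [AddCommGroup D] [Module ℝ D] (μ : Measure X) (L : D →ₗ[ℝ] (X → ℝ))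
    (hL : ∀ f, MemLp (L f) 2 μ) : D →ₗ[ℝ] Lp ℝ 2 μ where
  toFun f := (hL f).toLp _
  map_add' f g := by
    rw [← MemLp.toLp_add]
    exact MemLp.toLp_congr _ _ (by rw [map_add])
  map_smul' c f := by
    rw [RingHom.id_apply, ← MemLp.toLp_const_smul]
    exact MemLp.toLp_congr _ _ (by rw [map_smul])

lemma inner_toLp {f g : X → ℝ} (hf : MemLp f 2 μ) (hg : MemLp g 2 μ) :
    inner ℝ (hf.toLp f) (hg.toLp g) = ∫ x, f x * g x ∂μ := by
  rw [L2.inner_def]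
  refine integral_congr_ae ?_
  filter_upwards [hf.coeFn_toLp, hg.coeFn_toLp] with x h1 h2
  rw [h1, h2, real_inner_eq_re_inner, RCLike.inner_apply]
  simp [mul_comm]

lemma norm_toLp_sq {f : X → ℝ} (hf : MemLp f 2 μ) : ‖hf.toLp f‖ ^ 2 = ∫ x, f x ^ 2 ∂μ := by
  rw [← real_inner_self_eq_norm_sq, inner_toLp]
  simp only [sq]

variable {d : ℕ}

/-- `ℝ^d`-valued `L²` functions. -/
abbrev VecL2 (d : ℕ) (μ : Measure X) : Type _ := PiLp 2 fun _ : Fin d => Lp ℝ 2 μ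

/-- A linear map into `L²` vector fields, given by its components. -/
def toVecL2 {D : Type*} [AddCommGroup D] [Module ℝ D] (μ : Measure X) (L : Fin d → D →ₗ[ℝ] (X → ℝ))
    (hL : ∀ i f, MemLp (L i f) 2 μ) : D →ₗ[ℝ] VecL2 d μ :=
  (WithLp.linearEquiv 2 ℝ (Fin d → Lp ℝ 2 μ)).symm.toLinearMap ∘ₗ
    LinearMap.pi fun i => toL2 μ (L i) (hL i)

/-- An `L²` vector field, given by its components. -/
def vecToLp (F : Fin d → X → ℝ) (hF : ∀ i, MemLp (F i) 2 μ) : VecL2 d μ :=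
  WithLp.toLp 2 fun i => (hF i).toLp (F i)

lemma inner_vecToLp {F F' : Fin d → X → ℝ} (hF : ∀ i, MemLp (F i) 2 μ) (hF' : ∀ i, MemLp (F' i) 2 μ) :
    inner ℝ (vecToLp F hF) (vecToLp F' hF') = ∑ i, ∫ x, F i x * F' i x ∂μ := by
  rw [PiLp.inner_apply]
  exact Finset.sum_congr rfl fun i _ => inner_toLp (hF i) (hF' i)

lemma norm_vecToLp_sq {F : Fin d → X → ℝ} (hF : ∀ i, MemLp (F i) 2 μ) :
    ‖vecToLp F hF‖ ^ 2 = ∑ i, ∫ x, F i x ^ 2 ∂μ := by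
  rw [← real_inner_self_eq_norm_sq, inner_vecToLp]
  simp only [sq]

/-- Multiplication of an `L²` function by a constant vector. -/
def constVecMul (μ : Measure X) (g : Fin d → ℝ) : Lp ℝ 2 μ →L[ℝ] VecL2 d μ :=
  (PiLp.continuousLinearEquiv 2 ℝ fun _ : Fin d => Lp ℝ 2 μ).symm.toContinuousLinearMap.comp
    (ContinuousLinearMap.pi fun i => g i • ContinuousLinearMap.id ℝ (Lp ℝ 2 μ))

lemma constVecMul_toLp (g : Fin d → ℝ) {u : X → ℝ} (hu : MemLp u 2 μ) :
    constVecMul μ g (hu.toLp u) = vecToLp (fun i x => g i * u x) fun i => hu.const_mul (g i) := rfl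

end L2Packaging

/-! ### Operators on test functions are well defined on classes -/

section GraphOfOperator

variable {X : Type*} [NormedAddCommGroup X] [NormedSpace ℝ X] [MeasureSpace X]

/-- The density is positive on the support, so the open set where `f` does not vanish is Lebesgue
null, hence empty. -/
lemma eq_zero_of_ae_eq_zero [BorelSpace X] [(volume : Measure X).IsOpenPosMeasure] {Ψ : X → EReal}
    (h : IsPotential Ψ) {f : X → ℝ} (hf : f ∈ testFunctions {x | Ψ x < ⊤})
    (hf0 : f =ᵐ[expMeasure Ψ] 0) : f = 0 := by
  have h1 := h.ae_expMeasure_iff.1 hf0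
  have h2 : volume (Function.support f) = 0 := by
    refine measure_mono_null ?_ h1
    intro x hx hx'
    exact hx (hx' (hf.2.2 (subset_tsupport _ hx)))
  have h3 : IsOpen (Function.support f) := hf.1.continuous.isOpen_support
  exact Function.support_eq_empty_iff.1 (h3.measure_eq_zero_iff volume |>.1 h2)

/-- A class determines its test function, so no pair `(0, w)` with `w ≠ 0` occurs and the subspace
of pairs really is a graph. All later arguments about the operator go through this subspace. -/
lemma lpOperator_graph [BorelSpace X] [(volume : Measure X).IsOpenPosMeasure] {Ψ : X → EReal}
    (h : IsPotential Ψ) (p : ℝ≥0∞) [Fact (1 ≤ p)]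
    (L : testFunctions {x | Ψ x < ⊤} →ₗ[ℝ] (X → ℝ)) :
    (lpOperator (expMeasure Ψ) p _ L).graph = operatorGraph (expMeasure Ψ) p _ L := by
  refine Submodule.toLinearPMap_graph_eq _ fun z hz hz0 => ?_
  obtain ⟨f, hf1, hf2⟩ := hz
  have h1 : (f : X → ℝ) = 0 := by
    refine eq_zero_of_ae_eq_zero h f.2 (hf1.symm.trans ?_)
    rw [hz0]
    exact Lp.coeFn_zero _ _ _
  have h2 : f = 0 := Subtype.ext h1
  rw [h2, map_zero] at hf2
  exact Lp.ext (hf2.trans (Lp.coeFn_zero _ _ _).symm)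

end GraphOfOperator

lemma memLp_bdd_mul {X : Type*} [MeasurableSpace X] {μ : Measure X} {p : ℝ≥0∞} {g u : X → ℝ}
    (hg : MemLp g p μ) (hu : AEStronglyMeasurable u μ) {M : ℝ} (hM : ∀ x, |u x| ≤ M) :
    MemLp (fun x => g x * u x) p μ := by
  refine hg.of_le_mul (c := M) (hg.1.mul hu) (Eventually.of_forall fun x => ?_)
  rw [norm_mul, mul_comm]
  gcongr
  exact hM x

/-! ### The velocity operator: Dirichlet form and form bound -/

namespace VelocityPotential

variable {d : ℕ} {Φ : Rd d → EReal} {G : Rd d → Rd d} {H : Fin d → Rd d → ℝ}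
  (h : VelocityPotential Φ G H)
include h

lemma isPotential : IsPotential Φ :=
  ⟨EReal.measurable_exp.comp h.measurable.neg, h.bddBelow⟩

lemma integral_pd {θ : Rd d → ℝ} (hθ : θ ∈ testFunctions (finiteSet Φ)) (i : Fin d) :
    ∫ x, pd i θ x ∂(expMeasure Φ) = ∫ x, G x i * θ x ∂(expMeasure Φ) :=
  h.isPotential.integral_pd h.isOpen h.weakGradient i hθ

lemma memLp_grad_mul (i : Fin d) {u : Rd d → ℝ}
    (hu : AEStronglyMeasurable u (expMeasure Φ)) {M : ℝ} (hM : ∀ x, |u x| ≤ M) :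
    MemLp (fun x => G x i * u x) 2 (expMeasure Φ) :=
  memLp_bdd_mul (MemLp.coord h.gradient_memLp i) hu hM

lemma memLp_testFunction {Ω : Set (Rd d)} {φ : Rd d → ℝ} (hφ : φ ∈ testFunctions Ω) (p : ℝ≥0∞) :
    MemLp φ p (expMeasure Φ) := h.isPotential.memLp (testFunction_memLp hφ p)

lemma memLp_grad_mul_testFunction {Ω : Set (Rd d)} {φ : Rd d → ℝ} (hφ : φ ∈ testFunctions Ω)
    (i : Fin d) : MemLp (fun x => G x i * φ x) 2 (expMeasure Φ) := by
  obtain ⟨M, hM⟩ := testFunction_bounded hφ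
  exact h.memLp_grad_mul i hφ.1.continuous.aestronglyMeasurable hM

lemma memLp_velocityOperator (φ : testFunctions (finiteSet Φ)) :
    MemLp (velocityOperator G (finiteSet Φ) φ) 2 (expMeasure Φ) := by
  have e : velocityOperator G (finiteSet Φ) φ = fun v =>
      ∑ i, pd i (pd i (φ : Rd d → ℝ)) v - ∑ i, G v i * pd i (φ : Rd d → ℝ) v :=
    funext fun v => velocityOperator_apply G φ v
  rw [e]
  exact (memLp_finsetSum _ fun i _ => h.memLp_testFunction
    (pd_mem_testFunctions (pd_mem_testFunctions φ.2 i) i) 2).sub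
    (memLp_finsetSum _ fun i _ => h.memLp_grad_mul_testFunction (pd_mem_testFunctions φ.2 i) i)

/-- The velocity operator is associated with the Dirichlet form. -/
lemma integral_velocityOperator_mul (φ : testFunctions (finiteSet Φ)) {χ : Rd d → ℝ}
    (hχ : χ ∈ testFunctions (finiteSet Φ)) :
    ∫ v, velocityOperator G (finiteSet Φ) φ v * χ v ∂(expMeasure Φ) =
      -∑ i, ∫ v, pd i (φ : Rd d → ℝ) v * pd i χ v ∂(expMeasure Φ) := by
  have m1 : ∀ i, Integrable (fun v => pd i (pd i (φ : Rd d → ℝ)) v * χ v) (expMeasure Φ) := fun i =>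
    (h.memLp_testFunction (pd_mem_testFunctions (pd_mem_testFunctions φ.2 i) i) 2).integrable_mul
      (h.memLp_testFunction hχ 2)
  have m2 : ∀ i, Integrable (fun v => G v i * pd i (φ : Rd d → ℝ) v * χ v) (expMeasure Φ) := fun i =>
    (h.memLp_grad_mul_testFunction (pd_mem_testFunctions φ.2 i) i).integrable_mul
      (h.memLp_testFunction hχ 2)
  have m3 : ∀ i, Integrable (fun v => pd i (φ : Rd d → ℝ) v * pd i χ v) (expMeasure Φ) := fun i =>
    (h.memLp_testFunction (pd_mem_testFunctions φ.2 i) 2).integrable_mul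
      (h.memLp_testFunction (pd_mem_testFunctions hχ i) 2)
  have key : ∀ i, ∫ v, pd i (φ : Rd d → ℝ) v * pd i χ v ∂(expMeasure Φ) +
      ∫ v, pd i (pd i (φ : Rd d → ℝ)) v * χ v ∂(expMeasure Φ) =
      ∫ v, G v i * pd i (φ : Rd d → ℝ) v * χ v ∂(expMeasure Φ) := by
    intro i
    have hφi := pd_mem_testFunctions φ.2 i
    have h1 := h.integral_pd (mul_mem_testFunctions hχ hφi.1) i
    rw [← integral_add (m3 i) (m1 i)]
    refine Eq.trans (integral_congr_ae (Eventually.of_forall fun v => ?_)) (h1.trans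
      (integral_congr_ae (Eventually.of_forall fun v => by ring)))
    exact (pd_mul i (hφi.1.differentiable (by simp) v) (hχ.1.differentiable (by simp) v)).symm
  simp only [velocityOperator_apply, sub_mul, Finset.sum_mul]
  rw [integral_sub (integrable_finsetSum _ fun i _ => m1 i) (integrable_finsetSum _ fun i _ => m2 i),
    integral_finsetSum _ fun i _ => m1 i, integral_finsetSum _ fun i _ => m2 i, ← Finset.sum_sub_distrib,
    ← Finset.sum_neg_distrib]
  refine Finset.sum_congr rfl fun i _ => ?_
  linarith [key i]

/-- Integration by parts applied to `φ²`. It turns the gradient paired with a constant multiple of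
`φ` into `∇Φ₂`, and so produces the term that cancels in the position integration. -/
lemma integral_mul_pd_self {φ : Rd d → ℝ} (hφ : φ ∈ testFunctions (finiteSet Φ)) (i : Fin d) :
    ∫ v, φ v * pd i φ v ∂(expMeasure Φ) = 1 / 2 * ∫ v, φ v * (G v i * φ v) ∂(expMeasure Φ) := by
  have h1 := h.integral_pd (mul_mem_testFunctions hφ hφ.1) i
  have h2 : ∀ v, pd i (fun x => φ x * φ x) v = 2 * (φ v * pd i φ v) := by
    intro v
    rw [pd_mul i (hφ.1.differentiable (by simp) v) (hφ.1.differentiable (by simp) v)]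
    ring
  simp only [h2] at h1
  rw [integral_const_mul] at h1
  have h3 : ∫ v, φ v * (G v i * φ v) ∂(expMeasure Φ) = ∫ v, G v i * (φ v * φ v) ∂(expMeasure Φ) :=
    integral_congr_ae (Eventually.of_forall fun v => by ring)
  rw [h3, ← h1]
  ring

-- Young's inequality with exponent `2/α > 1` for the splitting `K t^α = (t^α/4) (4K)`; the
-- prefactor satisfies `(1/4)^{2/α} ≤ 1/4`. This is where `α < 2` is used: the growth of `ΔΦ₂`
-- becomes a small multiple of `|∇Φ₂|²`.
omit h in
lemma _root_.Langevin.exists_young_rpow {K α : ℝ} (hK : 0 < K) (hα : 1 ≤ α) (hα2 : α < 2) :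
    ∃ C, 0 < C ∧ ∀ t : ℝ, 0 ≤ t → K * (1 + t ^ α) ≤ 1 / 4 * t ^ 2 + C := by
  have hp : (2 / α).HolderConjugate (2 / α).conjExponent :=
    Real.HolderConjugate.conjExponent (by rw [lt_div_iff₀ (by linarith)]; linarith)
  set q := (2 / α).conjExponent
  refine ⟨K + (4 * K) ^ q / q, by have := hp.symm.pos; positivity, fun t ht => ?_⟩
  have h1 := Real.young_inequality_of_nonneg (a := t ^ α / 4) (b := 4 * K) (by positivity)
    (by positivity) hp
  have h2 : (t ^ α / 4) ^ (2 / α) / (2 / α) ≤ 1 / 4 * t ^ 2 := by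
    have h3 : 1 ≤ 2 / α := hp.lt.le
    calc (t ^ α / 4) ^ (2 / α) / (2 / α) ≤ (t ^ α / 4) ^ (2 / α) := div_le_self (by positivity) h3
      _ = (t ^ α) ^ (2 / α) * (1 / 4) ^ (2 / α) := by
          rw [div_eq_mul_one_div, Real.mul_rpow (by positivity) (by norm_num)]
      _ ≤ (t ^ α) ^ (2 / α) * (1 / 4) ^ (1 : ℝ) := by
          gcongr ?_ * ?_
          exact Real.rpow_le_rpow_of_exponent_ge (by norm_num) (by norm_num) h3
      _ = 1 / 4 * t ^ 2 := by
          rw [← Real.rpow_mul ht, mul_div_cancel₀ _ (by linarith), Real.rpow_one]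
          norm_num [mul_comm]
  linarith

/-- The gradient `∇Φ₂` is form bounded. -/
lemma exists_form_bound : ∃ C, 0 < C ∧ ∀ φ ∈ testFunctions (finiteSet Φ),
    ∑ i, ∫ v, (G v i * φ v) ^ 2 ∂(expMeasure Φ) ≤
      C * (∑ i, ∫ v, pd i φ v ^ 2 ∂(expMeasure Φ) + ∫ v, φ v ^ 2 ∂(expMeasure Φ)) := by
  obtain ⟨K, α, hK, hα, hα2, hbd⟩ := h.laplacian_bound
  obtain ⟨C, hC, hyoung⟩ := exists_young_rpow hK hα hα2
  -- Absorbing one half of the left-hand side doubles the coefficients `4` and `C` obtained below;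
  -- `8 + 2 C` dominates both.
  refine ⟨8 + 2 * C, by positivity, fun φ hφ => ?_⟩
  have hpot := h.isPotential
  obtain ⟨M, hM⟩ := hpot.exists_dens_le
  have hms := h.isOpen.measurableSet
  have hφ2 := mul_mem_testFunctions hφ hφ.1
  -- The product `e^{-Φ₂} ∂ᵢΦ₂` is weakly differentiable with derivative `e^{-Φ₂} (∂ᵢ²Φ₂ -
  -- (∂ᵢΦ₂)²)`; testing with `φ²` makes the square of the gradient appear.
  have hweak : ∀ i, IsWeakPartial (finiteSet Φ) i (fun v => dens Φ v * G v i)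
      fun v => -(dens Φ v * G v i) * G v i + dens Φ v * H i v := by
    intro i
    have hG2 : MemLpLoc (fun v => G v i) 2 (finiteSet Φ) volume := fun S hS hSΩ =>
      MemLp.coord (h.memLpLoc_two S hS hSΩ) i
    refine (hpot.isWeakPartial_dens h.isOpen h.weakGradient i).mul h.isOpen (h.weakSecond i)
      (M := M) (fun x _ => ?_) (fun S hS hSΩ => ?_) hG2
    · rw [abs_of_nonneg (dens_nonneg _ _)]; exact hM x
    · refine (hG2 S hS hSΩ).of_le_mul (c := M)
        ((hpot.measurable_dens.aestronglyMeasurable.mul (hG2 S hS hSΩ).1).neg)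
        (Eventually.of_forall fun x => ?_)
      rw [norm_neg, norm_mul, Real.norm_of_nonneg (dens_nonneg _ _)]
      gcongr
      exact hM x
  have iH : ∀ i, Integrable (fun v => H i v * φ v ^ 2) (expMeasure Φ) := by
    intro i
    obtain ⟨N, hN⟩ := testFunction_bounded hφ2
    rw [hpot.integrable_expMeasure_iff]
    have h1 := integrable_mul_testFunction (h.weakSecond i).2.1 hφ2.1.continuous hφ2.2.1 hφ2.2.2
    refine (h1.bdd_mul hpot.measurable_dens.aestronglyMeasurable (c := M)
      (Eventually.of_forall fun x => ?_)).congr (Eventually.of_forall fun x => by simp only; ring)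
    rw [Real.norm_of_nonneg (dens_nonneg _ _)]; exact hM x
  have iG : ∀ i, Integrable (fun v => (G v i * φ v) ^ 2) (expMeasure Φ) := fun i =>
    (h.memLp_grad_mul_testFunction hφ i).integrable_sq
  have ip : ∀ i, Integrable (fun v => pd i φ v ^ 2) (expMeasure Φ) := fun i =>
    (h.memLp_testFunction (pd_mem_testFunctions hφ i) 2).integrable_sq
  have iφ : Integrable (fun v => φ v ^ 2) (expMeasure Φ) := (h.memLp_testFunction hφ 2).integrable_sq
  have im : ∀ i, Integrable (fun v => G v i * φ v * pd i φ v) (expMeasure Φ) := fun i =>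
    (h.memLp_grad_mul_testFunction hφ i).integrable_mul
      (h.memLp_testFunction (pd_mem_testFunctions hφ i) 2)
  have key : ∀ i, ∫ v, (G v i * φ v) ^ 2 ∂(expMeasure Φ) =
      2 * (∫ v, G v i * φ v * pd i φ v ∂(expMeasure Φ)) + ∫ v, H i v * φ v ^ 2 ∂(expMeasure Φ) := by
    intro i
    have h1 := (hweak i).integral_eq hφ2
    have e1 : ∫ v, dens Φ v * G v i * fderiv ℝ (fun x => φ x * φ x) v (EuclideanSpace.single i 1) =
        2 * ∫ v, G v i * φ v * pd i φ v ∂(expMeasure Φ) := by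
      rw [hpot.integral_expMeasure, ← integral_const_mul]
      refine integral_congr_ae (Eventually.of_forall fun v => ?_)
      have := pd_mul i (hφ.1.differentiable (by simp) v) (hφ.1.differentiable (by simp) v)
      rw [pd] at this
      simp only [this]
      ring
    have e2 : ∫ v, (-(dens Φ v * G v i) * G v i + dens Φ v * H i v) * (φ v * φ v) =
        ∫ v, H i v * φ v ^ 2 ∂(expMeasure Φ) - ∫ v, (G v i * φ v) ^ 2 ∂(expMeasure Φ) := by
      rw [← integral_sub (iH i) (iG i), hpot.integral_expMeasure]
      exact integral_congr_ae (Eventually.of_forall fun v => by ring)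
    rw [e1, e2] at h1
    linarith
  have hsum : ∑ i, ∫ v, (G v i * φ v) ^ 2 ∂(expMeasure Φ) =
      ∫ v, (∑ i, (2 * (G v i * φ v * pd i φ v)) + (∑ i, H i v) * φ v ^ 2) ∂(expMeasure Φ) := by
    simp only [Finset.sum_mul]
    rw [integral_add (integrable_finsetSum _ fun i _ => (im i).const_mul 2)
      (integrable_finsetSum _ fun i _ => iH i), integral_finsetSum _ fun i _ => (im i).const_mul 2,
      integral_finsetSum _ fun i _ => iH i, ← Finset.sum_add_distrib]
    refine Finset.sum_congr rfl fun i _ => ?_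
    rw [key i, integral_const_mul]
  have hle : ∫ v, (∑ i, (2 * (G v i * φ v * pd i φ v)) + (∑ i, H i v) * φ v ^ 2) ∂(expMeasure Φ) ≤
      ∫ v, (∑ i, (1 / 2 * (G v i * φ v) ^ 2 + 4 * pd i φ v ^ 2) + C * φ v ^ 2) ∂(expMeasure Φ) := by
    refine integral_mono_ae ?_ ?_ ?_
    · simp only [Finset.sum_mul]
      exact (integrable_finsetSum _ fun i _ => (im i).const_mul 2).add
        (integrable_finsetSum _ fun i _ => iH i)
    · exact (integrable_finsetSum _ fun i _ => ((iG i).const_mul _).add ((ip i).const_mul _)).add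
        (iφ.const_mul _)
    · have h1 : ∀ᵐ v ∂(expMeasure Φ), |∑ i, H i v| ≤ K * (1 + ‖G v‖ ^ α) :=
        hpot.ae_expMeasure_iff.2 ((ae_restrict_iff' hms).1 hbd)
      filter_upwards [h1] with v hv
      have h2 : (∑ i, H i v) ≤ 1 / 4 * ∑ i, G v i ^ 2 + C := by
        have h3 := (le_abs_self _).trans (hv.trans (hyoung _ (norm_nonneg (G v))))
        rw [EuclideanSpace.norm_sq_eq] at h3
        simpa using h3
      have h4 : (∑ i, H i v) * φ v ^ 2 ≤ ∑ i, 1 / 4 * (G v i * φ v) ^ 2 + C * φ v ^ 2 := by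
        have h5 := mul_le_mul_of_nonneg_right h2 (sq_nonneg (φ v))
        have h6 : (1 / 4 * ∑ i, G v i ^ 2 + C) * φ v ^ 2 =
            ∑ i, 1 / 4 * (G v i * φ v) ^ 2 + C * φ v ^ 2 := by
          rw [Finset.mul_sum, add_mul, Finset.sum_mul]
          congr 1
          exact Finset.sum_congr rfl fun i _ => by ring
        linarith
      -- The inequality `2xy ≤ x²/4 + 4y²`, together with the quarter from the bound on the
      -- Laplacian, leaves the factor one half.
      have h7 : ∑ i, (2 * (G v i * φ v * pd i φ v)) + ∑ i, 1 / 4 * (G v i * φ v) ^ 2 ≤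
          ∑ i, (1 / 2 * (G v i * φ v) ^ 2 + 4 * pd i φ v ^ 2) := by
        rw [← Finset.sum_add_distrib]
        refine Finset.sum_le_sum fun i _ => ?_
        nlinarith [sq_nonneg (1 / 2 * (G v i * φ v) - 2 * pd i φ v)]
      linarith
  have hrhs : ∫ v, (∑ i, (1 / 2 * (G v i * φ v) ^ 2 + 4 * pd i φ v ^ 2) + C * φ v ^ 2) ∂(expMeasure Φ) =
      1 / 2 * ∑ i, ∫ v, (G v i * φ v) ^ 2 ∂(expMeasure Φ) + 4 * ∑ i, ∫ v, pd i φ v ^ 2 ∂(expMeasure Φ) +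
        C * ∫ v, φ v ^ 2 ∂(expMeasure Φ) := by
    have i1 : ∀ i, Integrable (fun v => 1 / 2 * (G v i * φ v) ^ 2 + 4 * pd i φ v ^ 2) (expMeasure Φ) :=
      fun i => ((iG i).const_mul _).add ((ip i).const_mul _)
    rw [integral_add (integrable_finsetSum _ fun i _ => i1 i)
      (iφ.const_mul _), integral_finsetSum _ fun i _ => i1 i,
      integral_const_mul, Finset.mul_sum, Finset.mul_sum, ← Finset.sum_add_distrib]
    congr 1
    refine Finset.sum_congr rfl fun i _ => ?_
    rw [integral_add ((iG i).const_mul _) ((ip i).const_mul _), integral_const_mul, integral_const_mul]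
  have hn1 : 0 ≤ ∑ i, ∫ v, pd i φ v ^ 2 ∂(expMeasure Φ) :=
    Finset.sum_nonneg fun i _ => integral_nonneg fun v => sq_nonneg _
  have hn2 : 0 ≤ ∫ v, φ v ^ 2 ∂(expMeasure Φ) := integral_nonneg fun v => sq_nonneg _
  rw [← hsum, hrhs] at hle
  nlinarith [mul_nonneg hC.le hn1]

end VelocityPotential

/-- The partial derivative of test functions as a linear map. -/
def pdLin {d : ℕ} (Ω : Set (Rd d)) (i : Fin d) : testFunctions Ω →ₗ[ℝ] (Rd d → ℝ) where
  toFun φ := pd i (φ : Rd d → ℝ)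
  map_add' φ χ := by
    funext x
    have h1 := fderiv_add (φ.2.1.differentiable (by simp) x) (χ.2.1.differentiable (by simp) x)
    simp only [pd, Pi.add_apply]
    rw [Submodule.coe_add, h1]
    rfl
  map_smul' c φ := by
    funext x
    have h1 := fderiv_const_smul (φ.2.1.differentiable (by simp) x) c
    simp only [pd, Pi.smul_apply, RingHom.id_apply]
    rw [Submodule.coe_smul, h1]
    rfl

/-- Multiplication of test functions by a fixed function. -/
def mulLin {d : ℕ} (Ω : Set (Rd d)) (g : Rd d → ℝ) : testFunctions Ω →ₗ[ℝ] (Rd d → ℝ) where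
  toFun φ v := g v * (φ : Rd d → ℝ) v
  map_add' φ χ := by funext v; simp [mul_add]
  map_smul' c φ := by funext v; simp; ring

lemma vecToLp_sub {X : Type*} [MeasurableSpace X] {μ : Measure X} {d : ℕ} {F F' : Fin d → X → ℝ}
    (hF : ∀ i, MemLp (F i) 2 μ) (hF' : ∀ i, MemLp (F' i) 2 μ) :
    vecToLp (fun i x => F i x - F' i x) (fun i => (hF i).sub (hF' i)) = vecToLp F hF - vecToLp F' hF' :=
  rfl

lemma integrable_mul_of_memLp_two {X : Type*} [MeasurableSpace X] {μ : Measure X} {f g : X → ℝ}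
    (hf : MemLp f 2 μ) (hg : MemLp g 2 μ) : Integrable (fun x => f x * g x) μ :=
  hf.integrable_mul hg

lemma integral_sum_mul {X ι : Type*} [Fintype ι] [MeasurableSpace X] {μ : Measure X} {F : ι → X → ℝ}
    {f : X → ℝ} (hF : ∀ i, MemLp (F i) 2 μ) (hf : MemLp f 2 μ) :
    ∫ x, (∑ i, F i x) * f x ∂μ = ∑ i, ∫ x, F i x * f x ∂μ := by
  simp only [Finset.sum_mul]
  exact integral_finsetSum _ fun i _ => integrable_mul_of_memLp_two (hF i) hf

lemma operatorGraph_mem_eq {X : Type*} [MeasurableSpace X] {μ : Measure X} {D : Submodule ℝ (X → ℝ)}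
    {L : D →ₗ[ℝ] (X → ℝ)} (hD : ∀ f : D, MemLp (D.subtype f) 2 μ) (hL : ∀ f, MemLp (L f) 2 μ)
    {p : Lp ℝ 2 μ × Lp ℝ 2 μ} (hp : p ∈ operatorGraph μ 2 D L) :
    ∃ f : D, p = (toL2 μ D.subtype hD f, toL2 μ L hL f) := by
  obtain ⟨f, h1, h2⟩ := hp
  exact ⟨f, Prod.ext (Lp.ext (h1.trans (hD f).coeFn_toLp.symm)) (Lp.ext (h2.trans (hL f).coeFn_toLp.symm))⟩

/-! ### Energy estimate for the velocity equation -/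

namespace VelocityPotential

variable {d : ℕ} {Φ : Rd d → EReal} {G : Rd d → Rd d} {H : Fin d → Rd d → ℝ}
  (h : VelocityPotential Φ G H)
include h

/-- A priori estimate for bounded weak solutions of `c u - Δu + ∇Φ₂ · ∇u = ∇Φ₂ · (Q - R) + ∇ · Z`. -/
lemma exists_energy_estimate {c : ℝ} (hc : 0 < c) : ∃ K, 0 ≤ K ∧
    ∀ (u : Rd d → ℝ) (Q R Z : Fin d → Rd d → ℝ) (g : Fin d → ℝ),
      Measurable u → (∀ i, Measurable (Q i)) → (∀ i, Measurable (R i)) → (∀ i, Measurable (Z i)) →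
      (∃ M, ∀ v, |u v| ≤ M) → (∀ i, ∃ M, ∀ v, |Q i v| ≤ M) → (∀ i, ∃ M, ∀ v, |R i v| ≤ M) →
      (∀ i, ∃ M, ∀ v, |Z i v| ≤ M) →
      (∀ φ : testFunctions (finiteSet Φ),
        ∫ v, u v * (c * (φ : Rd d → ℝ) v - velocityOperator G (finiteSet Φ) φ v) ∂(expMeasure Φ) -
          ∑ i, ∫ v, (Q i v - R i v) * (G v i * (φ : Rd d → ℝ) v) ∂(expMeasure Φ) +
          ∑ i, ∫ v, Z i v * pd i (φ : Rd d → ℝ) v ∂(expMeasure Φ) = 0) →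
      c / 2 * ∫ v, u v ^ 2 ∂(expMeasure Φ) + ∑ i, ∫ v, R i v * (G v i * u v) ∂(expMeasure Φ) +
        1 / 2 * ∑ i, g i * ∫ v, u v * (G v i * u v) ∂(expMeasure Φ) ≤
      1 / 2 * ∑ i, ∫ v, (Z i v - g i * u v) ^ 2 ∂(expMeasure Φ) +
        K * ∑ i, ∫ v, Q i v ^ 2 ∂(expMeasure Φ) := by
  obtain ⟨C, hC, hform⟩ := h.exists_form_bound
  have hfin := h.finite
  set D := testFunctions (finiteSet Φ)
  set μ := expMeasure Φ
  -- The largest `κ` satisfying both smallness conditions of `energy_estimate`.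
  set κ := min (1 / 2) (c / 2) / C with hκdef
  have hκ : 0 < κ := by positivity
  have hκC : κ * C = min (1 / 2) (c / 2) := by rw [hκdef]; field_simp
  refine ⟨1 / (4 * κ), by positivity, ?_⟩
  intro u Q R Z g mu mQ mR mZ bu bQ bR bZ heq
  have bdd : ∀ {w : Rd d → ℝ}, Measurable w → (∃ M, ∀ v, |w v| ≤ M) → MemLp w 2 μ := fun hw ⟨M, hb⟩ =>
    MemLp.of_bound hw.aestronglyMeasurable M (Eventually.of_forall hb)
  have hu := bdd mu bu
  have hQ := fun i => bdd (mQ i) (bQ i)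
  have hR := fun i => bdd (mR i) (bR i)
  have hZ := fun i => bdd (mZ i) (bZ i)
  have hGu : ∀ {w : Rd d → ℝ}, Measurable w → (∃ M, ∀ v, |w v| ≤ M) → ∀ i, MemLp (fun v => G v i * w v) 2 μ :=
    fun hw ⟨_, hb⟩ i => h.memLp_grad_mul i hw.aestronglyMeasurable hb
  have hι : ∀ f : D, MemLp (D.subtype f) 2 μ := fun f => h.memLp_testFunction f.2 2
  have hσ := h.memLp_velocityOperator
  have hδ : ∀ i, ∀ f : D, MemLp (pdLin (finiteSet Φ) i f) 2 μ := fun i f =>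
    h.memLp_testFunction (pd_mem_testFunctions f.2 i) 2
  have hγ : ∀ i, ∀ f : D, MemLp (mulLin (finiteSet Φ) (fun v => G v i) f) 2 μ := fun i f =>
    h.memLp_grad_mul_testFunction f.2 i
  set ι := toL2 μ D.subtype hι
  set σ := toL2 μ (velocityOperator G (finiteSet Φ)) hσ
  set δ := toVecL2 μ (pdLin (finiteSet Φ)) hδ
  set γ := toVecL2 μ (fun i => mulLin (finiteSet Φ) (fun v => G v i)) hγ
  have hιf : ∀ f, ι f = (hι f).toLp _ := fun f => rfl
  have hσf : ∀ f, σ f = (hσ f).toLp _ := fun f => rfl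
  have hδf : ∀ f, δ f = vecToLp _ fun i => hδ i f := fun f => rfl
  have hγf : ∀ f, γ f = vecToLp _ fun i => hγ i f := fun f => rfl
  have hsymm : ∀ f, inner ℝ (σ f) (ι f) = -‖δ f‖ ^ 2 := by
    intro f
    rw [hσf, hιf, hδf, inner_toLp, norm_vecToLp_sq]
    refine (h.integral_velocityOperator_mul f f.2).trans ?_
    congr 1
    exact Finset.sum_congr rfl fun i _ => integral_congr_ae (Eventually.of_forall fun v => (sq _).symm)
  have hgraph := lpOperator_graph h.isPotential 2 (velocityOperator G (finiteSet Φ))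
  have hneg : ∀ p ∈ (lpOperator μ 2 D (velocityOperator G (finiteSet Φ))).graph, inner ℝ p.2 p.1 ≤ 0 := by
    intro p hp
    obtain ⟨f, rfl⟩ := operatorGraph_mem_eq hι hσ (hgraph ▸ hp)
    have h1 := hsymm f
    simp only
    rw [h1]
    have := sq_nonneg ‖δ f‖
    linarith
  have hres : ∀ s : ℝ, 0 < s → ∀ (w : Lp ℝ 2 μ) (ε : ℝ), 0 < ε → ∃ f, ‖ι f - s • σ f - w‖ < ε := by
    intro s hs w ε hε
    obtain ⟨p, hp, hp'⟩ := h.essentiallySelfAdjoint.exists_resolvent_approx hneg hs w hε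
    obtain ⟨f, rfl⟩ := operatorGraph_mem_eq hι hσ (hgraph ▸ hp)
    exact ⟨f, hp'⟩
  have hdense : ∀ (w : Lp ℝ 2 μ) (ε : ℝ), 0 < ε → ∃ f, ‖ι f - w‖ < ε := by
    intro w ε hε
    obtain ⟨w', hw', hd⟩ := Metric.mem_closure_iff.1 (h.essentiallySelfAdjoint.dense_domain w) ε hε
    obtain ⟨y, hy⟩ := LinearPMap.mem_domain_iff.1 hw'
    obtain ⟨f, hf⟩ := operatorGraph_mem_eq hι hσ (hgraph ▸ hy)
    refine ⟨f, ?_⟩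
    have hw1 : w' = ι f := congrArg Prod.fst hf
    rw [← hw1, ← dist_eq_norm, dist_comm]
    exact hd
  have hkato : ∀ f, ‖γ f‖ ^ 2 ≤ C * (‖δ f‖ ^ 2 + ‖ι f‖ ^ 2) := by
    intro f
    rw [hγf, hδf, hιf, norm_vecToLp_sq, norm_vecToLp_sq, norm_toLp_sq]
    exact hform f f.2
  -- The choices `r = ∑ Gᵢ Rᵢ` and `t = ∑ gᵢ Gᵢ u` move the factor `∇Φ₂` away from the test
  -- function; they are in `L²` because `R` and `u` are bounded and `∇Φ₂` is square integrable.
  have hmain := energy_estimate hsymm hres hdense hC hkato hc hκ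
    (hκC.le.trans (min_le_left _ _)) (hκC.le.trans (min_le_right _ _))
    (u := hu.toLp u) (Q := vecToLp Q hQ) (R := vecToLp R hR) (Z := vecToLp Z hZ)
    (τ := constVecMul μ g)
    (r := (memLp_finsetSum Finset.univ fun i _ => hGu (mR i) (bR i) i).toLp _)
    (t := (memLp_finsetSum Finset.univ fun i _ => (hGu mu bu i).const_mul (g i)).toLp _)
    (fun f => ?_) (fun f => ?_) (fun f => ?_) (fun f => ?_)
  · rw [norm_toLp_sq, inner_toLp, inner_toLp, constVecMul_toLp, ← vecToLp_sub, norm_vecToLp_sq,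
      norm_vecToLp_sq] at hmain
    have e1 : ∫ v, (∑ i, G v i * R i v) * u v ∂μ = ∑ i, ∫ v, R i v * (G v i * u v) ∂μ := by
      rw [integral_sum_mul (fun i => hGu (mR i) (bR i) i) hu]
      exact Finset.sum_congr rfl fun i _ => integral_congr_ae (Eventually.of_forall fun v => by ring)
    have e2 : ∫ v, (∑ i, g i * (G v i * u v)) * u v ∂μ = ∑ i, g i * ∫ v, u v * (G v i * u v) ∂μ := by
      rw [integral_sum_mul (fun i => (hGu mu bu i).const_mul (g i)) hu]
      refine Finset.sum_congr rfl fun i _ => ?_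
      rw [← integral_const_mul]
      exact integral_congr_ae (Eventually.of_forall fun v => by ring)
    rw [e1, e2] at hmain
    exact hmain
  · have e0 : c • ι f - σ f = (((hι f).const_mul c).sub (hσ f)).toLp _ := rfl
    rw [e0, hγf, hδf, ← vecToLp_sub, inner_toLp, inner_vecToLp, inner_vecToLp]
    exact heq f
  · rw [hιf, hδf, hγf, constVecMul_toLp, inner_vecToLp, inner_vecToLp, Finset.mul_sum]
    refine Finset.sum_congr rfl fun i _ => ?_
    have h1 := h.integral_mul_pd_self f.2 i
    have e1 : ∀ w : Rd d → ℝ, ∫ v, g i * (f : Rd d → ℝ) v * w v ∂μ =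
        g i * ∫ v, (f : Rd d → ℝ) v * w v ∂μ := fun w => by
      rw [← integral_const_mul]
      simp only [mul_assoc]
    refine (e1 _).trans ?_
    refine Eq.trans ?_ (congrArg (1 / 2 * ·) (e1 _).symm)
    refine (congrArg (g i * ·) h1).trans ?_
    simp only [mulLin, LinearMap.coe_mk, AddHom.coe_mk]
    ring
  · rw [hιf, hγf, inner_vecToLp, inner_toLp, integral_sum_mul (fun i => hGu (mR i) (bR i) i) (hι f)]
    exact Finset.sum_congr rfl fun i _ => integral_congr_ae (Eventually.of_forall fun v => by
      simp [mulLin]; ring)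
  · rw [hιf, hγf, constVecMul_toLp, inner_vecToLp, inner_toLp,
      integral_sum_mul (fun i => (hGu mu bu i).const_mul (g i)) (hι f)]
    exact Finset.sum_congr rfl fun i _ => integral_congr_ae (Eventually.of_forall fun v => by
      simp [mulLin]; ring)

end VelocityPotential

/-! ### Directional derivatives and composition of test functions -/

section Directional

variable {X : Type*} [NormedAddCommGroup X] [NormedSpace ℝ X]

/-- The directional derivative. -/
def dd (e : X) (f : X → ℝ) (z : X) : ℝ := fderiv ℝ f z e

lemma dd_mem_testFunctions {Ω : Set X} {f : X → ℝ} (hf : f ∈ testFunctions Ω) (e : X) :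
    dd e f ∈ testFunctions Ω := by
  refine ⟨(hf.1.fderiv_right (m := ∞) (by simp)).clm_apply contDiff_const, hf.2.1.fderiv_apply ℝ _,
    (closure_minimal (fun x hx => ?_) (isClosed_tsupport f)).trans hf.2.2⟩
  refine support_fderiv_subset ℝ fun h => hx ?_
  change fderiv ℝ f x e = 0
  rw [h]; rfl

lemma dd_comm {f : X → ℝ} (hf : ContDiff ℝ ∞ f) (e e' : X) : dd e (dd e' f) = dd e' (dd e f) := by
  have h1 : ∀ z, HasFDerivAt (fderiv ℝ f) (fderiv ℝ (fderiv ℝ f) z) z := fun z =>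
    ((hf.fderiv_right (m := 1) (one_add_one_eq_two.trans_le two_le_infty)).differentiable (by simp) z).hasFDerivAt
  have h2 : ∀ e e' z, dd e (dd e' f) z = fderiv ℝ (fderiv ℝ f) z e e' := by
    intro e e' z
    have h3 := (h1 z).clm_apply (hasFDerivAt_const e' z)
    change fderiv ℝ (fun z => fderiv ℝ f z e') z e = _
    rw [h3.fderiv]
    simp
  funext z
  rw [h2, h2]
  exact (hf.contDiffAt.isSymmSndFDerivAt (by simpa using two_le_infty)) e e'

lemma dd_comp {f : X → ℝ} {B : ℝ → ℝ} {z : X} (hf : DifferentiableAt ℝ f z)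
    (hB : DifferentiableAt ℝ B (f z)) (e : X) : dd e (fun z => B (f z)) z = deriv B (f z) * dd e f z := by
  have h := hB.hasDerivAt.comp_hasFDerivAt z hf.hasFDerivAt
  change fderiv ℝ (B ∘ f) z e = _
  rw [h.fderiv]
  simp [dd]

lemma dd_mul {f g : X → ℝ} {z : X} (hf : DifferentiableAt ℝ f z) (hg : DifferentiableAt ℝ g z) (e : X) :
    dd e (fun z => f z * g z) z = f z * dd e g z + dd e f z * g z := by
  have h : HasFDerivAt (fun z => f z * g z) _ z := hf.hasFDerivAt.mul hg.hasFDerivAt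
  rw [dd, h.fderiv]
  simp [dd, mul_comm]

lemma comp_mem_testFunctions {Ω : Set X} {f : X → ℝ} (hf : f ∈ testFunctions Ω) {B : ℝ → ℝ}
    (hB : ContDiff ℝ ∞ B) (hB0 : B 0 = 0) : (fun z => B (f z)) ∈ testFunctions Ω := by
  refine ⟨hB.comp hf.1, hf.2.1.comp_left hB0, (closure_mono fun z hz => ?_).trans hf.2.2⟩
  exact fun hfz => hz (by simp [hfz, hB0])

lemma testFunction_bounded' {Ω : Set X} {φ : X → ℝ} (hφ : φ ∈ testFunctions Ω) :
    ∃ C, ∀ x, |φ x| ≤ C := hφ.1.continuous.bounded_above_of_compact_support hφ.2.1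

end Directional

/-! ### Slices, tensor products and the Langevin operator in coordinates -/

section Slices

variable {d : ℕ} {Φ₁ Φ₂ : Rd d → EReal}

/-- The `i`-th coordinate direction in position space. -/
def ex (i : Fin d) : Rd d × Rd d := (EuclideanSpace.single i 1, 0)

/-- The `i`-th coordinate direction in velocity space. -/
def ev (i : Fin d) : Rd d × Rd d := (0, EuclideanSpace.single i 1)

lemma pd_slice_left {f : Rd d × Rd d → ℝ} (hf : ContDiff ℝ ∞ f) (i : Fin d) (x v : Rd d) :
    pd i (fun x => f (x, v)) x = dd (ex i) f (x, v) := by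
  have h1 : HasFDerivAt (fun x : Rd d => (x, v)) _ x := (hasFDerivAt_id x).prodMk (hasFDerivAt_const (𝕜 := ℝ) v x)
  have h2 : HasFDerivAt (fun x => f (x, v)) _ x :=
    (hf.differentiable (by simp) (x, v)).hasFDerivAt.comp x h1
  rw [pd, h2.fderiv]
  rfl

lemma pd_slice_right {f : Rd d × Rd d → ℝ} (hf : ContDiff ℝ ∞ f) (i : Fin d) (x v : Rd d) :
    pd i (fun v => f (x, v)) v = dd (ev i) f (x, v) := by
  have h1 : HasFDerivAt (fun v : Rd d => (x, v)) _ v := (hasFDerivAt_const (𝕜 := ℝ) x v).prodMk (hasFDerivAt_id v)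
  have h2 : HasFDerivAt (fun v => f (x, v)) _ v :=
    (hf.differentiable (by simp) (x, v)).hasFDerivAt.comp v h1
  rw [pd, h2.fderiv]
  rfl

lemma slice_left_mem_testFunctions {f : Rd d × Rd d → ℝ} (hf : f ∈ testFunctions (finiteSet₂ Φ₁ Φ₂))
    (v : Rd d) : (fun x => f (x, v)) ∈ testFunctions (finiteSet Φ₁) := by
  have he : IsClosedEmbedding fun x : Rd d => (x, v) := by
    refine Topology.IsClosedEmbedding.of_continuous_injective_isClosedMap (by fun_prop)
      (fun x y hxy => congrArg Prod.fst hxy) fun s hs => ?_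
    have : (fun x : Rd d => (x, v)) '' s = s ×ˢ {v} := by ext ⟨a, b⟩; simp [eq_comm]
    rw [this]
    exact hs.prod isClosed_singleton
  refine ⟨hf.1.comp (contDiff_id.prodMk contDiff_const), hf.2.1.comp_isClosedEmbedding he,
    fun x hx => ?_⟩
  have := tsupport_comp_subset_preimage f he.continuous hx
  exact (hf.2.2 this).1

lemma slice_right_mem_testFunctions {f : Rd d × Rd d → ℝ} (hf : f ∈ testFunctions (finiteSet₂ Φ₁ Φ₂))
    (x : Rd d) : (fun v => f (x, v)) ∈ testFunctions (finiteSet Φ₂) := by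
  have he : IsClosedEmbedding fun v : Rd d => (x, v) := by
    refine Topology.IsClosedEmbedding.of_continuous_injective_isClosedMap (by fun_prop)
      (fun x y hxy => congrArg Prod.snd hxy) fun s hs => ?_
    have : (fun v : Rd d => (x, v)) '' s = {x} ×ˢ s := by ext ⟨a, b⟩; simp [eq_comm, and_comm]
    rw [this]
    exact isClosed_singleton.prod hs
  refine ⟨hf.1.comp (contDiff_const.prodMk contDiff_id), hf.2.1.comp_isClosedEmbedding he,
    fun v hv => ?_⟩
  have := tsupport_comp_subset_preimage f he.continuous hv
  exact (hf.2.2 this).2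

lemma prod_mem_testFunctions {a φ : Rd d → ℝ} (ha : a ∈ testFunctions (finiteSet Φ₁))
    (hφ : φ ∈ testFunctions (finiteSet Φ₂)) :
    (fun z : Rd d × Rd d => a z.1 * φ z.2) ∈ testFunctions (finiteSet₂ Φ₁ Φ₂) := by
  have hs : tsupport (fun z : Rd d × Rd d => a z.1 * φ z.2) ⊆ tsupport a ×ˢ tsupport φ := by
    refine closure_minimal (fun z hz => ?_) ((isClosed_tsupport a).prod (isClosed_tsupport φ))
    have := mul_ne_zero_iff.1 hz
    exact ⟨subset_tsupport _ this.1, subset_tsupport _ this.2⟩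
  refine ⟨(ha.1.comp contDiff_fst).mul (hφ.1.comp contDiff_snd), ?_, fun z hz => ?_⟩
  · exact (IsCompact.prod ha.2.1 hφ.2.1).of_isClosed_subset (isClosed_tsupport _) hs
  · exact ⟨ha.2.2 (hs hz).1, hφ.2.2 (hs hz).2⟩

lemma langevinOperator_apply (G₁ G₂ : Rd d → Rd d) {Ω : Set (Rd d × Rd d)} (f : testFunctions Ω)
    (z : Rd d × Rd d) :
    langevinOperator G₁ G₂ Ω f z = ∑ i, (dd (ev i) (dd (ev i) (f : Rd d × Rd d → ℝ)) z -
      G₂ z.2 i * dd (ev i) (f : Rd d × Rd d → ℝ) z + G₂ z.2 i * dd (ex i) (f : Rd d × Rd d → ℝ) z -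
      G₁ z.1 i * dd (ev i) (f : Rd d × Rd d → ℝ) z) := by
  obtain ⟨x, v⟩ := z
  have hf := f.2.1
  have hs : ContDiff ℝ ∞ fun v => (f : Rd d × Rd d → ℝ) (x, v) := hf.comp (contDiff_const.prodMk contDiff_id)
  have hd := fun i => (dd_mem_testFunctions f.2 (ev i)).1
  have e : ∀ i, pd i (fun v => (f : Rd d × Rd d → ℝ) (x, v)) = fun v => dd (ev i) f (x, v) := fun i =>
    funext fun v => pd_slice_right hf i x v
  have e1 : laplaceV f (x, v) = ∑ i, dd (ev i) (dd (ev i) (f : Rd d × Rd d → ℝ)) (x, v) := by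
    refine (laplacian_eq_sum_pd (hs.of_le two_le_infty) v).trans (Finset.sum_congr rfl fun i _ => ?_)
    rw [e i, pd_slice_right (hd i) i x v]
  have e2 : ∀ w, inner ℝ w (gradV f (x, v)) = ∑ i, w i * dd (ev i) (f : Rd d × Rd d → ℝ) (x, v) := by
    intro w
    refine (inner_gradient_eq_sum_pd _ v w).trans (Finset.sum_congr rfl fun i _ => ?_)
    rw [e i]
  have e3 : ∀ w, inner ℝ w (gradX f (x, v)) = ∑ i, w i * dd (ex i) (f : Rd d × Rd d → ℝ) (x, v) := by
    intro w
    refine (inner_gradient_eq_sum_pd _ x w).trans (Finset.sum_congr rfl fun i _ => ?_)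
    rw [pd_slice_left hf]
  change laplaceV f (x, v) - inner ℝ (G₂ v) (gradV f (x, v)) + inner ℝ (G₂ v) (gradX f (x, v)) -
    inner ℝ (G₁ x) (gradV f (x, v)) = _
  rw [e1, e2, e2, e3, ← Finset.sum_sub_distrib, ← Finset.sum_add_distrib, ← Finset.sum_sub_distrib]

lemma langevinOperator_prod (G₁ G₂ : Rd d → Rd d) {a φ : Rd d → ℝ} (ha : a ∈ testFunctions (finiteSet Φ₁))
    (hφ : φ ∈ testFunctions (finiteSet Φ₂)) (x v : Rd d) :
    langevinOperator G₁ G₂ (finiteSet₂ Φ₁ Φ₂) ⟨_, prod_mem_testFunctions ha hφ⟩ (x, v) =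
      a x * velocityOperator G₂ (finiteSet Φ₂) ⟨φ, hφ⟩ v + ∑ i, G₂ v i * φ v * pd i a x -
        ∑ i, G₁ x i * a x * pd i φ v := by
  have e1 : ∀ i, ∀ {φ : Rd d → ℝ}, φ ∈ testFunctions (finiteSet Φ₂) →
      dd (ev i) (fun z : Rd d × Rd d => a z.1 * φ z.2) = fun z => a z.1 * pd i φ z.2 := by
    intro i φ hφ
    funext ⟨x, v⟩
    rw [← pd_slice_right (prod_mem_testFunctions ha hφ).1]
    have h1 := (hφ.1.differentiable (by simp) v).hasFDerivAt.const_mul (a x)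
    rw [pd, h1.fderiv]
    rfl
  have e2 : ∀ i, dd (ex i) (fun z : Rd d × Rd d => a z.1 * φ z.2) (x, v) = φ v * pd i a x := by
    intro i
    rw [← pd_slice_left (prod_mem_testFunctions ha hφ).1]
    have h1 := (ha.1.differentiable (by simp) x).hasFDerivAt.mul_const (φ v)
    rw [pd, h1.fderiv]
    rfl
  rw [langevinOperator_apply, velocityOperator_apply]
  simp only [e1 _ hφ, e1 _ (pd_mem_testFunctions hφ _), e2]
  rw [mul_sub, Finset.mul_sum, Finset.mul_sum, ← Finset.sum_sub_distrib, ← Finset.sum_add_distrib,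
    ← Finset.sum_sub_distrib]
  exact Finset.sum_congr rfl fun i _ => by ring

end Slices

lemma IsPotential.expMeasure_lt_top_of_isCompact {d : ℕ} {Φ : Rd d → EReal} (h : IsPotential Φ)
    {K : Set (Rd d)} (hK : IsCompact K) : expMeasure Φ K < ⊤ := by
  obtain ⟨c, hc, hle⟩ := h.exists_expMeasure_le
  refine (hle K).trans_lt ?_
  simpa using ENNReal.mul_lt_top hc.lt_top hK.measure_lt_top

/-! ### Basic properties of the position potential -/

namespace PositionPotential

variable {d : ℕ} {q : ℝ≥0∞} {Φ : Rd d → EReal} {G : Rd d → Rd d} (h : PositionPotential q Φ G)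
include h

lemma isPotential : IsPotential Φ := ⟨h.continuous_exp.measurable, h.bddBelow⟩

omit h in
lemma _root_.Langevin.finiteSet_eq (Φ : Rd d → EReal) : finiteSet Φ = {x | 0 < EReal.exp (-Φ x)} := by
  ext x
  simp only [finiteSet, Set.mem_ofPred_eq, pos_iff_ne_zero, Ne, EReal.exp_eq_zero_iff,
    EReal.neg_eq_bot_iff, lt_top_iff_ne_top]

lemma isOpen : IsOpen (finiteSet Φ) := by
  rw [finiteSet_eq]
  exact isOpen_lt continuous_const h.continuous_exp

/-- The bounded density makes `μ_{Φ₁}` finite on compact sets, so local integrability exponents may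
be lowered. The energy method works with the exponent two. -/
lemma to_two (hq : 2 ≤ q) : PositionPotential 2 Φ G :=
  ⟨h.bddBelow, h.nonempty, h.continuous_exp, h.weakGradient, fun K hK _ => by
    have : IsFiniteMeasure ((expMeasure Φ).restrict K) :=
      ⟨by simpa using h.isPotential.expMeasure_lt_top_of_isCompact hK⟩
    exact (h.memLpLoc K hK (Set.subset_univ K)).mono_exponent hq⟩

lemma continuous_dens : Continuous (dens Φ) := by
  refine continuous_iff_continuousAt.2 fun x => ?_
  exact (ENNReal.tendsto_toReal (h.isPotential.exp_ne_top x)).comp h.continuous_exp.continuousAt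

end PositionPotential

/-! ### Product structure and invariance of the phase space measure -/

section PhaseSpace

variable {d : ℕ} {Φ₁ Φ₂ : Rd d → EReal} {G₁ G₂ : Rd d → Rd d} {H₂ : Fin d → Rd d → ℝ}

lemma phaseMeasure_eq_prod (p₁ : IsPotential Φ₁) (p₂ : IsPotential Φ₂) :
    phaseMeasure Φ₁ Φ₂ = (expMeasure Φ₁).prod (expMeasure Φ₂) := by
  have e := prod_withDensity (μ := (volume : Measure (Rd d))) (ν := (volume : Measure (Rd d)))
    p₁.measurable_exp p₂.measurable_exp
  unfold phaseMeasure expMeasure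
  rw [e, ← Measure.volume_eq_prod]
  congr 1
  funext z
  rw [← EReal.exp_add, EReal.neg_add (Or.inl (p₁.ne_bot _)) (Or.inr (p₂.ne_bot _)), sub_eq_add_neg]

lemma add_lt_top_iff_of_isPotential (p₁ : IsPotential Φ₁) (p₂ : IsPotential Φ₂) (z : Rd d × Rd d) :
    Φ₁ z.1 + Φ₂ z.2 < ⊤ ↔ Φ₁ z.1 < ⊤ ∧ Φ₂ z.2 < ⊤ := by
  refine ⟨fun hz => ⟨?_, ?_⟩, fun hz => EReal.add_lt_top hz.1.ne hz.2.ne⟩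
  · by_contra hcon
    rw [not_lt_top_iff.1 hcon, EReal.top_add_of_ne_bot (p₂.ne_bot _)] at hz
    exact lt_irrefl _ hz
  · by_contra hcon
    rw [not_lt_top_iff.1 hcon, EReal.add_top_of_ne_bot (p₁.ne_bot _)] at hz
    exact lt_irrefl _ hz

lemma finiteSet₂_eq (p₁ : IsPotential Φ₁) (p₂ : IsPotential Φ₂) :
    finiteSet₂ Φ₁ Φ₂ = {z | Φ₁ z.1 + Φ₂ z.2 < ⊤} :=
  Set.ext fun z => (add_lt_top_iff_of_isPotential p₁ p₂ z).symm

lemma IsPotential.add (p₁ : IsPotential Φ₁) (p₂ : IsPotential Φ₂) :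
    IsPotential fun z : Rd d × Rd d => Φ₁ z.1 + Φ₂ z.2 := by
  obtain ⟨c₁, h₁⟩ := p₁.bddBelow
  obtain ⟨c₂, h₂⟩ := p₂.bddBelow
  refine ⟨?_, c₁ + c₂, fun z => ?_⟩
  · have : (fun z : Rd d × Rd d => EReal.exp (-(Φ₁ z.1 + Φ₂ z.2))) =
        fun z => EReal.exp (-Φ₁ z.1) * EReal.exp (-Φ₂ z.2) := funext fun z => by
      rw [← EReal.exp_add, EReal.neg_add (Or.inl (p₁.ne_bot _)) (Or.inr (p₂.ne_bot _)), sub_eq_add_neg]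
    rw [this]
    exact (p₁.measurable_exp.comp measurable_fst).mul (p₂.measurable_exp.comp measurable_snd)
  · rw [EReal.coe_add]
    exact add_le_add (h₁ _) (h₂ _)

variable (h₁ : PositionPotential 2 Φ₁ G₁) (h₂ : VelocityPotential Φ₂ G₂ H₂)
include h₁ h₂

/-- Products of locally square integrable functions with test functions. -/
lemma memLp_phase_mul {Ω : Set (Rd d × Rd d)} {g : Rd d × Rd d → ℝ}
    (hg : ∀ K : Set (Rd d), IsCompact K → MemLp g 2 (((expMeasure Φ₁).restrict K).prod (expMeasure Φ₂)))
    {θ : Rd d × Rd d → ℝ} (hθ : θ ∈ testFunctions Ω) {p : ℝ≥0∞} (hp : p ≤ 2) :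
    MemLp (fun z => g z * θ z) p (phaseMeasure Φ₁ Φ₂) := by
  have := h₁.isPotential.sigmaFinite
  have := h₂.finite
  -- Only the position variable has to be localised: over this compact projection `μ_{Φ₁}` is
  -- finite, and `μ_{Φ₂}` is finite everywhere.
  set K := Prod.fst '' tsupport θ with hKdef
  have hK : IsCompact K := hθ.2.1.image continuous_fst
  have : IsFiniteMeasure ((expMeasure Φ₁).restrict K) :=
    ⟨by simpa using h₁.isPotential.expMeasure_lt_top_of_isCompact hK⟩
  obtain ⟨M, hM⟩ := testFunction_bounded' hθ
  have h3 := (memLp_bdd_mul (hg K hK) hθ.1.continuous.aestronglyMeasurable hM).mono_exponent hp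
  have e : ((expMeasure Φ₁).restrict K).prod (expMeasure Φ₂) =
      (phaseMeasure Φ₁ Φ₂).restrict (K ×ˢ Set.univ) := by
    rw [phaseMeasure_eq_prod h₁.isPotential h₂.isPotential, ← Measure.prod_restrict,
      Measure.restrict_univ]
  rw [e, ← memLp_indicator_iff_restrict (hK.measurableSet.prod MeasurableSet.univ)] at h3
  refine (memLp_congr_ae (Eventually.of_forall fun z => ?_)).1 h3
  by_cases hz : z ∈ K ×ˢ (Set.univ : Set (Rd d))
  · rw [Set.indicator_of_mem hz]
  · rw [Set.indicator_of_notMem hz, image_eq_zero_of_notMem_tsupport (f := θ), mul_zero]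
    exact fun hz' => hz ⟨⟨z, hz', rfl⟩, trivial⟩

omit h₁ in
lemma memLp_fst_of_locL2 {g : Rd d → ℝ} {K : Set (Rd d)} (hg : MemLp g 2 ((expMeasure Φ₁).restrict K)) :
    MemLp (fun z : Rd d × Rd d => g z.1) 2 (((expMeasure Φ₁).restrict K).prod (expMeasure Φ₂)) := by
  have := h₂.finite
  exact hg.comp_fst _

lemma memLp_snd_of_locL2 {g : Rd d → ℝ} (hg : MemLp g 2 (expMeasure Φ₂)) {K : Set (Rd d)} (hK : IsCompact K) :
    MemLp (fun z : Rd d × Rd d => g z.2) 2 (((expMeasure Φ₁).restrict K).prod (expMeasure Φ₂)) := by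
  have := h₂.finite
  have : IsFiniteMeasure ((expMeasure Φ₁).restrict K) :=
    ⟨by simpa using h₁.isPotential.expMeasure_lt_top_of_isCompact hK⟩
  exact hg.comp_snd _

lemma memLp_G₁_mul {Ω : Set (Rd d × Rd d)} {θ : Rd d × Rd d → ℝ} (hθ : θ ∈ testFunctions Ω)
    (i : Fin d) {p : ℝ≥0∞} (hp : p ≤ 2) : MemLp (fun z => G₁ z.1 i * θ z) p (phaseMeasure Φ₁ Φ₂) :=
  memLp_phase_mul h₁ h₂ (fun K hK => memLp_fst_of_locL2 h₂
    (MemLp.coord (h₁.memLpLoc K hK (Set.subset_univ K)) i)) hθ hp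

lemma memLp_G₂_mul {Ω : Set (Rd d × Rd d)} {θ : Rd d × Rd d → ℝ} (hθ : θ ∈ testFunctions Ω)
    (i : Fin d) {p : ℝ≥0∞} (hp : p ≤ 2) : MemLp (fun z => G₂ z.2 i * θ z) p (phaseMeasure Φ₁ Φ₂) :=
  memLp_phase_mul h₁ h₂ (fun _ hK => memLp_snd_of_locL2 h₁ h₂
    (MemLp.coord h₂.gradient_memLp i) hK) hθ hp

lemma memLp_phase_testFunction {Ω : Set (Rd d × Rd d)} {θ : Rd d × Rd d → ℝ} (hθ : θ ∈ testFunctions Ω)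
    {p : ℝ≥0∞} (hp : p ≤ 2) : MemLp θ p (phaseMeasure Φ₁ Φ₂) := by
  have h3 := memLp_phase_mul h₁ h₂ (g := fun _ => 1) (fun K hK => by
    have := h₂.finite
    exact memLp_snd_of_locL2 h₁ h₂ (g := fun _ => 1) (memLp_const 1) hK) hθ hp
  simpa using h3

lemma memLp_langevinOperator {Ω : Set (Rd d × Rd d)} (f : testFunctions Ω) {p : ℝ≥0∞} (hp : p ≤ 2) :
    MemLp (langevinOperator G₁ G₂ Ω f) p (phaseMeasure Φ₁ Φ₂) := by
  rw [show langevinOperator G₁ G₂ Ω f = fun z => _ from funext fun z => langevinOperator_apply G₁ G₂ f z]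
  refine memLp_finsetSum _ fun i _ => ?_
  have hv := dd_mem_testFunctions f.2 (ev i)
  exact (((memLp_phase_testFunction h₁ h₂ (dd_mem_testFunctions hv (ev i)) hp).sub
    (memLp_G₂_mul h₁ h₂ hv i hp)).add (memLp_G₂_mul h₁ h₂ (dd_mem_testFunctions f.2 (ex i)) i hp)).sub
    (memLp_G₁_mul h₁ h₂ hv i hp)

lemma integral_dd_ev {θ : Rd d × Rd d → ℝ} (hθ : θ ∈ testFunctions (finiteSet₂ Φ₁ Φ₂)) (i : Fin d) :
    ∫ z, dd (ev i) θ z ∂(phaseMeasure Φ₁ Φ₂) = ∫ z, G₂ z.2 i * θ z ∂(phaseMeasure Φ₁ Φ₂) := by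
  have := h₁.isPotential.sigmaFinite
  have := h₂.finite
  have i1 := memLp_one_iff_integrable.1 (memLp_phase_testFunction h₁ h₂ (dd_mem_testFunctions hθ (ev i))
    (p := 1) one_le_two)
  have i2 := memLp_one_iff_integrable.1 (memLp_G₂_mul h₁ h₂ hθ i (p := 1) one_le_two)
  rw [phaseMeasure_eq_prod h₁.isPotential h₂.isPotential] at i1 i2 ⊢
  rw [integral_prod _ i1, integral_prod _ i2]
  refine integral_congr_ae (Eventually.of_forall fun x => ?_)
  have h3 := h₂.integral_pd (slice_right_mem_testFunctions hθ x) i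
  simp only [pd_slice_right hθ.1] at h3
  exact h3

lemma integral_dd_ex {θ : Rd d × Rd d → ℝ} (hθ : θ ∈ testFunctions (finiteSet₂ Φ₁ Φ₂)) (i : Fin d) :
    ∫ z, dd (ex i) θ z ∂(phaseMeasure Φ₁ Φ₂) = ∫ z, G₁ z.1 i * θ z ∂(phaseMeasure Φ₁ Φ₂) := by
  have := h₁.isPotential.sigmaFinite
  have := h₂.finite
  have i1 := memLp_one_iff_integrable.1 (memLp_phase_testFunction h₁ h₂ (dd_mem_testFunctions hθ (ex i))
    (p := 1) one_le_two)
  have i2 := memLp_one_iff_integrable.1 (memLp_G₁_mul h₁ h₂ hθ i (p := 1) one_le_two)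
  rw [phaseMeasure_eq_prod h₁.isPotential h₂.isPotential] at i1 i2 ⊢
  rw [integral_prod_symm _ i1, integral_prod_symm _ i2]
  refine integral_congr_ae (Eventually.of_forall fun v => ?_)
  have h3 := h₁.isPotential.integral_pd h₁.isOpen h₁.weakGradient i (slice_left_mem_testFunctions hθ v)
  simp only [pd_slice_left hθ.1] at h3
  exact h3

/-- The measure `μ_𝚽` is invariant. -/
lemma integral_langevinOperator (f : testFunctions (finiteSet₂ Φ₁ Φ₂)) :
    ∫ z, langevinOperator G₁ G₂ (finiteSet₂ Φ₁ Φ₂) f z ∂(phaseMeasure Φ₁ Φ₂) = 0 := by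
  simp only [langevinOperator_apply]
  have hv := fun i => dd_mem_testFunctions f.2 (ev i)
  have i1 := fun i => memLp_one_iff_integrable.1 (memLp_phase_testFunction h₁ h₂
    (dd_mem_testFunctions (hv i) (ev i)) (p := 1) one_le_two)
  have i2 := fun i => memLp_one_iff_integrable.1 (memLp_G₂_mul h₁ h₂ (hv i) i (p := 1) one_le_two)
  have i3 := fun i => memLp_one_iff_integrable.1 (memLp_G₂_mul h₁ h₂
    (dd_mem_testFunctions f.2 (ex i)) i (p := 1) one_le_two)
  have i4 := fun i => memLp_one_iff_integrable.1 (memLp_G₁_mul h₁ h₂ (hv i) i (p := 1) one_le_two)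
  have i5 : ∀ i, Integrable (fun z => dd (ev i) (dd (ev i) (f : Rd d × Rd d → ℝ)) z -
      G₂ z.2 i * dd (ev i) (f : Rd d × Rd d → ℝ) z) (phaseMeasure Φ₁ Φ₂) := fun i => (i1 i).sub (i2 i)
  have i6 : ∀ i, Integrable (fun z => dd (ev i) (dd (ev i) (f : Rd d × Rd d → ℝ)) z -
      G₂ z.2 i * dd (ev i) (f : Rd d × Rd d → ℝ) z + G₂ z.2 i * dd (ex i) (f : Rd d × Rd d → ℝ) z)
      (phaseMeasure Φ₁ Φ₂) := fun i => (i5 i).add (i3 i)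
  rw [integral_finsetSum _ fun i _ => show Integrable (fun z => _ - _) _ from (i6 i).sub (i4 i)]
  refine Finset.sum_eq_zero fun i _ => ?_
  -- The first two terms cancel by integration by parts in `v`. Each of the two transport terms
  -- integrates to a mixed second derivative, and these agree by symmetry.
  rw [integral_sub (i6 i) (i4 i), integral_add (i5 i) (i3 i), integral_sub (i1 i) (i2 i), integral_dd_ev h₁ h₂ (hv i) i,
    ← integral_dd_ev h₁ h₂ (dd_mem_testFunctions f.2 (ex i)) i, ← integral_dd_ex h₁ h₂ (hv i) i,
    dd_comm f.2.1]
  ring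

end PhaseSpace

/-! ### The dual of `L¹` for a σ-finite measure -/

section L1Duality

variable {X : Type*} [MeasurableSpace X] {μ : Measure X}

/-- The square root of a strictly positive integrable function; it exists by σ-finiteness. -/
lemma exists_pos_memLp_two (μ : Measure X) [SigmaFinite μ] :
    ∃ w : X → ℝ, Measurable w ∧ (∀ x, 0 < w x) ∧ MemLp w 2 μ := by
  obtain ⟨g, hg, hgm, hgi⟩ := exists_pos_lintegral_lt_of_sigmaFinite μ (ε := 1) one_ne_zero
  refine ⟨fun x => √(g x), hgm.coe_nnreal_real.sqrt, fun x => Real.sqrt_pos.2 (hg x), ?_⟩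
  rw [memLp_two_iff_integrable_sq hgm.coe_nnreal_real.sqrt.aestronglyMeasurable]
  simp only [Real.sq_sqrt (NNReal.coe_nonneg _)]
  refine ⟨hgm.coe_nnreal_real.aestronglyMeasurable, ?_⟩
  refine lt_of_le_of_lt (le_of_eq (lintegral_congr fun x => ?_)) (hgi.trans ENNReal.one_lt_top)
  simp [enorm_eq_nnnorm]

/-- Continuous linear functionals on `L¹` are given by bounded functions. -/
lemma exists_bounded_of_dual [SigmaFinite μ] (ℓ : Lp ℝ 1 μ →L[ℝ] ℝ) :
    ∃ h : X → ℝ, Measurable h ∧ (∀ x, |h x| ≤ ‖ℓ‖) ∧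
      ∀ (f : X → ℝ) (hf : MemLp f 1 μ), ℓ (hf.toLp f) = ∫ x, h x * f x ∂μ := by
  obtain ⟨w, hwm, hw0, hw⟩ := exists_pos_memLp_two μ
  -- Multiplication by `w` maps `L²` to `L¹`, so the functional pulls back to `L²`, where Riesz
  -- represents it by some `k`. The function sought is `k / w`.
  set T := (ContinuousLinearMap.mul ℝ ℝ).holderL μ 2 2 1 (hw.toLp w)
  have hT : ∀ (f : X → ℝ) (hf : MemLp f 2 μ) (hwf : MemLp (fun x => w x * f x) 1 μ),
      T (hf.toLp f) = hwf.toLp _ := by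
    intro f hf hwf
    refine Lp.ext ?_
    filter_upwards [(ContinuousLinearMap.mul ℝ ℝ).coeFn_holder (r := 1) (hw.toLp w) (hf.toLp f),
      hw.coeFn_toLp, hf.coeFn_toLp, hwf.coeFn_toLp] with x h1 h2 h3 h4
    rw [h4, ← h2, ← h3]
    exact h1
  set κ := (InnerProductSpace.toDual ℝ (Lp ℝ 2 μ)).symm (ℓ.comp T)
  have hκ : ∀ f : Lp ℝ 2 μ, inner ℝ κ f = ℓ (T f) := fun f => InnerProductSpace.toDual_symm_apply
  obtain ⟨k, hkm, hkκ⟩ := (Lp.aestronglyMeasurable κ)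
  have hk2 : MemLp k 2 μ := (Lp.memLp κ).ae_eq hkκ
  have hkκ' : κ = hk2.toLp k := Lp.ext (hkκ.trans hk2.coeFn_toLp.symm)
  have hrep : ∀ (f : X → ℝ), MemLp f 2 μ → ∀ hwf : MemLp (fun x => w x * f x) 1 μ,
      ℓ (hwf.toLp _) = ∫ x, k x * f x ∂μ := by
    intro f hf hwf
    rw [← hT f hf hwf, ← hκ, hkκ', inner_toLp]
  have hw1 : MemLp (fun x => w x * w x) 1 μ := memLp_one_iff_integrable.2 (integrable_mul_of_memLp_two hw hw)
  -- Testing against `w` restricted to a set `S` compares integrals over `S`; the signs `s = ±1`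
  -- give both halves of `|k| ≤ ‖ℓ‖ w`.
  have hint : ∀ s : ℝ, |s| = 1 → (fun x => s * (k x * w x)) ≤ᵐ[μ] fun x => ‖ℓ‖ * (w x * w x) := by
    intro s hs
    refine ae_le_of_forall_setIntegral_le ((integrable_mul_of_memLp_two hk2 hw).const_mul s)
      ((integrable_mul_of_memLp_two hw hw).const_mul _) fun S hS _ => ?_
    have hSw : MemLp (S.indicator w) 2 μ := hw.indicator hS
    have hwS : MemLp (fun x => w x * S.indicator w x) 1 μ :=
      memLp_one_iff_integrable.2 (integrable_mul_of_memLp_two hw hSw)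
    have e1 : ∫ x in S, k x * w x ∂μ = ∫ x, k x * S.indicator w x ∂μ := by
      rw [← integral_indicator hS]
      refine integral_congr_ae (Eventually.of_forall fun x => ?_)
      by_cases hx : x ∈ S <;> simp [hx]
    have e2 : ∫ x in S, w x * w x ∂μ = ‖hwS.toLp _‖ := by
      rw [L1.norm_eq_integral_norm, ← integral_indicator hS]
      refine integral_congr_ae ?_
      filter_upwards [hwS.coeFn_toLp] with x hx
      rw [hx]
      by_cases hxS : x ∈ S
      · simp only [hxS, Set.indicator_of_mem, Real.norm_of_nonneg (mul_pos (hw0 x) (hw0 x)).le]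
      · simp [hxS]
    rw [integral_const_mul, integral_const_mul, e1, e2, ← hrep _ hSw hwS]
    refine (le_abs_self _).trans ?_
    rw [abs_mul, hs, one_mul]
    exact ℓ.le_opNorm _
  -- Truncation changes `k / w` only on a null set and gives the bound at every point.
  set h : X → ℝ := fun x => max (-‖ℓ‖) (min ‖ℓ‖ (k x / w x)) with hdef
  have hhm : Measurable h :=
    measurable_const.max (measurable_const.min (hkm.measurable.div hwm))
  have hhb : ∀ x, |h x| ≤ ‖ℓ‖ := fun x => abs_le.2 ⟨le_max_left _ _,
    max_le (by have := norm_nonneg ℓ; linarith) (min_le_left _ _)⟩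
  have hhk : ∀ᵐ x ∂μ, h x = k x / w x := by
    filter_upwards [hint 1 (by simp), hint (-1) (by simp)] with x h1 h2
    have hwx := hw0 x
    have h3 : k x / w x ≤ ‖ℓ‖ := by
      rw [div_le_iff₀ hwx]
      refine le_of_mul_le_mul_right ?_ hwx
      linarith
    have h4 : -‖ℓ‖ ≤ k x / w x := by
      rw [le_div_iff₀ hwx]
      refine le_of_mul_le_mul_right ?_ hwx
      linarith
    rw [hdef]
    simp only
    rw [min_eq_right h3, max_eq_right h4]
  refine ⟨h, hhm, hhb, fun f hf => ?_⟩
  have hfi := memLp_one_iff_integrable.1 hf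
  obtain ⟨f', hf'm, hff'⟩ := hf.1
  have hf' : MemLp f' 1 μ := hf.ae_eq hff'
  have hf'i := memLp_one_iff_integrable.1 hf'
  rw [MemLp.toLp_congr hf hf' hff', integral_congr_ae (g := fun x => h x * f' x)
    (hff'.mono fun x hx => by simp only [hx])]
  -- On these sets `f' / w` is dominated by `n w`, hence in `L²`, so the representation holds for
  -- the restriction of `f'`; the sets exhaust the space.
  set S : ℕ → Set X := fun n => {x | |f' x| ≤ n * (w x * w x)}
  have hS : ∀ n, MeasurableSet (S n) := fun n =>
    measurableSet_le hf'm.measurable.abs ((hwm.mul hwm).const_mul _)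
  have hbi : ∀ {g : X → ℝ}, Integrable g μ → Integrable (fun x => h x * g x) μ := fun hg =>
    hg.bdd_mul hhm.aestronglyMeasurable (Eventually.of_forall hhb)
  have key : ∀ n, |ℓ (hf'.toLp f') - ∫ x, h x * f' x ∂μ| ≤
      2 * ‖ℓ‖ * ∫ x, ‖f' x - (S n).indicator f' x‖ ∂μ := by
    intro n
    have hn1 : MemLp ((S n).indicator f') 1 μ := hf'.indicator (hS n)
    have hn1i := memLp_one_iff_integrable.1 hn1
    have hn2 : MemLp (fun x => (S n).indicator f' x / w x) 2 μ := by
      refine hw.of_le_mul (c := n) (hn1.1.aemeasurable.div hwm.aemeasurable).aestronglyMeasurable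
        (Eventually.of_forall fun x => ?_)
      rw [norm_div, Real.norm_of_nonneg (hw0 x).le, div_le_iff₀ (hw0 x)]
      by_cases hx : x ∈ S n
      · rw [Set.indicator_of_mem hx, mul_assoc]; exact hx
      · rw [Set.indicator_of_notMem hx]
        have := hw0 x
        simp only [norm_zero]
        positivity
    have e0 : (fun x => w x * ((S n).indicator f' x / w x)) = (S n).indicator f' := funext fun x =>
by
      have := (hw0 x).ne'
      field_simp
    have e1 := hrep _ hn2 (e0.symm ▸ hn1)
    have e2 : ℓ (hn1.toLp _) = ∫ x, h x * (S n).indicator f' x ∂μ := by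
      have e3 : hn1.toLp _ = (e0.symm ▸ hn1 : MemLp (fun x => w x * ((S n).indicator f' x / w x)) 1 μ).toLp _ :=
        MemLp.toLp_congr _ _ (by rw [e0])
      rw [e3, e1]
      refine integral_congr_ae (hhk.mono fun x hx => ?_)
      simp only [hx]
      ring
    have idiff : Integrable (fun x => f' x - (S n).indicator f' x) μ := hf'i.sub hn1i
    have e3 : ℓ (hf'.toLp f') = ℓ (hn1.toLp _) + ℓ ((hf'.sub hn1).toLp _) := by
      rw [← map_add, ← MemLp.toLp_add]
      congr 1
      exact MemLp.toLp_congr _ _ (by rw [add_sub_cancel])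
    have e4 : ∫ x, h x * f' x ∂μ = ∫ x, h x * (S n).indicator f' x ∂μ +
        ∫ x, h x * (f' x - (S n).indicator f' x) ∂μ := by
      rw [← integral_add (hbi hn1i) (hbi idiff)]
      exact integral_congr_ae (Eventually.of_forall fun x => by ring)
    have b1 : |ℓ ((hf'.sub hn1).toLp _)| ≤ ‖ℓ‖ * ∫ x, ‖f' x - (S n).indicator f' x‖ ∂μ := by
      refine (ℓ.le_opNorm _).trans (le_of_eq ?_)
      rw [L1.norm_eq_integral_norm]
      congr 1
      exact integral_congr_ae ((hf'.sub hn1).coeFn_toLp.mono fun x hx => by simp only [hx, Pi.sub_apply])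
    have b2 : |∫ x, h x * (f' x - (S n).indicator f' x) ∂μ| ≤
        ‖ℓ‖ * ∫ x, ‖f' x - (S n).indicator f' x‖ ∂μ := by
      rw [← integral_const_mul, ← Real.norm_eq_abs]
      refine norm_integral_le_of_norm_le (idiff.norm.const_mul _)
        (Eventually.of_forall fun x => ?_)
      rw [norm_mul]
      exact mul_le_mul_of_nonneg_right (hhb x) (norm_nonneg _)
    rw [e3, e4, e2, add_sub_add_left_eq_sub]
    refine (abs_sub _ _).trans ?_
    linarith
  have hlim : Tendsto (fun n => ∫ x, ‖f' x - (S n).indicator f' x‖ ∂μ) atTop (𝓝 (∫ _, (0 : ℝ) ∂μ)) := by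
    refine tendsto_integral_of_dominated_convergence (fun x => ‖f' x‖)
      (fun n => (hf'i.sub (hf'i.indicator (hS n))).norm.aestronglyMeasurable) hf'i.norm
      (fun n => Eventually.of_forall fun x => ?_) (Eventually.of_forall fun x => ?_)
    · by_cases hx : x ∈ S n <;> simp [hx]
    · have hww : 0 < w x * w x := mul_pos (hw0 x) (hw0 x)
      obtain ⟨N, hN⟩ := exists_nat_ge (|f' x| / (w x * w x))
      refine tendsto_const_nhds.congr' ?_
      filter_upwards [eventually_ge_atTop N] with n hn
      have hx : x ∈ S n := by
        change |f' x| ≤ n * (w x * w x)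
        rw [← div_le_iff₀ hww]
        exact hN.trans (by exact_mod_cast hn)
      simp [hx]
  rw [integral_zero] at hlim
  have h0 : |ℓ (hf'.toLp f') - ∫ x, h x * f' x ∂μ| ≤ 2 * ‖ℓ‖ * 0 :=
    ge_of_tendsto' (hlim.const_mul _) key
  rw [mul_zero] at h0
  exact sub_eq_zero.1 (abs_eq_zero.1 (le_antisymm h0 (abs_nonneg _)))

end L1Duality

/-! ### Excess over a level and sub-Markovian graphs in `L¹` -/

section PositivePart

variable {X : Type*} [MeasurableSpace X] {μ : Measure X}

lemma lipschitzWith_sub_posPart (c : ℝ) : LipschitzWith 1 fun s : ℝ => max (s - c) 0 :=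
  (LipschitzWith.of_dist_le_mul (K := 1) fun s t : ℝ => by
    rw [dist_sub_right, NNReal.coe_one, one_mul]).max_const 0

lemma sub_posPart_zero (c : ℝ≥0) : max ((0 : ℝ) - c) 0 = 0 := by simp

/-- The function `(u - c)⁺` for `u ∈ L¹` and `c ≥ 0`. -/
def excess (c : ℝ≥0) (u : Lp ℝ 1 μ) : Lp ℝ 1 μ :=
  (lipschitzWith_sub_posPart c).compLp (sub_posPart_zero c) u

lemma continuous_excess (c : ℝ≥0) : Continuous (excess c : Lp ℝ 1 μ → Lp ℝ 1 μ) :=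
  (lipschitzWith_sub_posPart c).continuous_compLp (sub_posPart_zero c)

lemma coeFn_excess (c : ℝ≥0) (u : Lp ℝ 1 μ) : excess c u =ᵐ[μ] fun x => max (u x - c) 0 :=
  (lipschitzWith_sub_posPart c).coeFn_compLp (sub_posPart_zero c) u

lemma norm_excess (c : ℝ≥0) (u : Lp ℝ 1 μ) : ‖excess c u‖ = ∫ x, max (u x - c) 0 ∂μ := by
  rw [L1.norm_eq_integral_norm]
  refine integral_congr_ae ((coeFn_excess c u).mono fun x hx => ?_)
  simp only [hx, Real.norm_of_nonneg (le_max_right _ _)]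

lemma integrable_sub_posPart (c : ℝ≥0) (u : Lp ℝ 1 μ) : Integrable (fun x => max (u x - c) 0) μ :=
  (L1.integrable_coeFn (excess c u)).congr (coeFn_excess c u)

lemma norm_excess_eq_zero_iff (c : ℝ≥0) (u : Lp ℝ 1 μ) : ‖excess c u‖ = 0 ↔ ∀ᵐ x ∂μ, u x ≤ c := by
  rw [norm_eq_zero, Lp.eq_zero_iff_ae_eq_zero]
  constructor
  · intro h
    filter_upwards [h, coeFn_excess c u] with x h1 h2
    rw [h2, Pi.zero_apply] at h1
    have := le_max_left (u x - c) 0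
    linarith
  · intro h
    filter_upwards [h, coeFn_excess c u] with x h1 h2
    rw [h2, Pi.zero_apply, max_eq_right]
    linarith

lemma norm_eq_norm_excess_add (u : Lp ℝ 1 μ) : ‖u‖ = ‖excess 0 u‖ + ‖excess 0 (-u)‖ := by
  rw [L1.norm_eq_integral_norm, norm_excess, norm_excess,
    ← integral_add (integrable_sub_posPart 0 u) (integrable_sub_posPart 0 (-u))]
  refine integral_congr_ae ((Lp.coeFn_neg u).mono fun x hx => ?_)
  simp only [hx, Pi.neg_apply, NNReal.coe_zero, sub_zero, Real.norm_eq_abs]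
  rcases le_total 0 (u x) with h | h
  · rw [abs_of_nonneg h, max_eq_left h, max_eq_right (by linarith), add_zero]
  · rw [abs_of_nonpos h, max_eq_right h, max_eq_left (by linarith), zero_add]

/-- Resolvent positivity and contractivity of an operator on `L¹`, expressed on its graph. -/
def IsSubMarkovianGraph (Γ : Set (Lp ℝ 1 μ × Lp ℝ 1 μ)) : Prop :=
  ∀ c : ℝ≥0, ∀ l : ℝ≥0, 0 < l → ∀ p ∈ Γ,
    (l : ℝ) * ‖excess c p.1‖ ≤ ‖excess (l * c) ((l : ℝ) • p.1 - p.2)‖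

/-- Both sides depend continuously on the pair, because `u ↦ (u - c)⁺` is Lipschitz on `L¹`. -/
lemma IsSubMarkovianGraph.closure {Γ : Set (Lp ℝ 1 μ × Lp ℝ 1 μ)} (h : IsSubMarkovianGraph Γ) :
    IsSubMarkovianGraph (closure Γ) := by
  intro c l hl
  refine fun p hp => (isClosed_le (f := fun p : Lp ℝ 1 μ × Lp ℝ 1 μ => (l : ℝ) * ‖excess c p.1‖)
    (g := fun p => ‖excess (l * c) ((l : ℝ) • p.1 - p.2)‖) ?_ ?_).closure_subset_iff.2 (h c l hl) hp
  · exact continuous_const.mul ((continuous_excess c).comp continuous_fst).norm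
  · have hc' : Continuous fun p : Lp ℝ 1 μ × Lp ℝ 1 μ => (l : ℝ) • p.1 - p.2 := by fun_prop
    exact ((continuous_excess _).comp hc').norm

/-- Add the level-zero inequalities for `u` and `-u`: the `L¹` norm is the sum of the norms of the
positive and negative parts. -/
lemma IsSubMarkovianGraph.isDissipative {A : Lp ℝ 1 μ →ₗ.[ℝ] Lp ℝ 1 μ}
    (h : IsSubMarkovianGraph (A.graph : Set (Lp ℝ 1 μ × Lp ℝ 1 μ))) : IsDissipative A := by
  intro c hc p hp
  lift c to ℝ≥0 using hc.le
  have h1 := h 0 c hc p hp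
  have h2 := h 0 c hc (-p) (A.graph.neg_mem hp)
  have e : (c : ℝ) • (-p).1 - (-p).2 = -((c : ℝ) • p.1 - p.2) := by
    rw [Prod.fst_neg, Prod.snd_neg, smul_neg]; abel
  simp only [mul_zero] at h1 h2
  rw [e, Prod.fst_neg] at h2
  rw [norm_eq_norm_excess_add p.1, norm_eq_norm_excess_add ((c : ℝ) • p.1 - p.2), mul_add]
  exact add_le_add h1 h2

/-- The set of all `u ∈ L¹` with `0 ≤ u ≤ 1`. -/
def unitInterval (μ : Measure X) : Set (Lp ℝ 1 μ) := {u | ∀ᵐ x ∂μ, 0 ≤ u x ∧ u x ≤ 1}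

lemma mem_unitInterval_iff {u : Lp ℝ 1 μ} :
    u ∈ unitInterval μ ↔ ‖excess 0 (-u)‖ = 0 ∧ ‖excess 1 u‖ = 0 := by
  rw [norm_excess_eq_zero_iff, norm_excess_eq_zero_iff, unitInterval, Set.mem_ofPred_eq,
    eventually_and]
  refine and_congr ⟨fun h => ?_, fun h => ?_⟩ Iff.rfl
  · filter_upwards [h, Lp.coeFn_neg u] with x h1 h2
    rw [h2]; simpa using h1
  · filter_upwards [h, Lp.coeFn_neg u] with x h1 h2
    rw [h2] at h1; simpa using h1

lemma isClosed_unitInterval : IsClosed (unitInterval μ) := by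
  have : unitInterval μ = {u | ‖excess 0 (-u)‖ = 0} ∩ {u | ‖excess 1 u‖ = 0} :=
    Set.ext fun u => mem_unitInterval_iff
  rw [this]
  exact (isClosed_eq ((continuous_excess 0).comp continuous_neg).norm continuous_const).inter
    (isClosed_eq (continuous_excess 1).norm continuous_const)

lemma convex_unitInterval : Convex ℝ (unitInterval μ) := by
  intro u hu w hw a b ha hb hab
  filter_upwards [hu, hw, Lp.coeFn_add (a • u) (b • w), Lp.coeFn_smul a u, Lp.coeFn_smul b w]
    with x h1 h2 h3 h4 h5
  rw [h3, Pi.add_apply, h4, h5, Pi.smul_apply, Pi.smul_apply, smul_eq_mul, smul_eq_mul]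
  constructor
  · nlinarith [mul_nonneg ha h1.1, mul_nonneg hb h2.1]
  · nlinarith [mul_le_mul_of_nonneg_left h1.2 ha, mul_le_mul_of_nonneg_left h2.2 hb]

/-- Level `1` for `u` gives the upper bound, level `0` for `-u` the lower one: in each case the
excess of the datum vanishes. -/
lemma IsSubMarkovianGraph.mem_unitInterval {A : Lp ℝ 1 μ →ₗ.[ℝ] Lp ℝ 1 μ}
    (h : IsSubMarkovianGraph (A.graph : Set (Lp ℝ 1 μ × Lp ℝ 1 μ))) {c : ℝ} (hc : 0 < c) {p : Lp ℝ 1 μ × Lp ℝ 1 μ}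
    (hp : p ∈ A.graph) (hpc : c⁻¹ • (c • p.1 - p.2) ∈ unitInterval μ) : p.1 ∈ unitInterval μ := by
  lift c to ℝ≥0 using hc.le
  have h1 := h 1 c hc p hp
  have h2 := h 0 c hc (-p) (A.graph.neg_mem hp)
  have e : (c : ℝ) • (-p).1 - (-p).2 = -((c : ℝ) • p.1 - p.2) := by
    rw [Prod.fst_neg, Prod.snd_neg, smul_neg]; abel
  simp only [mul_zero, mul_one] at h1 h2
  rw [e, Prod.fst_neg] at h2
  set g := (c : ℝ) • p.1 - p.2
  have e1 : ‖excess c g‖ = 0 := by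
    rw [norm_excess_eq_zero_iff]
    filter_upwards [hpc, Lp.coeFn_smul (c : ℝ)⁻¹ g] with x hx1 hx2
    rw [hx2, Pi.smul_apply, smul_eq_mul] at hx1
    have := mul_le_mul_of_nonneg_left hx1.2 hc.le
    rwa [mul_inv_cancel_left₀ hc.ne', mul_one] at this
  have e2 : ‖excess 0 (-g)‖ = 0 := by
    rw [norm_excess_eq_zero_iff]
    filter_upwards [hpc, Lp.coeFn_smul (c : ℝ)⁻¹ g, Lp.coeFn_neg g] with x hx1 hx2 hx3
    rw [hx2, Pi.smul_apply, smul_eq_mul] at hx1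
    have := mul_le_mul_of_nonneg_left hx1.1 hc.le
    rw [mul_inv_cancel_left₀ hc.ne', mul_zero] at this
    rw [hx3]
    simpa using this
  rw [e1] at h1
  rw [e2] at h2
  rw [mem_unitInterval_iff]
  have hz : ∀ {t : ℝ}, 0 ≤ t → c * t ≤ 0 → t = 0 := fun ht h => by nlinarith
  exact ⟨hz (norm_nonneg _) h2, hz (norm_nonneg _) h1⟩

end PositivePart

/-! ### Closability and range of the closure of a dissipative operator -/

section Closability

variable {B : Type*} [NormedAddCommGroup B] [NormedSpace ℝ B]

/-- Densely defined dissipative operators are closable. -/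
lemma IsDissipative.isClosable {A : B →ₗ.[ℝ] B} (hA : IsDissipative A)
    (hdense : Dense (A.domain : Set B)) : A.IsClosable := by
  have key : ∀ w : B, ((0 : B), w) ∈ A.graph.topologicalClosure → w = 0 := by
    intro w hw
    have hw' : ((0 : B), w) ∈ closure (A.graph : Set (B × B)) := hw
    -- Perturb `p` by `c r`, where `r` in the graph tends to `(0, w)`. The first component is
    -- unchanged in the limit while the second gains `c w`.
    have h1 : ∀ p ∈ A.graph, ∀ c : ℝ, 0 < c → c * ‖p.1‖ ≤ ‖c • p.1 - p.2 - c • w‖ := by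
      intro p hp c hc
      have h2 : ∀ r ∈ (A.graph : Set (B × B)),
          c * ‖p.1 + c • r.1‖ ≤ ‖c • (p.1 + c • r.1) - (p.2 + c • r.2)‖ := fun r hr =>
        hA c hc (p + c • r) (A.graph.add_mem hp (A.graph.smul_mem c hr))
      have h3 := (isClosed_le (f := fun r : B × B => c * ‖p.1 + c • r.1‖)
        (g := fun r : B × B => ‖c • (p.1 + c • r.1) - (p.2 + c • r.2)‖)
        (by fun_prop) (by fun_prop)).closure_subset_iff.2 h2 hw'
      simp only [Set.mem_ofPred_eq, smul_zero, add_zero] at h3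
      rwa [← sub_sub] at h3
    -- Divide by `c` and let `c → ∞`; by density the inequality extends to every vector, in
    -- particular to `w` itself.
    have h2 : ∀ p ∈ A.graph, ‖p.1‖ ≤ ‖p.1 - w‖ := by
      intro p hp
      have h3 : Tendsto (fun c : ℝ => ‖p.1 - w‖ + c⁻¹ * ‖p.2‖) atTop (𝓝 (‖p.1 - w‖ + 0 * ‖p.2‖)) :=
        tendsto_const_nhds.add (tendsto_inv_atTop_zero.mul_const _)
      rw [zero_mul, add_zero] at h3
      refine ge_of_tendsto h3 ?_
      filter_upwards [eventually_gt_atTop 0] with c hc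
      have h4 := h1 p hp c hc
      have h5 : ‖c • p.1 - p.2 - c • w‖ ≤ c * ‖p.1 - w‖ + ‖p.2‖ := by
        have e : c • p.1 - p.2 - c • w = c • (p.1 - w) - p.2 := by rw [smul_sub]; abel
        rw [e]
        refine (norm_sub_le _ _).trans ?_
        rw [norm_smul, Real.norm_of_nonneg hc.le]
      have h6 : c * ‖p.1‖ ≤ c * (‖p.1 - w‖ + c⁻¹ * ‖p.2‖) := by
        rw [mul_add, mul_inv_cancel_left₀ hc.ne']
        exact h4.trans h5
      exact le_of_mul_le_mul_left h6 hc
    have h3 : ∀ x : B, ‖x‖ ≤ ‖x - w‖ := fun x =>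
      (isClosed_le (f := fun x : B => ‖x‖) (g := fun x : B => ‖x - w‖) (by fun_prop)
        (by fun_prop)).closure_subset_iff.2 (fun x hx => by
          obtain ⟨y, hy⟩ := LinearPMap.mem_domain_iff.1 hx
          exact h2 _ hy) (hdense x)
    have h4 := h3 w
    rw [sub_self, norm_zero] at h4
    exact norm_le_zero_iff.1 h4
  refine ⟨A.graph.topologicalClosure.toLinearPMap, (Submodule.toLinearPMap_graph_eq _ ?_).symm⟩
  rintro ⟨x, w⟩ hx (rfl : x = 0)
  exact key w hx

/-- The resolvent equation for the closure of a dissipative operator whose range is dense. -/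
lemma IsDissipative.exists_closure_graph [CompleteSpace B] {A : B →ₗ.[ℝ] B} (hA : IsDissipative A) {c : ℝ}
    (hc : 0 < c) (hrange : ∀ (g : B) (ε : ℝ), 0 < ε → ∃ p ∈ A.graph, ‖c • p.1 - p.2 - g‖ < ε) (g : B) :
    ∃ p ∈ A.graph.topologicalClosure, c • p.1 - p.2 = g := by
  choose p hp hpg using fun n : ℕ => hrange g (1 / ((n : ℝ) + 1)) (by positivity)
  have h0 : Tendsto (fun n => c • (p n).1 - (p n).2) atTop (𝓝 g) := by
    rw [tendsto_iff_norm_sub_tendsto_zero]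
    exact squeeze_zero (fun n => norm_nonneg _) (fun n => (hpg n).le)
      tendsto_one_div_add_atTop_nhds_zero_nat
  have h1 : CauchySeq fun n => (p n).1 := by
    have h2 := Metric.cauchySeq_iff.1 h0.cauchySeq
    refine Metric.cauchySeq_iff.2 fun ε hε => ?_
    obtain ⟨N, hN⟩ := h2 (c * ε) (by positivity)
    refine ⟨N, fun m hm n hn => ?_⟩
    have h3 := hN m hm n hn
    have h4 := hA c hc (p m - p n) (A.graph.sub_mem (hp m) (hp n))
    rw [dist_eq_norm] at h3 ⊢
    have e : c • (p m - p n).1 - (p m - p n).2 = c • (p m).1 - (p m).2 - (c • (p n).1 - (p n).2) := by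
      rw [Prod.fst_sub, Prod.snd_sub, smul_sub]; abel
    rw [e] at h4
    exact lt_of_mul_lt_mul_left (h4.trans_lt h3) hc.le
  obtain ⟨u, hu⟩ := cauchySeq_tendsto_of_complete h1
  have h5 : Tendsto (fun n => (p n).2) atTop (𝓝 (c • u - g)) := by
    refine ((hu.const_smul c).sub h0).congr fun n => ?_
    abel
  refine ⟨(u, c • u - g), mem_closure_of_tendsto (hu.prodMk_nhds h5) (Eventually.of_forall hp), ?_⟩
  simp

end Closability

/-! ### Sub-Markovian estimate for the Langevin operator -/

section SubMarkovian

variable {d : ℕ} {Φ₁ Φ₂ : Rd d → EReal} {G₁ G₂ : Rd d → Rd d} {H₂ : Fin d → Rd d → ℝ}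

lemma lpOperator_graph_of_eq {X : Type*} [NormedAddCommGroup X] [NormedSpace ℝ X] [MeasureSpace X]
    [BorelSpace X] [(volume : Measure X).IsOpenPosMeasure] {Ψ : X → EReal}
    (h : IsPotential Ψ) (p : ℝ≥0∞) [Fact (1 ≤ p)] {Ω : Set X} (hΩ : Ω = {x | Ψ x < ⊤})
    (L : testFunctions Ω →ₗ[ℝ] (X → ℝ)) :
    (lpOperator (expMeasure Ψ) p _ L).graph = operatorGraph (expMeasure Ψ) p _ L := by
  subst hΩ
  exact lpOperator_graph h p L

lemma langevinOperatorL1_graph (p₁ : IsPotential Φ₁) (p₂ : IsPotential Φ₂) :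
    (langevinOperatorL1 Φ₁ Φ₂ G₁ G₂).graph = operatorGraph (phaseMeasure Φ₁ Φ₂) 1
      (testFunctions (finiteSet₂ Φ₁ Φ₂)) (langevinOperator G₁ G₂ (finiteSet₂ Φ₁ Φ₂)) :=
  lpOperator_graph_of_eq (p₁.add p₂) 1 (finiteSet₂_eq p₁ p₂) _

/-- A smooth primitive of a smooth function. -/
lemma exists_primitive {β : ℝ → ℝ} (hβ : ContDiff ℝ ∞ β) :
    ∃ B : ℝ → ℝ, ContDiff ℝ ∞ B ∧ B 0 = 0 ∧ deriv B = β := by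
  have h1 : ∀ s, HasDerivAt (fun s => ∫ t in (0 : ℝ)..s, β t) (β s) s := fun s =>
    hβ.continuous.integral_hasStrictDerivAt 0 s |>.hasDerivAt
  have h2 : deriv (fun s => ∫ t in (0 : ℝ)..s, β t) = β := funext fun s => (h1 s).deriv
  refine ⟨_, contDiff_infty_iff_deriv.2 ⟨fun s => (h1 s).differentiableAt, ?_⟩,
    intervalIntegral.integral_same, h2⟩
  rwa [h2]

/-- A diffusion operator: only `Δ_v` is of second order, so the defect in the chain rule is `B''(f)
|∇_v f|²`. -/
lemma langevinOperator_comp {Ω : Set (Rd d × Rd d)} (f : testFunctions Ω) {B : ℝ → ℝ}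
    (hB : ContDiff ℝ ∞ B) (hB0 : B 0 = 0) (z : Rd d × Rd d) :
    langevinOperator G₁ G₂ Ω ⟨_, comp_mem_testFunctions f.2 hB hB0⟩ z =
      deriv B ((f : Rd d × Rd d → ℝ) z) * langevinOperator G₁ G₂ Ω f z +
        ∑ i, deriv (deriv B) ((f : Rd d × Rd d → ℝ) z) * dd (ev i) (f : Rd d × Rd d → ℝ) z ^ 2 := by
  have hf := f.2.1
  have hfd := hf.differentiable (by simp)
  have hB' : ContDiff ℝ ∞ (deriv B) := (contDiff_infty_iff_deriv.1 hB).2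
  have hBd := hB.differentiable (by simp)
  have e1 : ∀ e : Rd d × Rd d, dd e (fun z => B ((f : Rd d × Rd d → ℝ) z)) =
      fun z => deriv B ((f : Rd d × Rd d → ℝ) z) * dd e (f : Rd d × Rd d → ℝ) z := fun e =>
    funext fun z => dd_comp (hfd z) (hBd _) e
  have e2 : ∀ e : Rd d × Rd d, dd e (fun z => deriv B ((f : Rd d × Rd d → ℝ) z) *
      dd e (f : Rd d × Rd d → ℝ) z) z = deriv B ((f : Rd d × Rd d → ℝ) z) *
        dd e (dd e (f : Rd d × Rd d → ℝ)) z +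
      deriv (deriv B) ((f : Rd d × Rd d → ℝ) z) * dd e (f : Rd d × Rd d → ℝ) z *
        dd e (f : Rd d × Rd d → ℝ) z := by
    intro e
    rw [dd_mul (f := fun z => deriv B ((f : Rd d × Rd d → ℝ) z))
      ((hB'.comp hf).differentiable (by simp) z)
      ((dd_mem_testFunctions f.2 e).1.differentiable (by simp) z),
      dd_comp (hfd z) (hB'.differentiable (by simp) _)]
  rw [langevinOperator_apply, langevinOperator_apply, Finset.mul_sum, ← Finset.sum_add_distrib]
  refine Finset.sum_congr rfl fun i _ => ?_
  simp only [e1, e2]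
  ring

/-- A smooth cutoff approximating the indicator function of `(c, ∞)`. -/
def cutoffAbove (c : ℝ) (n : ℕ) (s : ℝ) : ℝ := Real.smoothTransition (n * (s - c) - 1)

lemma contDiff_cutoffAbove (c : ℝ) (n : ℕ) : ContDiff ℝ ∞ (cutoffAbove c n) :=
  Real.smoothTransition.contDiff.comp (by fun_prop)

lemma tendsto_cutoffAbove (c s : ℝ) :
    Tendsto (fun n => cutoffAbove c n s) atTop (𝓝 (Set.indicator (Set.Ioi c) 1 s)) := by
  by_cases hs : c < s
  · rw [Set.indicator_of_mem (show s ∈ Set.Ioi c from hs)]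
    refine tendsto_const_nhds.congr' ?_
    obtain ⟨N, hN⟩ := exists_nat_ge (2 / (s - c))
    filter_upwards [eventually_ge_atTop N] with n hn
    have hsc : 0 < s - c := sub_pos.2 hs
    have h1 : 2 ≤ n * (s - c) := by
      rw [← div_le_iff₀ hsc]
      exact hN.trans (by exact_mod_cast hn)
    rw [Pi.one_apply, cutoffAbove, Real.smoothTransition.one_of_one_le (by linarith)]
  · rw [Set.indicator_of_notMem (show s ∉ Set.Ioi c from hs)]
    refine tendsto_const_nhds.congr fun n => ?_
    rw [cutoffAbove, Real.smoothTransition.zero_of_nonpos]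
    have : (n : ℝ) * (s - c) ≤ 0 := mul_nonpos_of_nonneg_of_nonpos (Nat.cast_nonneg n) (by linarith)
    linarith

variable (h₁ : PositionPotential 2 Φ₁ G₁) (h₂ : VelocityPotential Φ₂ G₂ H₂)
include h₁ h₂

/-- With `B' = β`, the integral of `L (B ∘ f)` vanishes by invariance and `β(f) L f ≤ L (B ∘ f)`
pointwise, as `B'' ≥ 0`. Normalising `B 0 = 0` keeps the support compact. -/
lemma integral_comp_mul_langevinOperator_nonpos (f : testFunctions (finiteSet₂ Φ₁ Φ₂)) {β : ℝ → ℝ}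
    (hβ : ContDiff ℝ ∞ β) (hβm : Monotone β) {M : ℝ} (hM : ∀ s, |β s| ≤ M) :
    ∫ z, β ((f : Rd d × Rd d → ℝ) z) * langevinOperator G₁ G₂ (finiteSet₂ Φ₁ Φ₂) f z
      ∂(phaseMeasure Φ₁ Φ₂) ≤ 0 := by
  obtain ⟨B, hB, hB0, rfl⟩ := exists_primitive hβ
  set F : testFunctions (finiteSet₂ Φ₁ Φ₂) := ⟨_, comp_mem_testFunctions f.2 hB hB0⟩
  rw [← integral_langevinOperator h₁ h₂ F]
  have i1 := memLp_one_iff_integrable.1 (memLp_langevinOperator h₁ h₂ f (p := 1) one_le_two)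
  refine integral_mono (i1.bdd_mul (hβ.continuous.comp f.2.1.continuous).aestronglyMeasurable
    (Eventually.of_forall fun z => hM _))
    (memLp_one_iff_integrable.1 (memLp_langevinOperator h₁ h₂ F (p := 1) one_le_two)) fun z => ?_
  simp only [F]
  rw [langevinOperator_comp f hB hB0]
  refine le_add_of_nonneg_right (Finset.sum_nonneg fun i _ => mul_nonneg ?_ (sq_nonneg _))
  exact hβm.deriv_nonneg

lemma integral_indicator_langevinOperator_nonpos (f : testFunctions (finiteSet₂ Φ₁ Φ₂)) (c : ℝ) :
    ∫ z, Set.indicator (Set.Ioi c) 1 ((f : Rd d × Rd d → ℝ) z) *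
      langevinOperator G₁ G₂ (finiteSet₂ Φ₁ Φ₂) f z ∂(phaseMeasure Φ₁ Φ₂) ≤ 0 := by
  have i1 := memLp_one_iff_integrable.1 (memLp_langevinOperator h₁ h₂ f (p := 1) one_le_two)
  have hb : ∀ n s, |cutoffAbove c n s| ≤ 1 := fun n s => by
    rw [cutoffAbove, abs_of_nonneg (Real.smoothTransition.nonneg _)]
    exact Real.smoothTransition.le_one _
  have hlim : Tendsto (fun n => ∫ z, cutoffAbove c n ((f : Rd d × Rd d → ℝ) z) *
      langevinOperator G₁ G₂ (finiteSet₂ Φ₁ Φ₂) f z ∂(phaseMeasure Φ₁ Φ₂)) atTop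
      (𝓝 (∫ z, Set.indicator (Set.Ioi c) 1 ((f : Rd d × Rd d → ℝ) z) *
        langevinOperator G₁ G₂ (finiteSet₂ Φ₁ Φ₂) f z ∂(phaseMeasure Φ₁ Φ₂))) := by
    refine tendsto_integral_of_dominated_convergence
      (fun z => ‖langevinOperator G₁ G₂ (finiteSet₂ Φ₁ Φ₂) f z‖) (fun n => ?_) i1.norm
      (fun n => Eventually.of_forall fun z => ?_) (Eventually.of_forall fun z => ?_)
    · exact ((contDiff_cutoffAbove c n).continuous.comp f.2.1.continuous).aestronglyMeasurable.mul i1.1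
    · rw [norm_mul]
      exact mul_le_of_le_one_left (norm_nonneg _) (hb n _)
    · exact (tendsto_cutoffAbove c _).mul_const _
  refine le_of_tendsto' hlim fun n => ?_
  refine integral_comp_mul_langevinOperator_nonpos h₁ h₂ f (contDiff_cutoffAbove c n) ?_ (hb n)
  intro s t hst
  refine Real.smoothTransition.monotone ?_
  gcongr

/-- Where `f > c`, `l (f - c) = (l f - L f - l c) + L f`; elsewhere the left side is replaced by
zero. Integrate and discard `∫ 1_{f > c} L f ≤ 0`. -/
lemma isSubMarkovianGraph_langevin : IsSubMarkovianGraph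
    ((langevinOperatorL1 Φ₁ Φ₂ G₁ G₂).graph : Set (Lp ℝ 1 (phaseMeasure Φ₁ Φ₂) ×
      Lp ℝ 1 (phaseMeasure Φ₁ Φ₂))) := by
  rw [langevinOperatorL1_graph h₁.isPotential h₂.isPotential]
  rintro c l hl ⟨u, w⟩ ⟨f, hu, hw⟩
  simp only at hu hw ⊢
  have hl' : (0 : ℝ) < l := hl
  have i1 := memLp_one_iff_integrable.1 (memLp_langevinOperator h₁ h₂ f (p := 1) one_le_two)
  have i2 : Integrable (fun z => Set.indicator (Set.Ioi (c : ℝ)) 1 ((f : Rd d × Rd d → ℝ) z) *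
      langevinOperator G₁ G₂ (finiteSet₂ Φ₁ Φ₂) f z) (phaseMeasure Φ₁ Φ₂) := by
    refine i1.bdd_mul (c := 1) ?_ (Eventually.of_forall fun z => ?_)
    · exact ((measurable_one.indicator measurableSet_Ioi).comp
        f.2.1.continuous.measurable).aestronglyMeasurable
    · by_cases hz : (c : ℝ) < (f : Rd d × Rd d → ℝ) z <;> simp [Set.indicator, hz]
  rw [norm_excess, norm_excess, ← integral_const_mul]
  have h3 := integral_indicator_langevinOperator_nonpos h₁ h₂ f c
  have h4 : ∫ z, (l : ℝ) * max (u z - c) 0 ∂(phaseMeasure Φ₁ Φ₂) ≤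
      ∫ z, (max (((l : ℝ) • u - w) z - (l * c : ℝ≥0)) 0 +
        Set.indicator (Set.Ioi (c : ℝ)) 1 ((f : Rd d × Rd d → ℝ) z) *
          langevinOperator G₁ G₂ (finiteSet₂ Φ₁ Φ₂) f z) ∂(phaseMeasure Φ₁ Φ₂) := by
    refine integral_mono_ae ((integrable_sub_posPart c u).const_mul _)
      ((integrable_sub_posPart (l * c) _).add i2) ?_
    filter_upwards [hu, hw, Lp.coeFn_sub ((l : ℝ) • u) w, Lp.coeFn_smul (l : ℝ) u] with z h5 h6 h7 h8
    rw [h7, Pi.sub_apply, h8, Pi.smul_apply, h5, h6, smul_eq_mul, NNReal.coe_mul]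
    by_cases hz : (c : ℝ) < (f : Rd d × Rd d → ℝ) z
    · rw [Set.indicator_of_mem (show _ ∈ Set.Ioi (c : ℝ) from hz), Pi.one_apply, one_mul,
        max_eq_left (by linarith)]
      have := le_max_left ((l : ℝ) * (f : Rd d × Rd d → ℝ) z -
        langevinOperator G₁ G₂ (finiteSet₂ Φ₁ Φ₂) f z - l * c) 0
      linarith
    · rw [Set.indicator_of_notMem (show _ ∉ Set.Ioi (c : ℝ) from hz), zero_mul,
        max_eq_right (by linarith), mul_zero, add_zero]
      exact le_max_right _ _
  rw [integral_add (integrable_sub_posPart (l * c) _) i2] at h4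
  exact h4.trans (add_le_of_nonpos_right h3)

end SubMarkovian

/-! ### Density by duality, and reduction to a uniqueness statement -/

section Density

/-- A subspace of `L¹` is dense if it is not annihilated by a non-trivial bounded function. -/
lemma dense_of_forall_bounded {X : Type*} [MeasurableSpace X] {μ : Measure X} [SigmaFinite μ]
    {S : Submodule ℝ (Lp ℝ 1 μ)}
    (hS : ∀ (h : X → ℝ) (M : ℝ), Measurable h → (∀ x, |h x| ≤ M) →
      (∀ u ∈ S, ∫ x, h x * u x ∂μ = 0) → ∀ᵐ x ∂μ, h x = 0) : Dense (S : Set (Lp ℝ 1 μ)) := by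
  intro x
  by_contra hx
  have hx' : x ∉ (S.topologicalClosure : Set (Lp ℝ 1 μ)) := hx
  obtain ⟨ℓ, c, hℓ, hℓx⟩ := geometric_hahn_banach_closed_point S.topologicalClosure.convex
    S.isClosed_topologicalClosure hx'
  have hc : 0 < c := by simpa using hℓ 0 (Submodule.zero_mem _)
  -- A functional bounded above on a subspace vanishes on it: rescaling `u` would otherwise attain
  -- the bound `c`.
  have hzero : ∀ u ∈ S, ℓ u = 0 := by
    intro u hu
    by_contra hne
    have h1 := hℓ ((c / ℓ u) • u) (Submodule.smul_mem _ _ (S.le_topologicalClosure hu))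
    rw [map_smul, smul_eq_mul, div_mul_cancel₀ _ hne] at h1
    exact lt_irrefl _ h1
  obtain ⟨h, hm, hb, hrep⟩ := exists_bounded_of_dual ℓ
  have hrep' : ∀ u : Lp ℝ 1 μ, ℓ u = ∫ x, h x * u x ∂μ := fun u => by
    rw [← hrep _ (Lp.memLp u), Lp.toLp_coeFn]
  have h0 := hS h ‖ℓ‖ hm hb fun u hu => by rw [← hrep', hzero u hu]
  have h1 : ℓ x = 0 := by
    rw [hrep']
    exact integral_eq_zero_of_ae (h0.mono fun y hy => by simp [hy])
  linarith

variable {d : ℕ} {Φ₁ Φ₂ : Rd d → EReal} {G₁ G₂ : Rd d → Rd d} {H₂ : Fin d → Rd d → ℝ}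
  (h₁ : PositionPotential 2 Φ₁ G₁) (h₂ : VelocityPotential Φ₂ G₂ H₂)
include h₁ h₂

lemma isOpen_finiteSet₂ : IsOpen (finiteSet₂ Φ₁ Φ₂) := h₁.isOpen.prod h₂.isOpen

lemma sigmaFinite_phaseMeasure : SigmaFinite (phaseMeasure Φ₁ Φ₂) :=
  (h₁.isPotential.add h₂.isPotential).sigmaFinite

/-- The fundamental lemma of the calculus of variations for the density times `h` on the open set
where the density is positive. -/
lemma ae_eq_zero_of_forall_testFunctions {h : Rd d × Rd d → ℝ} (hm : Measurable h) {M : ℝ}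
    (hb : ∀ z, |h z| ≤ M)
    (h0 : ∀ f ∈ testFunctions (finiteSet₂ Φ₁ Φ₂), ∫ z, h z * f z ∂(phaseMeasure Φ₁ Φ₂) = 0) :
    ∀ᵐ z ∂(phaseMeasure Φ₁ Φ₂), h z = 0 := by
  have p := h₁.isPotential.add h₂.isPotential
  set ρ := dens fun z : Rd d × Rd d => Φ₁ z.1 + Φ₂ z.2 with hρ
  obtain ⟨N, hN⟩ := p.exists_dens_le
  have hloc : LocallyIntegrable (fun z => ρ z * h z) volume := by
    intro z
    obtain ⟨K, hK, hKz⟩ := exists_compact_mem_nhds z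
    refine ⟨K, hKz, IntegrableOn.of_bound hK.measure_lt_top
      (p.measurable_dens.mul hm).aestronglyMeasurable (N * M) (Eventually.of_forall fun x => ?_)⟩
    rw [norm_mul, Real.norm_of_nonneg (dens_nonneg _ _)]
    exact mul_le_mul (hN x) (hb x) (norm_nonneg _) ((dens_nonneg _ _).trans (hN x))
  have h2 := (isOpen_finiteSet₂ h₁ h₂).ae_eq_zero_of_integral_contDiff_smul_eq_zero
    (hloc.locallyIntegrableOn _) (fun g hg hg' hg'' => by
      have h3 := h0 g ⟨hg, hg', hg''⟩
      rw [phaseMeasure, p.integral_expMeasure] at h3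
      rw [← h3]
      exact integral_congr_ae (Eventually.of_forall fun z => by simp only [smul_eq_mul]; ring))
  rw [phaseMeasure, p.ae_expMeasure_iff]
  filter_upwards [h2] with z hz hz'
  have h4 := hz ((add_lt_top_iff_of_isPotential h₁.isPotential h₂.isPotential z).1 hz')
  exact (mul_eq_zero.1 h4).resolve_left (p.dens_pos_iff.2 hz').ne'

lemma dense_domain_langevin : Dense ((langevinOperatorL1 Φ₁ Φ₂ G₁ G₂).domain :
    Set (Lp ℝ 1 (phaseMeasure Φ₁ Φ₂))) := by
  have := sigmaFinite_phaseMeasure h₁ h₂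
  refine dense_of_forall_bounded fun h M hm hb h0 => ?_
  refine ae_eq_zero_of_forall_testFunctions h₁ h₂ hm hb fun f hf => ?_
  have m1 := memLp_phase_testFunction h₁ h₂ hf (p := 1) one_le_two
  have m2 := memLp_langevinOperator h₁ h₂ ⟨f, hf⟩ (p := 1) one_le_two
  have hmem : m1.toLp f ∈ (langevinOperatorL1 Φ₁ Φ₂ G₁ G₂).domain := by
    refine LinearPMap.mem_domain_iff.2 ⟨m2.toLp _, ?_⟩
    rw [langevinOperatorL1_graph h₁.isPotential h₂.isPotential]
    exact ⟨⟨f, hf⟩, m1.coeFn_toLp, m2.coeFn_toLp⟩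
  rw [← h0 _ hmem]
  exact integral_congr_ae (m1.coeFn_toLp.mono fun z hz => by simp only [hz])

/-- A bounded function annihilating the range of `c - L` solves the dual resolvent equation, so
uniqueness for that equation is density of the range. -/
lemma exists_langevin_range_near
    (huniq : ∀ (c : ℝ) (h : Rd d × Rd d → ℝ) (M : ℝ), 0 < c → Measurable h → (∀ z, |h z| ≤ M) →
      (∀ f : testFunctions (finiteSet₂ Φ₁ Φ₂), ∫ z, h z * (c * (f : Rd d × Rd d → ℝ) z -
        langevinOperator G₁ G₂ (finiteSet₂ Φ₁ Φ₂) f z) ∂(phaseMeasure Φ₁ Φ₂) = 0) →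
      ∀ᵐ z ∂(phaseMeasure Φ₁ Φ₂), h z = 0) {c : ℝ} (hc : 0 < c) (g : Lp ℝ 1 (phaseMeasure Φ₁ Φ₂))
    {ε : ℝ} (hε : 0 < ε) :
    ∃ p ∈ (langevinOperatorL1 Φ₁ Φ₂ G₁ G₂).graph, ‖c • p.1 - p.2 - g‖ < ε := by
  have := sigmaFinite_phaseMeasure h₁ h₂
  set R : Lp ℝ 1 (phaseMeasure Φ₁ Φ₂) × Lp ℝ 1 (phaseMeasure Φ₁ Φ₂) →ₗ[ℝ] Lp ℝ 1 (phaseMeasure Φ₁ Φ₂) :=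
    c • LinearMap.fst ℝ _ _ - LinearMap.snd ℝ _ _
  have hdense : Dense ((langevinOperatorL1 Φ₁ Φ₂ G₁ G₂).graph.map R :
      Set (Lp ℝ 1 (phaseMeasure Φ₁ Φ₂))) := by
    refine dense_of_forall_bounded fun h M hm hb h0 => huniq c h M hc hm hb fun f => ?_
    have m1 := memLp_phase_testFunction h₁ h₂ f.2 (p := 1) one_le_two
    have m2 := memLp_langevinOperator h₁ h₂ f (p := 1) one_le_two
    have hmem : (m1.toLp _, m2.toLp _) ∈ (langevinOperatorL1 Φ₁ Φ₂ G₁ G₂).graph := by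
      rw [langevinOperatorL1_graph h₁.isPotential h₂.isPotential]
      exact ⟨f, m1.coeFn_toLp, m2.coeFn_toLp⟩
    rw [← h0 _ (Submodule.mem_map_of_mem hmem)]
    have e : R (m1.toLp _, m2.toLp _) = ((m1.const_mul c).sub m2).toLp _ := rfl
    rw [e]
    refine integral_congr_ae (((m1.const_mul c).sub m2).coeFn_toLp.mono fun z hz => ?_)
    simp only [hz, Pi.sub_apply]
  obtain ⟨_, ⟨p, hp, rfl⟩, hd⟩ := Metric.mem_closure_iff.1 (hdense g) ε hε
  rw [dist_comm, dist_eq_norm] at hd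
  exact ⟨p, hp, hd⟩

/-- Generation of a sub-Markovian semigroup, given uniqueness for the dual resolvent equation. -/
lemma exists_langevin_semigroup
    (huniq : ∀ (c : ℝ) (h : Rd d × Rd d → ℝ) (M : ℝ), 0 < c → Measurable h → (∀ z, |h z| ≤ M) →
      (∀ f : testFunctions (finiteSet₂ Φ₁ Φ₂), ∫ z, h z * (c * (f : Rd d × Rd d → ℝ) z -
        langevinOperator G₁ G₂ (finiteSet₂ Φ₁ Φ₂) f z) ∂(phaseMeasure Φ₁ Φ₂) = 0) →
      ∀ᵐ z ∂(phaseMeasure Φ₁ Φ₂), h z = 0) :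
    (langevinOperatorL1 Φ₁ Φ₂ G₁ G₂).IsClosable ∧
    ∃ T : ℝ≥0 → Lp ℝ 1 (phaseMeasure Φ₁ Φ₂) →L[ℝ] Lp ℝ 1 (phaseMeasure Φ₁ Φ₂),
      IsStronglyContinuousContractionSemigroup T ∧
      IsGenerator T (langevinOperatorL1 Φ₁ Φ₂ G₁ G₂).closure ∧ IsSubMarkovian T := by
  set A := langevinOperatorL1 Φ₁ Φ₂ G₁ G₂ with hA
  have hsub := isSubMarkovianGraph_langevin h₁ h₂
  have hdom := dense_domain_langevin h₁ h₂
  have hcl : A.IsClosable := hsub.isDissipative.isClosable hdom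
  have hgr := hcl.graph_closure_eq_closure_graph
  have hsub' : IsSubMarkovianGraph (A.closure.graph : Set (Lp ℝ 1 (phaseMeasure Φ₁ Φ₂) ×
      Lp ℝ 1 (phaseMeasure Φ₁ Φ₂))) := by
    rw [← hgr]
    exact hsub.closure
  have hdom' : Dense (A.closure.domain : Set (Lp ℝ 1 (phaseMeasure Φ₁ Φ₂))) :=
    hdom.mono A.le_closure.1
  obtain ⟨T, hT, hgen, hinv⟩ := exists_semigroup hdom' hsub'.isDissipative fun c hc g => by
    rw [← hgr]
    exact hsub.isDissipative.exists_closure_graph hc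
      (fun g ε hε => exists_langevin_range_near h₁ h₂ huniq hc g hε) g
  exact ⟨hcl, T, hT, hgen, hinv _ isClosed_unitInterval convex_unitInterval
    fun c hc p hp hpc => hsub'.mem_unitInterval hc hp hpc⟩

end Density

/-! ### Fubini for bounded kernels -/

section ProductIntegrals

variable {X Y : Type*} [MeasurableSpace X] [MeasurableSpace Y] {ν₁ : Measure X} {ν₂ : Measure Y}
  {H : X × Y → ℝ} {M : ℝ} {α : X → ℝ} {κ : Y → ℝ}

lemma integrable_bdd_mul_prod (hH : Measurable H) (hM : ∀ z, |H z| ≤ M) (hα : Integrable α ν₁)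
    (hκ : Integrable κ ν₂) : Integrable (fun z : X × Y => H z * (α z.1 * κ z.2)) (ν₁.prod ν₂) :=
  (hα.mul_prod hκ).bdd_mul hH.aestronglyMeasurable (Eventually.of_forall hM)

variable [SFinite ν₂]

lemma integrable_mul_integral (hH : Measurable H) (hM : ∀ z, |H z| ≤ M) (hα : Integrable α ν₁)
    (hκ : Integrable κ ν₂) : Integrable (fun x => α x * ∫ v, H (x, v) * κ v ∂ν₂) ν₁ := by
  refine (integrable_bdd_mul_prod hH hM hα hκ).integral_prod_left.congr (Eventually.of_forall fun x => ?_)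
  simp only
  rw [← integral_const_mul]
  exact integral_congr_ae (Eventually.of_forall fun v => by ring)

variable [SFinite ν₁]

lemma integral_bdd_mul_prod (hH : Measurable H) (hM : ∀ z, |H z| ≤ M) (hα : Integrable α ν₁)
    (hκ : Integrable κ ν₂) : ∫ z, H z * (α z.1 * κ z.2) ∂(ν₁.prod ν₂) =
      ∫ v, (∫ x, H (x, v) * α x ∂ν₁) * κ v ∂ν₂ := by
  rw [integral_prod_symm _ (integrable_bdd_mul_prod hH hM hα hκ)]
  refine integral_congr_ae (Eventually.of_forall fun v => ?_)
  simp only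
  rw [← integral_mul_const]
  simp only [mul_assoc]

lemma integral_mul_integral_swap (hH : Measurable H) (hM : ∀ z, |H z| ≤ M) (hα : Integrable α ν₁)
    (hκ : Integrable κ ν₂) : ∫ x, α x * (∫ v, H (x, v) * κ v ∂ν₂) ∂ν₁ =
      ∫ v, (∫ x, H (x, v) * α x ∂ν₁) * κ v ∂ν₂ := by
  rw [← integral_bdd_mul_prod hH hM hα hκ, integral_prod _ (integrable_bdd_mul_prod hH hM hα hκ)]
  refine integral_congr_ae (Eventually.of_forall fun x => ?_)
  simp only
  rw [← integral_const_mul]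
  exact integral_congr_ae (Eventually.of_forall fun v => by ring)

end ProductIntegrals

/-! ### Mollification in the position variable and its commutator -/

section SliceConvolution

variable {d : ℕ}

/-- The convolution in the first variable of `E(x) h(x, v)` with the kernel `k`. -/
def sliceConv (k E : Rd d → ℝ) (h : Rd d × Rd d → ℝ) (y v : Rd d) : ℝ :=
  ∫ x, k (y - x) * (E x * h (x, v))

variable {k E : Rd d → ℝ} {h : Rd d × Rd d → ℝ} {M : ℝ}

lemma integrable_mul_bdd (hE : Integrable E) (hh : Measurable h) (hM : ∀ z, |h z| ≤ M) (v : Rd d) :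
    Integrable fun x => E x * h (x, v) := by
  refine (hE.bdd_mul (f := fun x => h (x, v)) (c := M)
    (hh.comp (measurable_id.prodMk measurable_const)).aestronglyMeasurable
    (Eventually.of_forall fun x => hM _)).congr (Eventually.of_forall fun x => mul_comm _ _)

lemma sliceConv_mollKernel (n : ℕ) (y v : Rd d) :
    sliceConv (mollKernel n) E h y v = mollify n (fun x => E x * h (x, v)) y :=
  (mollify_apply n _ y).symm

lemma pd_sliceConv (hE : Integrable E) (hh : Measurable h) (hM : ∀ z, |h z| ≤ M) (n : ℕ) (i : Fin d)
    (y v : Rd d) : pd i (fun y => sliceConv (mollKernel n) E h y v) y =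
      sliceConv (pd i (mollKernel n)) E h y v := by
  have : (fun y => sliceConv (mollKernel n) E h y v) = mollify n (fun x => E x * h (x, v)) :=
    funext fun y => sliceConv_mollKernel n y v
  rw [this, pd, fderiv_mollify n (integrable_mul_bdd hE hh hM v).locallyIntegrable]
  rfl

lemma contDiff_sliceConv (hE : Integrable E) (hh : Measurable h) (hM : ∀ z, |h z| ≤ M) (n : ℕ)
    (v : Rd d) : ContDiff ℝ ∞ fun y => sliceConv (mollKernel n) E h y v := by
  have : (fun y => sliceConv (mollKernel n) E h y v) = mollify n (fun x => E x * h (x, v)) :=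
    funext fun y => sliceConv_mollKernel n y v
  rw [this]
  exact contDiff_mollify n (integrable_mul_bdd hE hh hM v).locallyIntegrable

lemma measurable_sliceConv (hk : Measurable k) (hE : Measurable E) (hh : Measurable h) :
    Measurable fun z : Rd d × Rd d => sliceConv k E h z.1 z.2 := by
  have h1 : StronglyMeasurable fun q : (Rd d × Rd d) × Rd d =>
      k (q.1.1 - q.2) * (E q.2 * h (q.2, q.1.2)) := by
    refine Measurable.stronglyMeasurable ?_
    exact (hk.comp ((measurable_fst.comp measurable_fst).sub measurable_snd)).mul
      ((hE.comp measurable_snd).mul (hh.comp (measurable_snd.prodMk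
        (measurable_snd.comp measurable_fst))))
  exact h1.integral_prod_right'.measurable

lemma abs_sliceConv_le {C : ℝ} (hk : ∀ x, |k x| ≤ C) (hE : Integrable E) (hM : ∀ z, |h z| ≤ M)
    (y v : Rd d) : |sliceConv k E h y v| ≤ C * M * ∫ x, |E x| := by
  rw [sliceConv, ← integral_const_mul, ← Real.norm_eq_abs]
  refine norm_integral_le_of_norm_le (hE.abs.const_mul _) (Eventually.of_forall fun x => ?_)
  have hC : 0 ≤ C := (abs_nonneg _).trans (hk 0)
  rw [Real.norm_eq_abs, abs_mul, abs_mul]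
  calc |k (y - x)| * (|E x| * |h (x, v)|) ≤ C * (|E x| * M) := by
        gcongr
        · exact hk _
        · exact hM _
    _ = C * M * |E x| := by ring

lemma abs_sliceConv_mollKernel_le {C : ℝ} (n : ℕ) (hE : ∀ x, |E x| ≤ C) (hM : ∀ z, |h z| ≤ M)
    (y v : Rd d) : |sliceConv (mollKernel n) E h y v| ≤ C * M := by
  have hC : 0 ≤ C := (abs_nonneg _).trans (hE 0)
  rw [sliceConv_mollKernel, mollify_eq_integral_mollMeasure]
  have h1 := norm_integral_le_of_norm_le_const (μ := mollMeasure d n)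
    (f := fun z => E (y - z) * h (y - z, v)) (C := C * M) (Eventually.of_forall fun z => by
      rw [norm_mul]
      exact mul_le_mul (hE _) (hM _) (norm_nonneg _) hC)
  simpa using h1

lemma sliceConv_eq_zero {n : ℕ} {S : Set (Rd d)} (hE : ∀ x, x ∉ S → E x = 0)
    {y : Rd d} (hy : ∀ x ∈ S, 1 / ((n : ℝ) + 1) < ‖y - x‖) (v : Rd d) :
    sliceConv (mollKernel n) E h y v = 0 := by
  refine integral_eq_zero_of_ae (Eventually.of_forall fun x => ?_)
  by_cases hx : x ∈ S
  · simp [mollKernel_eq_zero (hy x hx)]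
  · simp [hE x hx]

lemma ae_tendsto_sliceConv (hE : Integrable E) (hh : Measurable h) (hM : ∀ z, |h z| ≤ M) (v : Rd d) :
    ∀ᵐ y, Tendsto (fun n => sliceConv (mollKernel n) E h y v) atTop (𝓝 (E y * h (y, v))) := by
  simp only [sliceConv_mollKernel]
  exact ae_tendsto_mollify (integrable_mul_bdd hE hh hM v).locallyIntegrable

/-- The averaged squared translation error at a point. -/
def translationError (n : ℕ) (g : Rd d → ℝ) (y : Rd d) : ℝ≥0∞ :=
  ∫⁻ z, ‖g (y - z) - g y‖ₑ ^ (2 : ℝ≥0∞).toReal ∂(mollMeasure d n)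

lemma measurable_translationError (n : ℕ) {g : Rd d → ℝ} (hg : Measurable g) :
    Measurable (translationError n g) := by
  have h1 : Measurable fun q : Rd d × Rd d => ‖g (q.1 - q.2) - g q.1‖ₑ ^ (2 : ℝ≥0∞).toReal :=
    ((hg.comp (measurable_fst.sub measurable_snd)).sub (hg.comp measurable_fst)).enorm.pow_const _
  exact h1.lintegral_prod_right'

/-- Commutator estimate for mollification and multiplication. -/
lemma sq_sliceConv_commutator_le {g : Rd d → ℝ} (hg : Measurable g) {C : ℝ}
    (hEC : ∀ x, |E x| ≤ C) (hEi : Integrable E) (hgE : Integrable fun x => g x * E x)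
    (hh : Measurable h) (hM : ∀ z, |h z| ≤ M) (n : ℕ) (y v : Rd d) (hD : translationError n g y ≠ ⊤) :
    (sliceConv (mollKernel n) (fun x => g x * E x) h y v -
      g y * sliceConv (mollKernel n) E h y v) ^ 2 ≤ (C * M) ^ 2 * (translationError n g y).toReal := by
  have hC : 0 ≤ C := (abs_nonneg _).trans (hEC 0)
  have hM0 : 0 ≤ M := (abs_nonneg _).trans (hM 0)
  have i1 := integrable_comp_sub_mollMeasure n
    (integrable_mul_bdd hgE hh hM v).locallyIntegrable y
  have i2 := integrable_comp_sub_mollMeasure n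
    (integrable_mul_bdd hEi hh hM v).locallyIntegrable y
  -- Freezing `g` at `y` leaves an average of `g (y - z) - g y` times a function bounded by `C M`;
  -- Jensen for the mollifier measure then gives the square.
  have e : sliceConv (mollKernel n) (fun x => g x * E x) h y v -
      g y * sliceConv (mollKernel n) E h y v =
      ∫ z, (g (y - z) - g y) * (E (y - z) * h (y - z, v)) ∂(mollMeasure d n) := by
    rw [sliceConv_mollKernel, sliceConv_mollKernel, mollify_eq_integral_mollMeasure,
      mollify_eq_integral_mollMeasure, ← integral_const_mul, ← integral_sub i1 (i2.const_mul _)]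
    exact integral_congr_ae (Eventually.of_forall fun z => by ring)
  have hm1 : Measurable fun z => g (y - z) - g y :=
    (hg.comp (measurable_const.sub measurable_id)).sub measurable_const
  have h1 : ‖∫ z, (g (y - z) - g y) * (E (y - z) * h (y - z, v)) ∂(mollMeasure d n)‖ₑ ≤
      ENNReal.ofReal (C * M) * eLpNorm (fun z => g (y - z) - g y) 2 (mollMeasure d n) := by
    refine (enorm_integral_le_lintegral_enorm _).trans ?_
    refine le_trans ?_ (mul_le_mul_right (eLpNorm_le_eLpNorm_of_exponent_le one_le_two
      hm1.aestronglyMeasurable) _)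
    rw [eLpNorm_one_eq_lintegral_enorm, ← lintegral_const_mul _ hm1.enorm]
    refine lintegral_mono fun z => ?_
    rw [enorm_mul, mul_comm]
    refine mul_le_mul_left ?_ _
    rw [Real.enorm_eq_ofReal_abs, abs_mul]
    exact ENNReal.ofReal_le_ofReal (mul_le_mul (hEC _) (hM _) (abs_nonneg _) hC)
  have h2 : eLpNorm (fun z => g (y - z) - g y) 2 (mollMeasure d n) ^ 2 = translationError n g y := by
    rw [eLpNorm_eq_lintegral_rpow_enorm_toReal two_ne_zero ENNReal.ofNat_ne_top,
      ← ENNReal.rpow_natCast, ← ENNReal.rpow_mul]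
    simp [translationError]
  have h3 : ‖∫ z, (g (y - z) - g y) * (E (y - z) * h (y - z, v)) ∂(mollMeasure d n)‖ₑ ^ 2 ≤
      ENNReal.ofReal (C * M) ^ 2 * translationError n g y := by
    rw [← h2, ← mul_pow]
    gcongr
  rw [e]
  have h4 := ENNReal.toReal_mono (ENNReal.mul_ne_top (by simp) hD) h3
  rw [ENNReal.toReal_pow, ENNReal.toReal_mul, ENNReal.toReal_pow,
    ENNReal.toReal_ofReal (mul_nonneg hC hM0), toReal_enorm, Real.norm_eq_abs, sq_abs] at h4
  exact h4

end SliceConvolution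

/-! ### The dual equation for mollified slices -/

section DualEquation

variable {d : ℕ} {Φ₁ Φ₂ : Rd d → EReal} {G₁ G₂ : Rd d → Rd d} {H₂ : Fin d → Rd d → ℝ}
  (h₁ : PositionPotential 2 Φ₁ G₁) (h₂ : VelocityPotential Φ₂ G₂ H₂)
  {h : Rd d × Rd d → ℝ} (hh : Measurable h) {M : ℝ} (hM : ∀ z, |h z| ≤ M)
include h₁ h₂ hh hM

omit hh hM h₂ in
lemma integral_mul_mul_eq_sliceConv {a : Rd d → ℝ} {k E : Rd d → ℝ} {y : Rd d}
    (ha : ∀ᵐ x, dens Φ₁ x * a x = k (y - x) * E x) (v : Rd d) :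
    ∫ x, h (x, v) * a x ∂(expMeasure Φ₁) = sliceConv k E h y v := by
  rw [h₁.isPotential.integral_expMeasure, sliceConv]
  refine integral_congr_ae (ha.mono fun x hx => ?_)
  simp only
  rw [mul_left_comm, hx]
  ring

omit hh hM h₂ in
lemma integrable_mul_dens {Ω : Set (Rd d)} {ψ : Rd d → ℝ} (hψ : ψ ∈ testFunctions Ω) :
    Integrable fun x => ψ x * dens Φ₁ x := by
  refine (h₁.isPotential.integrable_expMeasure_iff.1
    (h₁.isPotential.integrable_testFunction hψ)).congr (Eventually.of_forall fun x => mul_comm _ _)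

/-- Test the dual equation with `f(x, v) = j_n(y - x) ψ(x) φ(v)` and integrate out `x`. The position
derivative falls either on `ψ` or on the kernel, which gives the two parts of the source term. The
functions `b i` allow a measurable version of `∇Φ₁` to be substituted. -/
lemma sliceConv_weak_equation {c : ℝ}
    (heq : ∀ f : testFunctions (finiteSet₂ Φ₁ Φ₂), ∫ z, h z * (c * (f : Rd d × Rd d → ℝ) z -
        langevinOperator G₁ G₂ (finiteSet₂ Φ₁ Φ₂) f z) ∂(phaseMeasure Φ₁ Φ₂) = 0)
    {ψ : Rd d → ℝ} (hψ : ψ ∈ testFunctions (finiteSet Φ₁)) {b : Fin d → Rd d → ℝ}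
    (hb : ∀ i, ∀ᵐ x, G₁ x i * (ψ x * dens Φ₁ x) = b i x) (n : ℕ) (y : Rd d)
    (φ : testFunctions (finiteSet Φ₂)) :
    ∫ v, sliceConv (mollKernel n) (fun x => ψ x * dens Φ₁ x) h y v *
        (c * (φ : Rd d → ℝ) v - velocityOperator G₂ (finiteSet Φ₂) φ v) ∂(expMeasure Φ₂) -
      ∑ i, ∫ v, (sliceConv (mollKernel n) (fun x => pd i ψ x * dens Φ₁ x) h y v -
        sliceConv (pd i (mollKernel n)) (fun x => ψ x * dens Φ₁ x) h y v) *
          (G₂ v i * (φ : Rd d → ℝ) v) ∂(expMeasure Φ₂) +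
      ∑ i, ∫ v, sliceConv (mollKernel n) (b i) h y v * pd i (φ : Rd d → ℝ) v ∂(expMeasure Φ₂) = 0 := by
  have s₁ := h₁.isPotential.sigmaFinite
  have s₂ := h₂.finite
  set μ₁ := expMeasure Φ₁
  set μ₂ := expMeasure Φ₂
  have hj : ContDiff ℝ ∞ fun x => mollKernel n (y - x) :=
    (contDiff_mollKernel n).comp (contDiff_const.sub contDiff_id)
  have hj' : ∀ i, ContDiff ℝ ∞ fun x => pd i (mollKernel n) (y - x) := fun i =>
    (((contDiff_mollKernel n).fderiv_right (m := ∞) (by simp)).clm_apply contDiff_const).comp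
      (contDiff_const.sub contDiff_id)
  set a : Rd d → ℝ := fun x => mollKernel n (y - x) * ψ x with hadef
  have ha : a ∈ testFunctions (finiteSet Φ₁) := mul_mem_testFunctions hψ hj
  have ha1 : ∀ i, (fun x => mollKernel n (y - x) * pd i ψ x) ∈ testFunctions (finiteSet Φ₁) := fun i =>
    mul_mem_testFunctions (pd_mem_testFunctions hψ i) hj
  have ha2 : ∀ i, (fun x => pd i (mollKernel n) (y - x) * ψ x) ∈ testFunctions (finiteSet Φ₁) := fun i =>
    mul_mem_testFunctions hψ (hj' i)
  have hpd : ∀ i x, pd i a x = mollKernel n (y - x) * pd i ψ x - pd i (mollKernel n) (y - x) * ψ x := by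
    intro i x
    rw [hadef, pd_mul i (hj.differentiable (by simp) x) (hψ.1.differentiable (by simp) x)]
    have : pd i (fun x => mollKernel n (y - x)) x = -pd i (mollKernel n) (y - x) :=
      fderiv_mollKernel_sub n y x _
    rw [this]
    ring
  have hpdm := fun i => pd_mem_testFunctions ha i
  have iT := fun {θ : Rd d → ℝ} (hθ : θ ∈ testFunctions (finiteSet Φ₁)) =>
    h₁.isPotential.integrable_testFunction hθ
  have iG := fun i => h₁.isPotential.integrable_grad_mul h₁.isOpen h₁.weakGradient i ha
  have m2 : ∀ {k : Rd d → ℝ}, MemLp k 2 μ₂ → Integrable k μ₂ := fun hk => hk.integrable one_le_two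
  have k0 : Integrable (fun v => c * (φ : Rd d → ℝ) v - velocityOperator G₂ (finiteSet Φ₂) φ v) μ₂ :=
    m2 (((h₂.memLp_testFunction φ.2 2).const_mul c).sub (h₂.memLp_velocityOperator φ))
  have k1 : ∀ i, Integrable (fun v => G₂ v i * (φ : Rd d → ℝ) v) μ₂ := fun i =>
    m2 (h₂.memLp_grad_mul_testFunction φ.2 i)
  have k2 : ∀ i, Integrable (pd i (φ : Rd d → ℝ)) μ₂ := fun i =>
    m2 (h₂.memLp_testFunction (pd_mem_testFunctions φ.2 i) 2)
  have J0 := integrable_bdd_mul_prod hh hM (iT ha) k0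
  have J1 := fun i => integrable_bdd_mul_prod hh hM (iT (hpdm i)) (k1 i)
  have J2 := fun i => integrable_bdd_mul_prod hh hM (iG i) (k2 i)
  have E0 := integral_bdd_mul_prod hh hM (iT ha) k0
  have E1 := fun i => integral_bdd_mul_prod hh hM (iT (hpdm i)) (k1 i)
  have E2 := fun i => integral_bdd_mul_prod hh hM (iG i) (k2 i)
  have hmain := heq ⟨_, prod_mem_testFunctions ha φ.2⟩
  rw [phaseMeasure_eq_prod h₁.isPotential h₂.isPotential] at hmain
  have hint : ∀ z : Rd d × Rd d, h z * (c * (a z.1 * (φ : Rd d → ℝ) z.2) -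
      langevinOperator G₁ G₂ (finiteSet₂ Φ₁ Φ₂) ⟨_, prod_mem_testFunctions ha φ.2⟩ z) =
      h z * (a z.1 * (c * (φ : Rd d → ℝ) z.2 - velocityOperator G₂ (finiteSet Φ₂) φ z.2)) -
        ∑ i, h z * (pd i a z.1 * (G₂ z.2 i * (φ : Rd d → ℝ) z.2)) +
        ∑ i, h z * (G₁ z.1 i * a z.1 * pd i (φ : Rd d → ℝ) z.2) := by
    rintro ⟨x, v⟩
    rw [langevinOperator_prod G₁ G₂ ha φ.2, ← Finset.mul_sum, ← Finset.mul_sum]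
    have e1 : ∑ i, G₂ v i * (φ : Rd d → ℝ) v * pd i a x =
        ∑ i, pd i a x * (G₂ v i * (φ : Rd d → ℝ) v) := Finset.sum_congr rfl fun i _ => mul_comm _ _
    rw [e1]
    ring
  have hmain' : ∫ z, (h z * (a z.1 * (c * (φ : Rd d → ℝ) z.2 -
      velocityOperator G₂ (finiteSet Φ₂) φ z.2)) -
        ∑ i, h z * (pd i a z.1 * (G₂ z.2 i * (φ : Rd d → ℝ) z.2)) +
        ∑ i, h z * (G₁ z.1 i * a z.1 * pd i (φ : Rd d → ℝ) z.2)) ∂(μ₁.prod μ₂) = 0 := by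
    rw [← hmain]
    exact integral_congr_ae (Eventually.of_forall fun z => (hint z).symm)
  have JS1 := integrable_finsetSum Finset.univ fun i _ => J1 i
  have J3 : Integrable (fun z : Rd d × Rd d => h z * (a z.1 * (c * (φ : Rd d → ℝ) z.2 -
      velocityOperator G₂ (finiteSet Φ₂) φ z.2)) -
        ∑ i, h z * (pd i a z.1 * (G₂ z.2 i * (φ : Rd d → ℝ) z.2))) (μ₁.prod μ₂) := J0.sub JS1
  rw [integral_add J3 (integrable_finsetSum _ fun i _ => J2 i), integral_sub J0 JS1,
    integral_finsetSum _ fun i _ => J1 i, integral_finsetSum _ fun i _ => J2 i, E0,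
    Finset.sum_congr rfl fun i _ => E1 i, Finset.sum_congr rfl fun i _ => E2 i] at hmain'
  rw [← hmain']
  congr 1
  · congr 1
    · refine integral_congr_ae (Eventually.of_forall fun v => ?_)
      simp only
      rw [integral_mul_mul_eq_sliceConv h₁ (k := mollKernel n) (y := y)
        (E := fun x => ψ x * dens Φ₁ x) (Eventually.of_forall fun x => by simp only [hadef]; ring)]
    · refine Finset.sum_congr rfl fun i _ => integral_congr_ae (Eventually.of_forall fun v => ?_)
      simp only [hpd]
      rw [← integral_mul_mul_eq_sliceConv h₁ (a := fun x => mollKernel n (y - x) * pd i ψ x)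
          (k := mollKernel n) (y := y) (E := fun x => pd i ψ x * dens Φ₁ x)
          (Eventually.of_forall fun x => by ring),
        ← integral_mul_mul_eq_sliceConv h₁ (a := fun x => pd i (mollKernel n) (y - x) * ψ x)
          (k := pd i (mollKernel n)) (y := y) (E := fun x => ψ x * dens Φ₁ x)
          (Eventually.of_forall fun x => by ring)]
      have b1 : ∀ {θ : Rd d → ℝ}, θ ∈ testFunctions (finiteSet Φ₁) →
          Integrable (fun x => h (x, v) * θ x) μ₁ := fun hθ => (iT hθ).bdd_mul
        (hh.comp (measurable_id.prodMk measurable_const)).aestronglyMeasurable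
        (Eventually.of_forall fun x => hM _)
      rw [← integral_sub (b1 (ha1 i)) (b1 (ha2 i))]
      congr 1
      exact integral_congr_ae (Eventually.of_forall fun x => by simp only; ring)
  · refine Finset.sum_congr rfl fun i _ => integral_congr_ae (Eventually.of_forall fun v => ?_)
    simp only
    rw [integral_mul_mul_eq_sliceConv h₁ (E := b i) (k := mollKernel n) (y := y)]
    filter_upwards [hb i] with x hx
    rw [← hx, hadef]
    ring

end DualEquation

/-- Fubini places `v` outside: for each fixed `v` the mollifications converge for almost every `y`,
and everything is uniformly bounded, so dominated convergence applies twice. -/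
lemma tendsto_integral_sq_sliceConv {d : ℕ} {Y : Measure (Rd d)} [IsFiniteMeasure Y]
    {E w : Rd d → ℝ} {h : Rd d × Rd d → ℝ} {C M : ℝ} (hw : Integrable w) (hE : Integrable E)
    (hEm : Measurable E) (hEC : ∀ x, |E x| ≤ C) (hh : Measurable h) (hM : ∀ z, |h z| ≤ M) :
    Tendsto (fun n => ∫ y, w y * ∫ v, sliceConv (mollKernel n) E h y v ^ 2 ∂Y) atTop
      (𝓝 (∫ y, w y * ∫ v, (E y * h (y, v)) ^ 2 ∂Y)) := by
  have hb := fun n => abs_sliceConv_mollKernel_le (E := E) (h := h) n hEC hM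
  have hC : 0 ≤ C := (abs_nonneg _).trans (hEC 0)
  have hm : ∀ n, Measurable fun z : Rd d × Rd d => sliceConv (mollKernel n) E h z.1 z.2 := fun n =>
    measurable_sliceConv (continuous_mollKernel n).measurable hEm hh
  have hm0 : Measurable fun z : Rd d × Rd d => E z.1 * h z := (hEm.comp measurable_fst).mul hh
  have hb0 : ∀ z : Rd d × Rd d, |E z.1 * h z| ≤ C * M := fun z => by
    rw [abs_mul]
    exact mul_le_mul (hEC _) (hM _) (abs_nonneg _) hC
  have hsq : ∀ {t : ℝ}, |t| ≤ C * M → |t ^ 2| ≤ (C * M) ^ 2 := fun ht => by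
    rw [abs_pow]
    exact pow_le_pow_left₀ (abs_nonneg _) ht 2
  have h1 : Integrable (fun _ : Rd d => (1 : ℝ)) Y := integrable_const _
  have e : ∀ n, ∫ y, w y * ∫ v, sliceConv (mollKernel n) E h y v ^ 2 ∂Y =
      ∫ v, ∫ y, sliceConv (mollKernel n) E h y v ^ 2 * w y ∂volume ∂Y := fun n => by
    have := integral_mul_integral_swap ((hm n).pow_const 2) (fun z => hsq (hb n z.1 z.2)) hw h1
    simpa using this
  have e0 : ∫ y, w y * ∫ v, (E y * h (y, v)) ^ 2 ∂Y =
      ∫ v, ∫ y, (E y * h (y, v)) ^ 2 * w y ∂volume ∂Y := by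
    have := integral_mul_integral_swap (hm0.pow_const 2) (fun z => hsq (hb0 z)) hw h1
    simpa using this
  have hbd : ∀ n v y, ‖sliceConv (mollKernel n) E h y v ^ 2 * w y‖ ≤ (C * M) ^ 2 * |w y| :=
    fun n v y => by
      rw [norm_mul, Real.norm_eq_abs, Real.norm_eq_abs]
      exact mul_le_mul_of_nonneg_right (hsq (hb n y v)) (abs_nonneg _)
  simp only [e, e0]
  refine tendsto_integral_of_dominated_convergence (fun _ => (C * M) ^ 2 * ∫ y, |w y|)
    (fun n => ?_) (integrable_const _) (fun n => Eventually.of_forall fun v => ?_)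
    (Eventually.of_forall fun v => ?_)
  · have := (integrable_bdd_mul_prod ((hm n).pow_const 2) (fun z => hsq (hb n z.1 z.2)) hw h1
      (ν₁ := volume) (ν₂ := Y)).integral_prod_right.aestronglyMeasurable
    simpa using this
  · rw [← integral_const_mul]
    exact norm_integral_le_of_norm_le (hw.abs.const_mul _) (Eventually.of_forall fun y => hbd n v y)
  · refine tendsto_integral_of_dominated_convergence (fun y => (C * M) ^ 2 * |w y|)
      (fun n => ?_) (hw.abs.const_mul _) (fun n => Eventually.of_forall fun y => hbd n v y) ?_
    · exact (((hm n).comp (measurable_id.prodMk measurable_const)).pow_const 2).aestronglyMeasurable.mul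
        hw.aestronglyMeasurable
    · filter_upwards [ae_tendsto_sliceConv hE hh hM v] with y hy
      exact (hy.pow 2).mul_const _

/-! ### The weight `e^{Φ₁}` on compact subsets of `{Φ₁ < ∞}` -/

namespace PositionPotential

variable {d : ℕ} {Φ : Rd d → EReal} {G : Rd d → Rd d} (h : PositionPotential 2 Φ G)
include h

lemma dens_pos {x : Rd d} (hx : x ∈ finiteSet Φ) : 0 < dens Φ x := h.isPotential.dens_pos_iff.2 hx

lemma exists_inv_dens_le {K : Set (Rd d)} (hK : IsCompact K) (hKΩ : K ⊆ finiteSet Φ) :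
    ∃ W, 0 < W ∧ ∀ x ∈ K, (dens Φ x)⁻¹ ≤ W := by
  obtain ⟨W, hW⟩ := hK.exists_bound_of_continuousOn (f := fun x => (dens Φ x)⁻¹)
    (h.continuous_dens.continuousOn.inv₀ fun x hx => (h.dens_pos (hKΩ hx)).ne')
  exact ⟨max W 1, by positivity, fun x hx =>
    (le_abs_self _).trans ((hW x hx).trans (le_max_left _ _))⟩

/-- On such a compact set the continuous density is bounded below, so Lebesgue measure is dominated
by a multiple of `μ_{Φ₁}`. -/
lemma memLp_indicator_grad {K : Set (Rd d)} (hK : IsCompact K) (hKΩ : K ⊆ finiteSet Φ) (i : Fin d) :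
    MemLp (K.indicator fun x => G x i) 2 volume := by
  obtain ⟨W, hW0, hW⟩ := h.exists_inv_dens_le hK hKΩ
  rw [memLp_indicator_iff_restrict hK.measurableSet]
  have h1 : MemLp (fun x => G x i) 2 ((expMeasure Φ).restrict K) :=
    MemLp.coord (h.memLpLoc K hK (Set.subset_univ _)) i
  refine h1.of_measure_le_smul (c := ENNReal.ofReal W) ENNReal.ofReal_ne_top ?_
  refine Measure.le_iff.2 fun s hs => ?_
  rw [Measure.restrict_apply hs, Measure.smul_apply, Measure.restrict_apply hs,
    h.isPotential.expMeasure_eq, withDensity_apply _ (hs.inter hK.measurableSet), smul_eq_mul,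
    ← lintegral_const_mul _ h.isPotential.measurable_dens.ennreal_ofReal, ← setLIntegral_one]
  refine setLIntegral_mono' (hs.inter hK.measurableSet) fun x hx => ?_
  rw [← ENNReal.ofReal_mul hW0.le, ← ENNReal.ofReal_one]
  have := h.dens_pos (hKΩ hx.2)
  exact ENNReal.ofReal_le_ofReal ((inv_le_iff_one_le_mul₀ this).1 (hW x hx.2))

/-- Chain rule for `exp`, which is bounded on the values of `Φ` over a compact set; these lie below
`log W`. -/
lemma isWeakPartial_inv_dens (i : Fin d) :
    IsWeakPartial (finiteSet Φ) i (fun x => (dens Φ x)⁻¹) fun x => (dens Φ x)⁻¹ * G x i := by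
  have e : ∀ x ∈ finiteSet Φ, Real.exp (Φ x).toReal = (dens Φ x)⁻¹ := fun x hx => by
    rw [h.isPotential.dens_of_lt_top hx, Real.exp_neg, inv_inv]
  refine ((h.weakGradient i).comp h.isOpen (F := Real.exp) (F' := Real.exp) Real.hasDerivAt_exp
    Real.continuous_exp fun K hK hKΩ => ?_).congr h.isOpen.measurableSet e
    fun x hx => by simp only; rw [e x hx]
  obtain ⟨W, hW0, hW⟩ := h.exists_inv_dens_le hK hKΩ
  refine ⟨Set.Iic (Real.log W), isClosed_Iic, convex_Iic _, fun x hx => ?_, W, fun s hs => ?_⟩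
  · rw [Set.mem_Iic, Real.le_log_iff_exp_le hW0, e x (hKΩ hx)]
    exact hW x hx
  · rw [abs_of_pos (Real.exp_pos _), ← Real.le_log_iff_exp_le hW0]
    exact ⟨hs, hs⟩

end PositionPotential

/-! ### Caccioppoli inequality in the position variable -/

section Caccioppoli

variable {d : ℕ} {Φ₁ Φ₂ : Rd d → EReal} {G₁ G₂ : Rd d → Rd d} {H₂ : Fin d → Rd d → ℝ}
  (h₁ : PositionPotential 2 Φ₁ G₁) (h₂ : VelocityPotential Φ₂ G₂ H₂)
include h₁ h₂

omit h₂ in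
/-- Weighted integration by parts for the mollified slices. -/
lemma integral_sliceConv_mul_pd_add {ψ : Rd d → ℝ} (hψ : ψ ∈ testFunctions (finiteSet Φ₁))
    {h : Rd d × Rd d → ℝ} (hh : Measurable h) {M : ℝ} (hM : ∀ z, |h z| ≤ M) {K : Set (Rd d)}
    (hKΩ : K ⊆ finiteSet Φ₁) {δ : ℝ} (hδK : Metric.cthickening δ (tsupport ψ) ⊆ K) {n : ℕ}
    (hn : 1 / ((n : ℝ) + 1) ≤ δ) {i : Fin d} {g : Rd d → ℝ}
    (hg : ∀ᵐ y, y ∈ K → g y = G₁ y i) (v : Rd d) :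
    ∫ y, sliceConv (mollKernel n) (fun x => ψ x * dens Φ₁ x) h y v *
        sliceConv (pd i (mollKernel n)) (fun x => ψ x * dens Φ₁ x) h y v *
          K.indicator (fun y => (dens Φ₁ y)⁻¹) y =
      -(1 / 2 * ∫ y, sliceConv (mollKernel n) (fun x => ψ x * dens Φ₁ x) h y v ^ 2 *
        (K.indicator (fun y => (dens Φ₁ y)⁻¹) y * g y)) := by
  set E : Rd d → ℝ := fun x => ψ x * dens Φ₁ x with hE
  have hEi : Integrable E := integrable_mul_dens h₁ hψ
  set u : Rd d → ℝ := fun y => sliceConv (mollKernel n) E h y v with hu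
  have hus : ContDiff ℝ ∞ u := contDiff_sliceConv hEi hh hM n v
  have hδ : 0 < δ := lt_of_lt_of_le (by positivity) hn
  -- The mollification enlarges the support of `ψ` by at most `δ`, so the slice stays inside `K` and
  -- its square is an admissible test function for `e^{Φ₁}`.
  have hu0 : ∀ y, y ∉ Metric.cthickening δ (tsupport ψ) → u y = 0 := fun y hy => by
    refine sliceConv_eq_zero (S := tsupport ψ) (fun x hx => ?_) (fun x hx => ?_) v
    · simp only [hE, image_eq_zero_of_notMem_tsupport hx, zero_mul]
    · by_contra! hlt
      exact hy (Metric.mem_cthickening_of_dist_le y x δ _ hx ((dist_eq_norm y x).trans_le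
        (hlt.trans hn)))
  have hsub : tsupport u ⊆ Metric.cthickening δ (tsupport ψ) := by
    refine closure_minimal (fun y hy => ?_) Metric.isClosed_cthickening
    by_contra hc
    exact hy (hu0 y hc)
  have hut : u ∈ testFunctions (finiteSet Φ₁) :=
    ⟨hus, HasCompactSupport.of_support_subset_isCompact
      (IsCompact.cthickening hψ.2.1) (subset_closure.trans hsub), hsub.trans (hδK.trans hKΩ)⟩
  have hθ := mul_mem_testFunctions hut hus
  have hpd : ∀ y, pd i (fun y => u y * u y) y = 2 * (u y * sliceConv (pd i (mollKernel n)) E h y v) := by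
    intro y
    rw [pd_mul i (hus.differentiable (by simp) y) (hus.differentiable (by simp) y),
      pd_sliceConv hEi hh hM]
    ring
  have hmain := (h₁.isWeakPartial_inv_dens i).integral_eq hθ
  have e1 : ∫ x, (dens Φ₁ x)⁻¹ * fderiv ℝ (fun y => u y * u y) x (EuclideanSpace.single i 1) =
      2 * ∫ y, u y * sliceConv (pd i (mollKernel n)) E h y v *
          K.indicator (fun y => (dens Φ₁ y)⁻¹) y := by
    rw [← integral_const_mul]
    refine integral_congr_ae (Eventually.of_forall fun y => ?_)
    have := hpd y
    simp only [pd] at this ⊢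
    rw [this]
    by_cases hy : y ∈ K
    · rw [Set.indicator_of_mem hy]
      ring
    · rw [hu0 y fun hc => hy (hδK hc)]
      ring
  have e2 : ∫ x, (dens Φ₁ x)⁻¹ * G₁ x i * (u x * u x) =
      ∫ y, u y ^ 2 * (K.indicator (fun y => (dens Φ₁ y)⁻¹) y * g y) := by
    refine integral_congr_ae (hg.mono fun y hgy => ?_)
    simp only
    by_cases hy : y ∈ K
    · rw [Set.indicator_of_mem hy, hgy hy]
      ring
    · rw [hu0 y fun hc => hy (hδK hc)]
      ring
  rw [e1, e2] at hmain
  linarith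

/-- Caccioppoli inequality for bounded solutions of the dual resolvent equation. -/
lemma exists_caccioppoli {c : ℝ} (hc : 0 < c) : ∃ K, 0 ≤ K ∧ ∀ (h : Rd d × Rd d → ℝ) (M : ℝ),
    Measurable h → (∀ z, |h z| ≤ M) →
    (∀ f : testFunctions (finiteSet₂ Φ₁ Φ₂), ∫ z, h z * (c * (f : Rd d × Rd d → ℝ) z -
      langevinOperator G₁ G₂ (finiteSet₂ Φ₁ Φ₂) f z) ∂(phaseMeasure Φ₁ Φ₂) = 0) →
    ∀ ψ ∈ testFunctions (finiteSet Φ₁),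
      c / 2 * ∫ x, ψ x ^ 2 * ∫ v, h (x, v) ^ 2 ∂(expMeasure Φ₂) ∂(expMeasure Φ₁) ≤
        K * ∑ i, ∫ x, pd i ψ x ^ 2 * ∫ v, h (x, v) ^ 2 ∂(expMeasure Φ₂) ∂(expMeasure Φ₁) := by
  obtain ⟨C, hC0, hC⟩ := h₂.exists_energy_estimate hc
  refine ⟨C, hC0, fun h M hh hM heq ψ hψ => ?_⟩
  have s₂ := h₂.finite
  set μ₂ := expMeasure Φ₂
  obtain ⟨D, hD⟩ := h₁.isPotential.exists_dens_le
  obtain ⟨δ, hδ, hδΩ⟩ := hψ.2.1.isCompact.exists_cthickening_subset_open h₁.isOpen hψ.2.2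
  set K := Metric.cthickening δ (tsupport ψ) with hKdef
  have hK : IsCompact K := IsCompact.cthickening hψ.2.1
  obtain ⟨W, hW0, hW⟩ := h₁.exists_inv_dens_le hK hδΩ
  -- The weight `e^{Φ₁}` compensates for the factor `e^{-Φ₁}` entering twice in the square of the
  -- slice: one factor is left, which is the density of `μ_{Φ₁}`.
  set w : Rd d → ℝ := K.indicator fun y => (dens Φ₁ y)⁻¹ with hw
  have hdm : Measurable (dens Φ₁) := h₁.isPotential.measurable_dens
  have hd0 : ∀ x, 0 ≤ dens Φ₁ x := dens_nonneg _
  have hw0 : ∀ y, 0 ≤ w y := fun y => Set.indicator_nonneg (fun y _ => inv_nonneg.2 (hd0 y)) y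
  have hwW : ∀ y, w y ≤ W := fun y => Set.indicator_le' hW (fun _ _ => hW0.le) y
  have hwL : MemLp w 2 := by
    rw [hw, memLp_indicator_iff_restrict hK.measurableSet]
    have : IsFiniteMeasure (volume.restrict K) := ⟨by simpa using hK.measure_lt_top⟩
    refine MemLp.of_bound hdm.inv.aestronglyMeasurable W ((ae_restrict_iff' hK.measurableSet).2
      (Eventually.of_forall fun y hy => ?_))
    rw [Real.norm_eq_abs, abs_of_nonneg (inv_nonneg.2 (hd0 y))]
    exact hW y hy
  have hwi : Integrable w := by
    rw [hw, integrable_indicator_iff hK.measurableSet]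
    have : IsFiniteMeasure (volume.restrict K) := ⟨by simpa using hK.measure_lt_top⟩
    exact ((memLp_indicator_iff_restrict hK.measurableSet).1 hwL).integrable one_le_two
  have hGL := fun i => h₁.memLp_indicator_grad hK hδΩ i
  -- A measurable version of `∇Φ₁` on `K`, square integrable on the whole space; its value at `y` is
  -- the frozen vector in the slice estimate.
  set g : Fin d → Rd d → ℝ := fun i => (hGL i).1.mk _ with hg
  have hgm : ∀ i, Measurable (g i) := fun i => (hGL i).1.stronglyMeasurable_mk.measurable
  have hgG : ∀ i, ∀ᵐ y, g i y = K.indicator (fun x => G₁ x i) y := fun i =>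
    (hGL i).1.ae_eq_mk.mono fun y hy => hy.symm
  have hgL : ∀ i, MemLp (g i) 2 := fun i => (memLp_congr_ae (hGL i).1.ae_eq_mk).1 (hGL i)
  have hgK : ∀ i, ∀ᵐ y, y ∈ K → g i y = G₁ y i := fun i => (hgG i).mono fun y hy hyK => by
    rw [hy, Set.indicator_of_mem hyK]
  have hψK : ∀ y, y ∉ K → ψ y = 0 := fun y hy =>
    image_eq_zero_of_notMem_tsupport fun hc => hy (Metric.self_subset_cthickening _ hc)
  set A : Rd d → ℝ := fun x => ψ x * dens Φ₁ x with hA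
  set B : Fin d → Rd d → ℝ := fun i x => pd i ψ x * dens Φ₁ x with hB
  have hbd : ∀ {θ : Rd d → ℝ}, θ ∈ testFunctions (finiteSet Φ₁) →
      ∃ N, ∀ x, |θ x * dens Φ₁ x| ≤ N := fun hθ => by
    obtain ⟨N, hN⟩ := testFunction_bounded hθ
    refine ⟨N * D, fun x => ?_⟩
    rw [abs_mul, abs_of_nonneg (hd0 x)]
    exact mul_le_mul (hN x) (hD x) (hd0 x) ((abs_nonneg _).trans (hN x))
  have hpdψ := fun i => pd_mem_testFunctions hψ i
  obtain ⟨N, hN⟩ := hbd hψ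
  choose P hP using fun i => hbd (hpdψ i)
  have hAm : Measurable A := hψ.1.continuous.measurable.mul hdm
  have hBm : ∀ i, Measurable (B i) := fun i => (hpdψ i).1.continuous.measurable.mul hdm
  have hAi : Integrable A := integrable_mul_dens h₁ hψ
  have hBi : ∀ i, Integrable (B i) := fun i => integrable_mul_dens h₁ (hpdψ i)
  have hAL : MemLp A 2 := by
    refine memLp_bdd_mul (testFunction_memLp hψ 2) hdm.aestronglyMeasurable (M := D) fun x => ?_
    rw [abs_of_nonneg (hd0 x)]
    exact hD x
  have hgA : ∀ i, Integrable fun x => g i x * A x := fun i => integrable_mul_of_memLp_two (hgL i) hAL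
  have hb : ∀ i, ∀ᵐ x, G₁ x i * (ψ x * dens Φ₁ x) = g i x * A x := fun i =>
    (hgK i).mono fun x hx => by
      by_cases hxK : x ∈ K
      · rw [hx hxK]
      · simp [hA, hψK x hxK]
  have hjm : ∀ n, Measurable (mollKernel n : Rd d → ℝ) := fun n => (continuous_mollKernel n).measurable
  have hjt : ∀ n, (mollKernel n : Rd d → ℝ) ∈ testFunctions (Set.univ : Set (Rd d)) := fun n =>
    ⟨contDiff_mollKernel n, hasCompactSupport_mollKernel n, Set.subset_univ _⟩
  have hjd := fun n i => pd_mem_testFunctions (hjt n) i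
  -- the energy estimate on each slice
  have hslice : ∀ n y, c / 2 * ∫ v, sliceConv (mollKernel n) A h y v ^ 2 ∂μ₂ +
      ∑ i, ∫ v, sliceConv (pd i (mollKernel n)) A h y v *
        (G₂ v i * sliceConv (mollKernel n) A h y v) ∂μ₂ +
      1 / 2 * ∑ i, g i y * ∫ v, sliceConv (mollKernel n) A h y v *
        (G₂ v i * sliceConv (mollKernel n) A h y v) ∂μ₂ ≤
      1 / 2 * ∑ i, ∫ v, (sliceConv (mollKernel n) (fun x => g i x * A x) h y v -
        g i y * sliceConv (mollKernel n) A h y v) ^ 2 ∂μ₂ +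
      C * ∑ i, ∫ v, sliceConv (mollKernel n) (B i) h y v ^ 2 ∂μ₂ := by
    intro n y
    have hsl : ∀ {k E : Rd d → ℝ}, Measurable k → Measurable E →
        Measurable fun v => sliceConv k E h y v := fun hk hE =>
      (measurable_sliceConv hk hE hh).comp (measurable_const.prodMk measurable_id)
    refine hC (fun v => sliceConv (mollKernel n) A h y v)
      (fun i v => sliceConv (mollKernel n) (B i) h y v)
      (fun i v => sliceConv (pd i (mollKernel n)) A h y v)
      (fun i v => sliceConv (mollKernel n) (fun x => g i x * A x) h y v) (fun i => g i y)
      (hsl (hjm n) hAm) (fun i => hsl (hjm n) (hBm i))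
      (fun i => hsl (hjd n i).1.continuous.measurable hAm)
      (fun i => hsl (hjm n) ((hgm i).mul hAm))
      ⟨_, fun v => abs_sliceConv_mollKernel_le n hN hM y v⟩
      (fun i => ⟨_, fun v => abs_sliceConv_mollKernel_le n (hP i) hM y v⟩)
      (fun i => ?_) (fun i => ?_) fun φ => ?_
    · obtain ⟨N', hN'⟩ := testFunction_bounded (hjd n i)
      exact ⟨_, fun v => abs_sliceConv_le hN' hAi hM y v⟩
    · obtain ⟨N', hN'⟩ := testFunction_bounded (hjt n)
      exact ⟨_, fun v => abs_sliceConv_le hN' (hgA i) hM y v⟩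
    · exact sliceConv_weak_equation h₁ h₂ hh hM heq hψ hb n y φ
  have hGi : ∀ i, Integrable (fun v => G₂ v i) μ₂ := fun i =>
    (MemLp.coord h₂.gradient_memLp i).integrable one_le_two
  have hUm : ∀ n, Measurable fun z : Rd d × Rd d => sliceConv (mollKernel n) A h z.1 z.2 := fun n =>
    measurable_sliceConv (hjm n) hAm hh
  have hsq : ∀ {t a : ℝ}, |t| ≤ a → |t ^ 2| ≤ a ^ 2 := fun ht => by
    rw [abs_pow]
    exact pow_le_pow_left₀ (abs_nonneg _) ht 2
  have hUb : ∀ n (z : Rd d × Rd d), |sliceConv (mollKernel n) A h z.1 z.2| ≤ N * M := fun n z =>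
    abs_sliceConv_mollKernel_le n hN hM _ _
  have one_int : Integrable (fun _ : Rd d => (1 : ℝ)) μ₂ := integrable_const _
  have hwg : ∀ i, Integrable fun y => w y * g i y := fun i => integrable_mul_of_memLp_two hwL (hgL i)
  -- The averaged translation error tends to zero, hence is finite for large `n`; finiteness is
  -- needed to pass to real-valued integrals.
  have hτfin : ∀ i, ∀ᶠ n in atTop, ∫⁻ y, translationError n (g i) y ≠ ⊤ := fun i => by
    have := tendsto_lintegral_translate one_le_two ENNReal.ofNat_ne_top (hgL i)
    filter_upwards [this.eventually_lt_const ENNReal.zero_lt_top] with n hn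
    exact hn.ne
  have hfin : ∀ᶠ n in atTop, ∀ i, ∫⁻ y, translationError n (g i) y ≠ ⊤ := eventually_all.2 hτfin
  -- the weighted inequality, integrated in the position variable
  have hint : ∀ᶠ n in atTop, c / 2 * ∫ y, w y * ∫ v, sliceConv (mollKernel n) A h y v ^ 2 ∂μ₂ ≤
      1 / 2 * (W * μ₂.real Set.univ * (N * M) ^ 2) * ∑ i, (∫⁻ y, translationError n (g i) y).toReal +
        C * ∑ i, ∫ y, w y * ∫ v, sliceConv (mollKernel n) (B i) h y v ^ 2 ∂μ₂ := by
    filter_upwards [hfin, tendsto_mollRadius_le hδ] with n hn hnδ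
    set u : Rd d → Rd d → ℝ := fun y v => sliceConv (mollKernel n) A h y v with hu
    set R : Fin d → Rd d → Rd d → ℝ := fun i y v => sliceConv (pd i (mollKernel n)) A h y v with hR
    have hRm : ∀ i, Measurable fun z : Rd d × Rd d => R i z.1 z.2 := fun i =>
      measurable_sliceConv (hjd n i).1.continuous.measurable hAm hh
    have hQm : ∀ i, Measurable fun z : Rd d × Rd d => sliceConv (mollKernel n) (B i) h z.1 z.2 :=
      fun i => measurable_sliceConv (hjm n) (hBm i) hh
    choose J hJ using fun i => testFunction_bounded (hjd n i)
    have huRb : ∀ i (z : Rd d × Rd d), |u z.1 z.2 * R i z.1 z.2| ≤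
        N * M * (J i * M * ∫ x, |A x|) := fun i z => by
      rw [abs_mul]
      exact mul_le_mul (hUb n z) (abs_sliceConv_le (hJ i) hAi hM _ _) (abs_nonneg _)
        ((abs_nonneg _).trans (hUb n z))
    have iF0 : Integrable fun y => w y * ∫ v, u y v ^ 2 ∂μ₂ := by
      simpa using integrable_mul_integral ((hUm n).pow_const 2) (fun z => hsq (hUb n z)) hwi one_int
    have iF1 : ∀ i, Integrable fun y => w y * ∫ v, u y v * R i y v * G₂ v i ∂μ₂ := fun i =>
      integrable_mul_integral ((hUm n).mul (hRm i)) (huRb i) hwi (hGi i)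
    have iF2 : ∀ i, Integrable fun y => w y * g i y * ∫ v, u y v ^ 2 * G₂ v i ∂μ₂ := fun i =>
      integrable_mul_integral ((hUm n).pow_const 2) (fun z => hsq (hUb n z)) (hwg i) (hGi i)
    have iF3 : ∀ i, Integrable fun y => (translationError n (g i) y).toReal := fun i =>
      integrable_toReal_of_lintegral_ne_top (measurable_translationError n (hgm i)).aemeasurable (hn i)
    have iF4 : ∀ i, Integrable fun y => w y * ∫ v, sliceConv (mollKernel n) (B i) h y v ^ 2 ∂μ₂ :=
      fun i => by
        simpa using integrable_mul_integral ((hQm i).pow_const 2)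
          (fun z => hsq (abs_sliceConv_mollKernel_le n (hP i) hM _ _)) hwi one_int
    -- Integration by parts in the position variable against `e^{Φ₁}`: the term with `∂ᵢu` becomes
    -- minus one half of the term with `∂ᵢΦ₁ u²`, exactly the other term of indefinite sign.
    have hcancel : ∀ i, ∫ y, w y * ∫ v, u y v * R i y v * G₂ v i ∂μ₂ =
        -(1 / 2 * ∫ y, w y * g i y * ∫ v, u y v ^ 2 * G₂ v i ∂μ₂) := fun i => by
      have hm : Measurable fun z : Rd d × Rd d => u z.1 z.2 * R i z.1 z.2 := (hUm n).mul (hRm i)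
      have e1 := integral_mul_integral_swap hm (huRb i) hwi (hGi i)
      have e2 := integral_mul_integral_swap ((hUm n).pow_const 2) (fun z => hsq (hUb n z))
        (hwg i) (hGi i)
      refine e1.trans ((congrArg (fun t => -(1 / 2 * t)) e2).trans ?_).symm
      rw [← integral_const_mul, ← integral_neg]
      refine integral_congr_ae (Eventually.of_forall fun v => ?_)
      have := integral_sliceConv_mul_pd_add h₁ hψ hh hM hδΩ subset_rfl hnδ (hgK i) v
      simp only [hu, hR] at this ⊢
      rw [this]
      ring
    have hae : ∀ᵐ y, c / 2 * (w y * ∫ v, u y v ^ 2 ∂μ₂) +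
        (∑ i, w y * ∫ v, u y v * R i y v * G₂ v i ∂μ₂ +
        1 / 2 * ∑ i, w y * g i y * ∫ v, u y v ^ 2 * G₂ v i ∂μ₂) ≤
        1 / 2 * (W * μ₂.real Set.univ * (N * M) ^ 2) * ∑ i, (translationError n (g i) y).toReal +
        C * ∑ i, w y * ∫ v, sliceConv (mollKernel n) (B i) h y v ^ 2 ∂μ₂ := by
      have hτ : ∀ᵐ y, ∀ i, translationError n (g i) y < ⊤ := ae_all_iff.2 fun i =>
        ae_lt_top (measurable_translationError n (hgm i)) (hn i)
      filter_upwards [hτ] with y hy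
      have h1 := mul_le_mul_of_nonneg_left (hslice n y) (hw0 y)
      have h2 : ∀ i, w y * ∫ v, (sliceConv (mollKernel n) (fun x => g i x * A x) h y v -
          g i y * sliceConv (mollKernel n) A h y v) ^ 2 ∂μ₂ ≤
          W * μ₂.real Set.univ * (N * M) ^ 2 * (translationError n (g i) y).toReal := fun i => by
        have h3 : ∫ v, (sliceConv (mollKernel n) (fun x => g i x * A x) h y v -
            g i y * sliceConv (mollKernel n) A h y v) ^ 2 ∂μ₂ ≤
            ∫ _v, (N * M) ^ 2 * (translationError n (g i) y).toReal ∂μ₂ :=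
          integral_mono_of_nonneg (Eventually.of_forall fun v => sq_nonneg _) (integrable_const _)
            (Eventually.of_forall fun v => sq_sliceConv_commutator_le (hgm i) hN hAi (hgA i) hh hM n
              y v (hy i).ne)
        rw [integral_const, smul_eq_mul] at h3
        calc _ ≤ W * (μ₂.real Set.univ * ((N * M) ^ 2 * (translationError n (g i) y).toReal)) :=
              mul_le_mul (hwW y) h3 (integral_nonneg fun v => sq_nonneg _) hW0.le
          _ = _ := by ring
      have h3 := Finset.sum_le_sum fun i (_ : i ∈ Finset.univ) => h2 i
      rw [← Finset.mul_sum, ← Finset.mul_sum] at h3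
      have r1 : ∑ i, w y * ∫ v, u y v * R i y v * G₂ v i ∂μ₂ =
          w y * ∑ i, ∫ v, R i y v * (G₂ v i * u y v) ∂μ₂ := by
        rw [Finset.mul_sum]
        refine Finset.sum_congr rfl fun i _ => ?_
        congr 1
        exact integral_congr_ae (Eventually.of_forall fun v => by simp only; ring)
      have r2 : ∑ i, w y * g i y * ∫ v, u y v ^ 2 * G₂ v i ∂μ₂ =
          w y * ∑ i, g i y * ∫ v, u y v * (G₂ v i * u y v) ∂μ₂ := by
        rw [Finset.mul_sum]
        refine Finset.sum_congr rfl fun i _ => ?_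
        rw [mul_assoc]
        congr 2
        exact integral_congr_ae (Eventually.of_forall fun v => by simp only; ring)
      rw [r1, r2, ← Finset.mul_sum]
      simp only [hu, hR] at h1 ⊢
      linarith
    have iL : Integrable fun y => ∑ i, w y * ∫ v, u y v * R i y v * G₂ v i ∂μ₂ :=
      integrable_finsetSum _ fun i _ => iF1 i
    have iL' : Integrable fun y => 1 / 2 * ∑ i, w y * g i y * ∫ v, u y v ^ 2 * G₂ v i ∂μ₂ :=
      (integrable_finsetSum _ fun i _ => iF2 i).const_mul _
    have iR : Integrable fun y => 1 / 2 * (W * μ₂.real Set.univ * (N * M) ^ 2) *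
        ∑ i, (translationError n (g i) y).toReal := (integrable_finsetSum _ fun i _ => iF3 i).const_mul _
    have iR' : Integrable fun y => C * ∑ i, w y * ∫ v, sliceConv (mollKernel n) (B i) h y v ^ 2 ∂μ₂ :=
      (integrable_finsetSum _ fun i _ => iF4 i).const_mul _
    have iLL : Integrable fun y => ∑ i, w y * ∫ v, u y v * R i y v * G₂ v i ∂μ₂ +
        1 / 2 * ∑ i, w y * g i y * ∫ v, u y v ^ 2 * G₂ v i ∂μ₂ := iL.add iL'
    have hfinal := integral_mono_ae ((iF0.const_mul (c / 2)).add iLL) (iR.add iR') hae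
    simp only [Pi.add_apply] at hfinal
    rw [integral_add (iF0.const_mul (c / 2)) iLL, integral_add iL iL', integral_add iR iR',
      integral_const_mul, integral_const_mul, integral_const_mul, integral_const_mul,
      integral_finsetSum _ fun i _ => iF1 i, integral_finsetSum _ fun i _ => iF2 i,
      integral_finsetSum _ fun i _ => iF3 i, integral_finsetSum _ fun i _ => iF4 i,
      Finset.sum_congr rfl fun i _ => hcancel i, Finset.sum_neg_distrib, ← Finset.mul_sum,
      neg_add_cancel, add_zero] at hfinal
    have e3 : ∀ i, ∫ y, (translationError n (g i) y).toReal =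
        (∫⁻ y, translationError n (g i) y).toReal := fun i =>
      integral_toReal (measurable_translationError n (hgm i)).aemeasurable
        (ae_lt_top (measurable_translationError n (hgm i)) (hn i))
    simp only [e3] at hfinal
    exact hfinal
  have hlim1 := (tendsto_integral_sq_sliceConv (Y := μ₂) hwi hAi hAm hN hh hM).const_mul (c / 2)
  -- The commutator contribution is a fixed constant times the translation error of `∇Φ₁` in `L²`
  -- and disappears; only the terms with `∇ψ` survive.
  have hlim2 : Tendsto (fun n => 1 / 2 * (W * μ₂.real Set.univ * (N * M) ^ 2) *
      ∑ i, (∫⁻ y, translationError n (g i) y).toReal +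
        C * ∑ i, ∫ y, w y * ∫ v, sliceConv (mollKernel n) (B i) h y v ^ 2 ∂μ₂) atTop
      (𝓝 (1 / 2 * (W * μ₂.real Set.univ * (N * M) ^ 2) * ∑ i : Fin d, (0 : ℝ) +
        C * ∑ i, ∫ y, w y * ∫ v, (B i y * h (y, v)) ^ 2 ∂μ₂)) := by
    refine ((tendsto_finsetSum _ fun i _ => ?_).const_mul _).add
      ((tendsto_finsetSum _ fun i _ =>
        tendsto_integral_sq_sliceConv hwi (hBi i) (hBm i) (hP i) hh hM).const_mul _)
    have := tendsto_lintegral_translate one_le_two ENNReal.ofNat_ne_top (hgL i)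
    simpa [translationError, Function.comp_def] using (ENNReal.tendsto_toReal ENNReal.zero_ne_top).comp this
  have hle := le_of_tendsto_of_tendsto hlim1 hlim2 hint
  -- The weight and the two factors `e^{-Φ₁}` combine to the density of `μ_{Φ₁}`.
  have hpt : ∀ {θ : Rd d → ℝ}, (∀ y, y ∉ K → θ y = 0) →
      ∫ y, w y * ∫ v, (θ y * dens Φ₁ y * h (y, v)) ^ 2 ∂μ₂ =
        ∫ x, θ x ^ 2 * ∫ v, h (x, v) ^ 2 ∂μ₂ ∂(expMeasure Φ₁) := fun {θ} hθ => by
    rw [h₁.isPotential.integral_expMeasure]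
    refine integral_congr_ae (Eventually.of_forall fun y => ?_)
    simp only [mul_pow, integral_const_mul]
    by_cases hy : y ∈ K
    · have := h₁.dens_pos (hδΩ hy)
      simp only [hw, Set.indicator_of_mem hy]
      field_simp
    · rw [hθ y hy]
      ring
  have hpdK : ∀ i y, y ∉ K → pd i ψ y = 0 := fun i y hy =>
    image_eq_zero_of_notMem_tsupport fun hc => hy (Metric.self_subset_cthickening _
      (tsupport_fderiv_apply_subset ψ _ hc))
  rw [hpt hψK, Finset.sum_congr rfl fun i _ => hpt (hpdK i)] at hle
  simpa using hle

end Caccioppoli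

/-! ### Extending quadratic inequalities to compactly supported weakly differentiable functions -/

section WeakPartialCompact

variable {d : ℕ} {Ω K : Set (Rd d)}

lemma exists_cutoff (hΩ : IsOpen Ω) (hK : IsCompact K) (hKΩ : K ⊆ Ω) :
    ∃ η ∈ testFunctions Ω, ∀ x ∈ K, η =ᶠ[𝓝 x] fun _ => 1 := by
  obtain ⟨δ, hδ, hδΩ⟩ := hK.exists_cthickening_subset_open hΩ hKΩ
  obtain ⟨η, hη, -, hsupp, hone⟩ := exists_contMDiff_support_eq_eq_one_iff (n := ⊤)
    (modelWithCornersSelf ℝ (Rd d)) (Metric.isOpen_thickening (δ := δ) (E := K))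
    (Metric.isClosed_cthickening (δ := δ / 2) (E := K))
    (Metric.cthickening_subset_thickening' hδ (half_lt_self hδ) K)
  have hts : tsupport η ⊆ Metric.cthickening δ K := by
    rw [tsupport, hsupp]
    exact Metric.closure_thickening_subset_cthickening δ K
  refine ⟨η, ⟨hη.contDiff, hK.cthickening.of_isClosed_subset (isClosed_tsupport η) hts,
    hts.trans hδΩ⟩, fun x hx => ?_⟩
  filter_upwards [Metric.isOpen_thickening.mem_nhds (Metric.self_subset_thickening (half_pos hδ) K hx)]
    with y hy
  exact (hone y).1 (Metric.thickening_subset_cthickening _ K hy)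

/-- Multiplying the kernel by a cutoff equal to one near `K` makes it admissible in the weak
formulation without changing any integral. Extension by zero is therefore weakly differentiable on
`ℝ^d`, and the identity holds at every point. -/
lemma IsWeakPartial.pd_mollify (hΩ : IsOpen Ω) (hK : IsCompact K) (hKΩ : K ⊆ Ω) {i : Fin d}
    {u w : Rd d → ℝ} (h : IsWeakPartial Ω i u w) (hu0 : ∀ x, x ∉ K → u x = 0)
    (hw0 : ∀ x, x ∉ K → w x = 0) (hu : LocallyIntegrable u) (n : ℕ) (x : Rd d) :
    pd i (mollify n u) x = mollify n w x := by
  obtain ⟨η, hη, hη1⟩ := exists_cutoff hΩ hK hKΩ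
  have hj : ContDiff ℝ ∞ fun y => mollKernel n (x - y) :=
    (contDiff_mollKernel n).comp (contDiff_const.sub contDiff_id)
  have hmain := h.integral_eq (mul_mem_testFunctions hη hj)
  rw [pd, fderiv_mollify n hu, mollify_apply, ← neg_neg (∫ y, mollKernel n (x - y) * w y)]
  have e1 : ∫ y, mollKernel n (x - y) * w y = ∫ y, w y * (mollKernel n (x - y) * η y) := by
    refine integral_congr_ae (Eventually.of_forall fun y => ?_)
    simp only
    by_cases hy : y ∈ K
    · rw [(hη1 y hy).self_of_nhds]
      ring
    · rw [hw0 y hy]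
      ring
  rw [e1, ← hmain, ← integral_neg]
  refine integral_congr_ae (Eventually.of_forall fun y => ?_)
  simp only
  by_cases hy : y ∈ K
  · have e2 := pd_mul i (hj.differentiable (by simp) y) (hη.1.differentiable (by simp) y)
    have e3 : pd i η y = 0 := by
      rw [pd, (hη1 y hy).fderiv_eq]
      simp
    have e4 : pd i (fun y => mollKernel n (x - y)) y =
        -fderiv ℝ (mollKernel n) (x - y) (EuclideanSpace.single i 1) := fderiv_mollKernel_sub n x y _
    have e5 : fderiv ℝ (fun y => mollKernel n (x - y) * η y) y (EuclideanSpace.single i 1) =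
        -fderiv ℝ (mollKernel n) (x - y) (EuclideanSpace.single i 1) := by
      rw [← pd, e2, e3, e4, (hη1 y hy).self_of_nhds]
      ring
    rw [e5]
    ring
  · rw [hu0 y hy]
    ring

lemma mollify_mem_testFunctions {δ : ℝ} (hK : IsCompact K) (hδΩ : Metric.cthickening δ K ⊆ Ω)
    {u : Rd d → ℝ} (hu0 : ∀ x, x ∉ K → u x = 0) (hu : LocallyIntegrable u) {n : ℕ}
    (hn : 1 / ((n : ℝ) + 1) ≤ δ) : mollify n u ∈ testFunctions Ω := by
  have hsub : tsupport (mollify n u) ⊆ Metric.cthickening δ K := by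
    refine closure_minimal (fun y hy => ?_) Metric.isClosed_cthickening
    by_contra hc
    refine hy ?_
    rw [mollify_apply]
    refine integral_eq_zero_of_ae (Eventually.of_forall fun x => ?_)
    by_cases hx : x ∈ K
    · have : 1 / ((n : ℝ) + 1) < ‖y - x‖ := by
        by_contra! hlt
        exact hc (Metric.mem_cthickening_of_dist_le y x δ _ hx
          ((dist_eq_norm y x).trans_le (hlt.trans hn)))
      simp [mollKernel_eq_zero this]
    · simp [hu0 x hx]
  exact ⟨contDiff_mollify n hu, HasCompactSupport.of_support_subset_isCompact hK.cthickening
    (subset_closure.trans hsub), hsub.trans hδΩ⟩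

/-- Convergence in Lebesgue `L²` passes to `ν`, whose density is bounded, and norms of convergent
sequences converge. -/
lemma tendsto_integral_sq_mollify {ν : Measure (Rd d)} {C : ℝ≥0∞} (hC : C ≠ ⊤)
    (hν : ν ≤ C • volume) {f : Rd d → ℝ} (hf : MemLp f 2) :
    Tendsto (fun n => ∫ x, mollify n f x ^ 2 ∂ν) atTop (𝓝 (∫ x, f x ^ 2 ∂ν)) := by
  have h1 := tendsto_eLpNorm_mollify_sub one_le_two ENNReal.ofNat_ne_top hf
  have hfl : LocallyIntegrable f := hf.locallyIntegrable one_le_two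
  have hac : ν ≪ volume := (Measure.absolutelyContinuous_of_le hν).trans
    (Measure.smul_absolutelyContinuous)
  have hfν : MemLp f 2 ν := hf.of_measure_le_smul hC hν
  have h2 : Tendsto (fun n => eLpNorm (mollify n f - f) 2 ν) atTop (𝓝 0) := by
    have h3 : Tendsto (fun n => C ^ (1 / (2 : ℝ≥0∞).toReal) * eLpNorm (mollify n f - f) 2 volume)
        atTop (𝓝 0) := by
      have := ENNReal.Tendsto.const_mul h1 (Or.inr (ENNReal.rpow_ne_top_of_nonneg (by positivity) hC :
        C ^ (1 / (2 : ℝ≥0∞).toReal) ≠ ⊤))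
      simpa using this
    refine tendsto_of_tendsto_of_tendsto_of_le_of_le tendsto_const_nhds h3 (fun _ => zero_le)
      fun n => ?_
    refine (eLpNorm_mono_measure _ hν).trans ?_
    rw [eLpNorm_smul_measure_of_ne_top ENNReal.ofNat_ne_top]
    simp
  have hev : ∀ᶠ n in atTop, MemLp (mollify n f) 2 ν := by
    filter_upwards [h2.eventually_lt_const ENNReal.zero_lt_top] with n hn
    have hm : AEStronglyMeasurable (mollify n f) ν :=
      (contDiff_mollify n hfl).continuous.aestronglyMeasurable
    have : MemLp (mollify n f - f) 2 ν := ⟨hm.sub hfν.1, hn⟩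
    simpa using this.add hfν
  have h4 : Tendsto (fun n => (eLpNorm (mollify n f) 2 ν).toReal) atTop
      (𝓝 (eLpNorm f 2 ν).toReal) := by
    rw [tendsto_iff_dist_tendsto_zero]
    have h5 : Tendsto (fun n => (eLpNorm (mollify n f - f) 2 ν).toReal) atTop (𝓝 0) := by
      simpa [Function.comp_def] using (ENNReal.tendsto_toReal ENNReal.zero_ne_top).comp h2
    refine tendsto_of_tendsto_of_tendsto_of_le_of_le' tendsto_const_nhds h5
      (Eventually.of_forall fun _ => dist_nonneg) ?_
    filter_upwards [hev] with n hn
    rw [Real.dist_eq, ← Lp.norm_toLp _ hn, ← Lp.norm_toLp _ hfν, ← Lp.norm_toLp _ (hn.sub hfν),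
      MemLp.toLp_sub]
    exact abs_norm_sub_norm_le _ _
  have h6 : ∀ {k : Rd d → ℝ}, MemLp k 2 ν → (eLpNorm k 2 ν).toReal ^ 2 = ∫ x, k x ^ 2 ∂ν := fun hk => by
    rw [← Lp.norm_toLp _ hk, norm_toLp_sq]
  rw [← h6 hfν]
  exact (h4.pow 2).congr' (hev.mono fun n hn => h6 hn)

/-- An inequality between Dirichlet-type forms extends from test functions to compactly supported
weakly differentiable functions. -/
lemma integral_sq_le_of_isWeakPartial {ν : Measure (Rd d)} {C : ℝ≥0∞} (hC : C ≠ ⊤)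
    (hν : ν ≤ C • volume) {a b : ℝ} (hΩ : IsOpen Ω)
    (hab : ∀ ψ ∈ testFunctions Ω, a * ∫ x, ψ x ^ 2 ∂ν ≤ b * ∑ i, ∫ x, pd i ψ x ^ 2 ∂ν)
    (hK : IsCompact K) (hKΩ : K ⊆ Ω) {u : Rd d → ℝ} {w : Fin d → Rd d → ℝ}
    (huw : ∀ i, IsWeakPartial Ω i u (w i)) (hu0 : ∀ x, x ∉ K → u x = 0)
    (hw0 : ∀ i, ∀ x, x ∉ K → w i x = 0) (hu : MemLp u 2) (hw : ∀ i, MemLp (w i) 2) :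
    a * ∫ x, u x ^ 2 ∂ν ≤ b * ∑ i, ∫ x, w i x ^ 2 ∂ν := by
  obtain ⟨δ, hδ, hδΩ⟩ := hK.exists_cthickening_subset_open hΩ hKΩ
  have hul := hu.locallyIntegrable one_le_two
  refine le_of_tendsto_of_tendsto ((tendsto_integral_sq_mollify hC hν hu).const_mul a)
    ((tendsto_finsetSum _ fun i _ => tendsto_integral_sq_mollify hC hν (hw i)).const_mul b) ?_
  filter_upwards [tendsto_mollRadius_le hδ] with n hn
  have := hab _ (mollify_mem_testFunctions hK hδΩ hu0 hul hn)
  simpa only [(huw _).pd_mollify hΩ hK hKΩ hu0 (hw0 _) hul n] using this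

end WeakPartialCompact

/-! ### A Liouville argument by iterated scaling -/

section Liouville

variable {d : ℕ}

/-- A measure with bounded density that satisfies a Caccioppoli inequality on the whole space
vanishes. -/
lemma eq_zero_of_caccioppoli {ν : Measure (Rd d)} {C : ℝ≥0∞} (hC : C ≠ ⊤) (hν : ν ≤ C • volume)
    {a b : ℝ} (ha : 0 < a) (hb : 0 ≤ b) (hab : ∀ χ ∈ testFunctions (Set.univ : Set (Rd d)),
      a * ∫ x, χ x ^ 2 ∂ν ≤ b * ∑ i, ∫ x, pd i χ x ^ 2 ∂ν) : ν = 0 := by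
  set V : ℝ → ℝ := fun R => ν.real (Metric.closedBall 0 R) with hV
  have hfin : ∀ R, ν (Metric.closedBall 0 R) ≠ ⊤ := fun R => by
    refine ((hν _).trans_lt ?_).ne
    rw [Measure.smul_apply, smul_eq_mul]
    exact ENNReal.mul_lt_top hC.lt_top (isCompact_closedBall _ _).measure_lt_top
  have hV0 : ∀ R, 0 ≤ V R := fun R => measureReal_nonneg
  have hVmono : ∀ {r R}, r ≤ R → V r ≤ V R := fun hr =>
    measureReal_mono (Metric.closedBall_subset_closedBall hr) (hfin _)
  -- A priori growth: the bounded density gives at most Euclidean volume growth.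
  obtain ⟨D, hD⟩ : ∃ D, ∀ R, 0 ≤ R → V R ≤ D * R ^ d := by
    refine ⟨(C * volume (Metric.ball (0 : Rd d) 1)).toReal, fun R hR => ?_⟩
    have h1 := hν (Metric.closedBall 0 R)
    rw [Measure.smul_apply, smul_eq_mul, Measure.addHaar_closedBall volume _ hR] at h1
    have h2 := ENNReal.toReal_mono (ENNReal.mul_ne_top hC (ENNReal.mul_ne_top
      ENNReal.ofReal_ne_top measure_ball_lt_top.ne)) h1
    rw [ENNReal.toReal_mul, ENNReal.toReal_mul, ENNReal.toReal_ofReal (by positivity)] at h2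
    rw [ENNReal.toReal_mul]
    simp only [finrank_euclideanSpace, Fintype.card_fin] at h2
    calc V R ≤ _ := h2
      _ = _ := by ring
  -- Test with a bump that is one on `B_R` and supported in `B_{2R}`; its gradient is of order
  -- `1/R`.
  obtain ⟨κ, hκ0, hκ⟩ : ∃ κ, 0 ≤ κ ∧ ∀ R, 0 < R → V R * R ^ 2 ≤ κ * V (2 * R) := by
    let β : ContDiffBump (0 : Rd d) := ⟨1, 2, one_pos, one_lt_two⟩
    have hβ : (β : Rd d → ℝ) ∈ testFunctions Set.univ := ⟨β.contDiff, β.hasCompactSupport, Set.subset_univ _⟩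
    choose L hL using fun i => testFunction_bounded (pd_mem_testFunctions hβ i)
    refine ⟨b / a * ∑ i, L i ^ 2, mul_nonneg (div_nonneg hb ha.le)
      (Finset.sum_nonneg fun i _ => sq_nonneg _), fun R hR => ?_⟩
    have hs : ContDiff ℝ ∞ fun x : Rd d => β (R⁻¹ • x) := β.contDiff.comp (contDiff_const_smul _)
    have hts : ∀ x, 2 * R < ‖x‖ → β (R⁻¹ • x) = 0 := fun x hx => β.zero_of_le_dist (by
      rw [dist_zero_right, norm_smul, norm_inv, Real.norm_of_nonneg hR.le, le_inv_mul_iff₀ hR]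
      change R * 2 ≤ _
      linarith)
    have hsub : tsupport (fun x : Rd d => β (R⁻¹ • x)) ⊆ Metric.closedBall 0 (2 * R) := by
      refine closure_minimal (fun x hx => ?_) Metric.isClosed_closedBall
      by_contra hc
      rw [mem_closedBall_zero_iff, not_le] at hc
      exact hx (hts x hc)
    have hmem : (fun x : Rd d => β (R⁻¹ • x)) ∈ testFunctions Set.univ :=
      ⟨hs, HasCompactSupport.of_support_subset_isCompact (isCompact_closedBall _ _)
        (subset_closure.trans hsub), Set.subset_univ _⟩
    have hpd : ∀ i x, pd i (fun x : Rd d => β (R⁻¹ • x)) x = R⁻¹ * pd i β (R⁻¹ • x) := fun i x => by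
      rw [pd, fderiv_comp_smul]
      rfl
    have hint : ∀ r, Integrable ((Metric.closedBall (0 : Rd d) r).indicator fun _ => (1 : ℝ)) ν := fun r =>
      (integrable_indicator_iff Metric.isClosed_closedBall.measurableSet).2
        (integrableOn_const (hfin r))
    have hVi : ∀ r, ∫ x, (Metric.closedBall (0 : Rd d) r).indicator (fun _ => (1 : ℝ)) x ∂ν = V r :=
      fun r => by
        rw [integral_indicator Metric.isClosed_closedBall.measurableSet]
        simp [hV]
    have h1 : V R ≤ ∫ x, β (R⁻¹ • x) ^ 2 ∂ν := by
      rw [← hVi R]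
      refine integral_mono_of_nonneg (Eventually.of_forall fun x => Set.indicator_nonneg
        (fun _ _ => zero_le_one) x) ((hint (2 * R)).mono' (by
          exact (hs.continuous.pow 2).aestronglyMeasurable) (Eventually.of_forall fun x => ?_))
          (Eventually.of_forall fun x => ?_)
      · by_cases hx : x ∈ Metric.closedBall 0 (2 * R)
        · rw [Set.indicator_of_mem hx, Real.norm_eq_abs, abs_of_nonneg (sq_nonneg _)]
          exact pow_le_one₀ β.nonneg β.le_one
        · rw [mem_closedBall_zero_iff, not_le] at hx
          simp only [hts x hx]
          simpa using Set.indicator_nonneg (fun _ _ => zero_le_one) x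
      · by_cases hx : x ∈ Metric.closedBall 0 R
        · have : β (R⁻¹ • x) = 1 := β.one_of_mem_closedBall (by
            rw [mem_closedBall_zero_iff] at hx ⊢
            rw [norm_smul, norm_inv, Real.norm_of_nonneg hR.le, inv_mul_le_iff₀ hR]
            change _ ≤ R * 1
            linarith)
          simp [Set.indicator_of_mem hx, this]
        · rw [Set.indicator_of_notMem hx]
          exact sq_nonneg _
    have h2 : ∀ i, ∫ x, pd i (fun x : Rd d => β (R⁻¹ • x)) x ^ 2 ∂ν ≤ (R⁻¹ * L i) ^ 2 * V (2 * R) := by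
      intro i
      rw [← hVi (2 * R), ← integral_const_mul]
      refine integral_mono_of_nonneg (Eventually.of_forall fun x => sq_nonneg _)
        ((hint _).const_mul _) (Eventually.of_forall fun x => ?_)
      by_cases hx : x ∈ Metric.closedBall 0 (2 * R)
      · simp only [Set.indicator_of_mem hx, mul_one, hpd]
        rw [sq_le_sq, abs_mul, abs_mul]
        exact mul_le_mul_of_nonneg_left ((hL i _).trans (le_abs_self _)) (abs_nonneg _)
      · have : pd i (fun x : Rd d => β (R⁻¹ • x)) x = 0 :=
          image_eq_zero_of_notMem_tsupport fun hc => hx (hsub (tsupport_fderiv_apply_subset _ _ hc))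
        simp [Set.indicator_of_notMem hx, this]
    have h3 := hab _ hmem
    have h4 := Finset.sum_le_sum fun i (_ : i ∈ Finset.univ) => h2 i
    have h5 : a * V R ≤ b * ∑ i, (R⁻¹ * L i) ^ 2 * V (2 * R) :=
      (mul_le_mul_of_nonneg_left h1 ha.le).trans (h3.trans (mul_le_mul_of_nonneg_left h4 hb))
    have h6 : ∑ i, (R⁻¹ * L i) ^ 2 * V (2 * R) = (∑ i, L i ^ 2) * V (2 * R) * (R⁻¹) ^ 2 := by
      rw [Finset.sum_mul, Finset.sum_mul]
      exact Finset.sum_congr rfl fun i _ => by ring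
    rw [h6] at h5
    have h7 : a * (V R * R ^ 2) ≤ b * ((∑ i, L i ^ 2) * V (2 * R)) := by
      have := mul_le_mul_of_nonneg_right h5 (sq_nonneg R)
      calc a * (V R * R ^ 2) = a * V R * R ^ 2 := by ring
        _ ≤ _ := this
        _ = _ := by field_simp
    calc V R * R ^ 2 = a⁻¹ * (a * (V R * R ^ 2)) := by field_simp
      _ ≤ a⁻¹ * (b * ((∑ i, L i ^ 2) * V (2 * R))) :=
        mul_le_mul_of_nonneg_left h7 (inv_nonneg.2 ha.le)
      _ = _ := by ring
  -- Each use of the scaling inequality gains two powers of `R` and doubles the radius, which costs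
  -- only a constant.
  have hdecay : ∀ k : ℕ, ∃ E, ∀ R, 0 < R → V R * R ^ (2 * k) ≤ E * R ^ d := fun k => by
    induction k with
    | zero => exact ⟨D, fun R hR => by simpa using hD R hR.le⟩
    | succ k ih =>
      obtain ⟨E, hE⟩ := ih
      refine ⟨κ * E * 2 ^ d, fun R hR => ?_⟩
      calc V R * R ^ (2 * (k + 1)) = V R * R ^ 2 * R ^ (2 * k) := by ring
        _ ≤ κ * V (2 * R) * R ^ (2 * k) := by
          exact mul_le_mul_of_nonneg_right (hκ R hR) (by positivity)
        _ ≤ κ * V (2 * R) * (2 * R) ^ (2 * k) := by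
          have := hV0 (2 * R)
          gcongr
          linarith
        _ = κ * (V (2 * R) * (2 * R) ^ (2 * k)) := by ring
        _ ≤ κ * (E * (2 * R) ^ d) := by
          exact mul_le_mul_of_nonneg_left (hE _ (by positivity)) hκ0
        _ = _ := by ring
  -- With `k = d + 1` the exponent is `2k = (d + 2) + d`, so after cancelling `R^d` a positive power
  -- of `R` remains.
  obtain ⟨E, hE⟩ := hdecay (d + 1)
  have hlin : ∀ R, 1 ≤ R → V R * R ≤ E := fun R hR => by
    have hR0 : 0 < R := by linarith
    have h1 : V R * R ^ (d + 2) ≤ E := by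
      have := hE R hR0
      have h2 : V R * R ^ (d + 2) * R ^ d ≤ E * R ^ d := by
        calc _ = V R * R ^ (2 * (d + 1)) := by ring
          _ ≤ _ := this
      exact le_of_mul_le_mul_right h2 (by positivity)
    refine le_trans (mul_le_mul_of_nonneg_left ?_ (hV0 R)) h1
    exact le_self_pow₀ hR (by omega)
  have hVz : ∀ n : ℕ, V n = 0 := fun n => by
    refine le_antisymm (le_of_forall_pos_le_add fun ε hε => ?_) (hV0 _)
    set R : ℝ := max (max n 1) (E / ε) with hR
    have hR1 : 1 ≤ R := (le_max_right _ _).trans (le_max_left _ _)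
    have h1 := hVmono (r := n) (R := R) ((le_max_left _ _).trans (le_max_left _ _))
    have h2 : E / ε ≤ R := le_max_right _ _
    rw [div_le_iff₀ hε] at h2
    have h3 := hlin R hR1
    nlinarith
  refine Measure.measure_univ_eq_zero.1 ?_
  rw [← Metric.iUnion_closedBall_nat (0 : Rd d)]
  refine measure_iUnion_null fun n => ?_
  have := hVz n
  simp only [hV, Measure.real, ENNReal.toReal_eq_zero_iff] at this
  exact this.resolve_right (hfin _)

end Liouville

/-! ### Crossing the boundary of `{Φ₁ < ∞}`, and uniqueness -/

section Uniqueness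

variable {d : ℕ}

/-- The Caccioppoli inequality on `{Φ < ∞}` extends to the whole space. -/
lemma PositionPotential.integral_sq_le_of_testFunctions {Φ : Rd d → EReal} {G : Rd d → Rd d}
    (h : PositionPotential 2 Φ G) {ν : Measure (Rd d)} {B : ℝ≥0∞} (hB : B ≠ ⊤)
    (hν : ν ≤ B • expMeasure Φ) {a b : ℝ}
    (hab : ∀ ψ ∈ testFunctions (finiteSet Φ), a * ∫ x, ψ x ^ 2 ∂ν ≤ b * ∑ i, ∫ x, pd i ψ x ^ 2 ∂ν)
    {χ : Rd d → ℝ} (hχ : χ ∈ testFunctions (Set.univ : Set (Rd d))) :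
    a * ∫ x, χ x ^ 2 ∂ν ≤ b * ∑ i, ∫ x, pd i χ x ^ 2 ∂ν := by
  obtain ⟨c, hc, hcμ⟩ := h.isPotential.exists_expMeasure_le
  have hνv : ν ≤ (B * c) • (volume : Measure (Rd d)) := by
    rw [mul_smul]
    refine hν.trans fun s => ?_
    simp only [Measure.smul_apply, smul_eq_mul]
    gcongr
    simpa using hcμ s
  have hνμ : ν ≪ expMeasure Φ :=
    (Measure.absolutelyContinuous_of_le hν).trans Measure.smul_absolutelyContinuous
  have hνac : ν ≪ volume := hνμ.trans (expMeasure_absolutelyContinuous Φ)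
  have hpdχ := fun i => pd_mem_testFunctions hχ i
  obtain ⟨Cχ, hCχ⟩ := testFunction_bounded hχ
  -- The cutoffs are `F_n(Φ)` with `F_n(s) = β(s/(n+1))`: they vanish where `Φ > 2(n+1)` and, at
  -- each point of `{Φ < ∞}`, equal one with vanishing derivative for large `n`.
  let β : ContDiffBump (0 : ℝ) := ⟨1, 2, one_pos, one_lt_two⟩
  have hβd : ∀ s, HasDerivAt β (deriv β s) s := fun s =>
    ((β.contDiff (n := 1)).differentiable (by simp) s).hasDerivAt
  have hβc : Continuous (deriv β) := (β.contDiff (n := 1)).continuous_deriv le_rfl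
  obtain ⟨L, hL⟩ := hβc.bounded_above_of_compact_support β.hasCompactSupport.deriv
  have hβ1 : ∀ s, |β s| ≤ 1 := fun s => by
    rw [abs_of_nonneg β.nonneg]
    exact β.le_one
  set F : ℕ → ℝ → ℝ := fun n s => β (s / ((n : ℝ) + 1)) with hF
  set F' : ℕ → ℝ → ℝ := fun n s => deriv β (s / ((n : ℝ) + 1)) / ((n : ℝ) + 1) with hF'
  have hN : ∀ n : ℕ, (0 : ℝ) < (n : ℝ) + 1 := fun n => by positivity
  have hFd : ∀ n s, HasDerivAt (F n) (F' n s) s := fun n s => by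
    have := (hβd (s / ((n : ℝ) + 1))).comp s ((hasDerivAt_id s).div_const _)
    simpa [F, F', Function.comp_def, div_eq_mul_inv] using this
  have hFc : ∀ n, Continuous (F' n) := fun n =>
    (hβc.comp (continuous_id.div_const _)).div_const _
  have hF1 : ∀ n s, |F n s| ≤ 1 := fun n s => hβ1 _
  have hL0 : 0 ≤ L := (norm_nonneg _).trans (hL 0)
  have hFL : ∀ n s, |F' n s| ≤ L := fun n s => by
    rw [hF', abs_div, abs_of_pos (hN n)]
    refine (div_le_self (abs_nonneg _) ?_).trans (hL _)
    have : (0 : ℝ) ≤ n := n.cast_nonneg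
    linarith
  have hFlarge : ∀ (n : ℕ) s, 2 * ((n : ℝ) + 1) < s → F n s = 0 ∧ F' n s = 0 := fun n s hs => by
    have h1 : s / ((n : ℝ) + 1) ∉ tsupport β := by
      rw [β.tsupport_eq, mem_closedBall_zero_iff, not_le, Real.norm_eq_abs]
      refine lt_of_lt_of_le ?_ (le_abs_self _)
      rw [lt_div_iff₀ (hN n)]
      exact hs
    have h0 : β (s / ((n : ℝ) + 1)) = 0 := image_eq_zero_of_notMem_tsupport h1
    refine ⟨h0, ?_⟩
    have h2 : deriv β (s / ((n : ℝ) + 1)) = 0 :=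
      image_eq_zero_of_notMem_tsupport fun hc => h1 (tsupport_deriv_subset hc)
    simp [F', h2]
  have hFsmall : ∀ s, ∀ᶠ n in atTop, F n s = 1 ∧ F' n s = 0 := fun s => by
    obtain ⟨m, hm⟩ := exists_nat_gt |s|
    filter_upwards [eventually_ge_atTop m] with n hn
    have h1 : s / ((n : ℝ) + 1) ∈ Metric.ball (0 : ℝ) β.rIn := by
      rw [mem_ball_zero_iff, Real.norm_eq_abs, abs_div, abs_of_pos (hN n), div_lt_iff₀ (hN n)]
      have : (m : ℝ) ≤ n := by exact_mod_cast hn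
      change _ < 1 * _
      linarith
    have h2 := β.eventuallyEq_one_of_mem_ball h1
    refine ⟨h2.self_of_nhds, ?_⟩
    have h3 : deriv β (s / ((n : ℝ) + 1)) = 0 := by
      rw [h2.deriv_eq]
      exact deriv_const _ _
    simp [F', h3]
  set Ω := finiteSet Φ with hΩ
  set f : Rd d → ℝ := fun x => (Φ x).toReal with hf
  set u : ℕ → Rd d → ℝ := fun n => Ω.indicator fun x => F n (f x) * χ x with hu
  set w : ℕ → Fin d → Rd d → ℝ := fun n i => Ω.indicator fun x =>
    F' n (f x) * G x i * χ x + F n (f x) * pd i χ x with hw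
  -- The condition on the density says `Φ ≤ 2(n+1)`. Continuity of `e^{-Φ}` makes the set closed, so
  -- `F_n(Φ) χ` has compact support inside `{Φ < ∞}`.
  set K : ℕ → Set (Rd d) := fun n => tsupport χ ∩ {x | Real.exp (-(2 * ((n : ℝ) + 1))) ≤ dens Φ x}
    with hKdef
  have hK : ∀ n, IsCompact (K n) := fun n =>
    hχ.2.1.isCompact.inter_right (isClosed_le continuous_const h.continuous_dens)
  have hKΩ : ∀ n, K n ⊆ Ω := fun n x hx =>
    h.isPotential.dens_pos_iff.1 ((Real.exp_pos _).trans_le hx.2)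
  have hzero : ∀ n x, x ∈ Ω → x ∉ K n → (χ x = 0 ∧ ∀ i, pd i χ x = 0) ∨
      (F n (f x) = 0 ∧ F' n (f x) = 0) := fun n x hxΩ hx => by
    by_cases hxs : x ∈ tsupport χ
    · right
      have h1 : dens Φ x < Real.exp (-(2 * ((n : ℝ) + 1))) := not_le.1 fun hc => hx ⟨hxs, hc⟩
      rw [h.isPotential.dens_of_lt_top hxΩ, Real.exp_lt_exp] at h1
      exact hFlarge n _ (by linarith)
    · exact Or.inl ⟨image_eq_zero_of_notMem_tsupport hxs, fun i =>
        image_eq_zero_of_notMem_tsupport fun hc => hxs (tsupport_fderiv_apply_subset _ _ hc)⟩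
  have hu0 : ∀ n x, x ∉ K n → u n x = 0 := fun n x hx => by
    by_cases hxΩ : x ∈ Ω
    · simp only [hu, Set.indicator_of_mem hxΩ]
      rcases hzero n x hxΩ hx with h1 | h1 <;> simp [h1.1]
    · exact Set.indicator_of_notMem hxΩ _
  have hw0 : ∀ n i x, x ∉ K n → w n i x = 0 := fun n i x hx => by
    by_cases hxΩ : x ∈ Ω
    · simp only [hw, Set.indicator_of_mem hxΩ]
      rcases hzero n x hxΩ hx with h1 | h1
      · simp [h1.1, h1.2 i]
      · simp [h1.1, h1.2]
    · exact Set.indicator_of_notMem hxΩ _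
  have hcomp : ∀ n i, IsWeakPartial Ω i (fun x => F n (f x)) fun x => F' n (f x) * G x i := fun n i =>
    (h.weakGradient i).comp h.isOpen (hFd n) (hFc n) fun K' _ _ =>
      ⟨Set.univ, isClosed_univ, convex_univ, fun _ _ => trivial, max 1 L, fun s _ =>
        ⟨(hF1 n s).trans (le_max_left _ _), (hFL n s).trans (le_max_right _ _)⟩⟩
  have hχw : ∀ i, IsWeakPartial Ω i χ (pd i χ) := fun i =>
    ⟨(hχ.1.continuous.locallyIntegrable).locallyIntegrableOn _,
      ((hpdχ i).1.continuous.locallyIntegrable).locallyIntegrableOn _, fun φ hφ => by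
        have := integral_mul_fderiv_testFunction (hχ.1.of_le (by simp)) (hφ.1.of_le (by simp)) hφ.2.1
          (EuclideanSpace.single i 1)
        rw [setIntegral_eq_integral_of_tsupport_subset hφ.2.2,
          setIntegral_eq_integral_of_tsupport_subset
            ((tsupport_fderiv_apply_subset φ _).trans hφ.2.2), this]
        rfl⟩
  have hloc : ∀ n i, MemLpLoc (fun x => F' n (f x) * G x i) 2 Ω volume := fun n i K' hK' hK'Ω => by
    have h1 := (memLp_indicator_iff_restrict hK'.measurableSet).1 (h.memLp_indicator_grad hK' hK'Ω i)
    have h2 := (integrable_indicator_iff hK'.measurableSet).1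
      (LocallyIntegrableOn.integrable_indicator (hcomp n i).2.1 hK' hK'Ω)
    refine (h1.const_mul L).mono h2.aestronglyMeasurable (Eventually.of_forall fun x => ?_)
    rw [norm_mul, norm_mul, Real.norm_of_nonneg hL0]
    exact mul_le_mul_of_nonneg_right (hFL n _) (norm_nonneg _)
  have huw : ∀ n i, IsWeakPartial Ω i (u n) (w n i) := fun n i =>
    ((hcomp n i).mul h.isOpen (hχw i) (M := 1) (fun x _ => hF1 n _) (hloc n i)
      fun K' _ _ => (testFunction_memLp hχ 2).restrict K').congr h.isOpen.measurableSet
      (fun x hx => (Set.indicator_of_mem (s := Ω) hx fun x => F n (f x) * χ x).symm)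
      fun x hx => (Set.indicator_of_mem (s := Ω) hx fun x =>
        F' n (f x) * G x i * χ x + F n (f x) * pd i χ x).symm
  have hind : ∀ {n} {g : Rd d → ℝ}, (∀ x, x ∉ K n → g x = 0) → (K n).indicator g = g :=
    fun hg => Set.indicator_eq_self.2 fun x hx => by_contra fun hc => hx (hg x hc)
  have hule : ∀ n x, |u n x| ≤ |χ x| := fun n x => by
    by_cases hxΩ : x ∈ Ω
    · simp only [hu, Set.indicator_of_mem hxΩ, abs_mul]
      exact mul_le_of_le_one_left (abs_nonneg _) (hF1 n _)
    · simp only [hu, Set.indicator_of_notMem hxΩ, abs_zero]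
      exact abs_nonneg _
  have hwle : ∀ n i x, |w n i x| ≤ L * |G x i * χ x| + |pd i χ x| := fun n i x => by
    by_cases hxΩ : x ∈ Ω
    · simp only [hw, Set.indicator_of_mem hxΩ]
      refine (abs_add_le _ _).trans (add_le_add ?_ ?_)
      · rw [mul_assoc, abs_mul]
        exact mul_le_mul_of_nonneg_right (hFL n _) (abs_nonneg _)
      · rw [abs_mul]
        exact mul_le_of_le_one_left (abs_nonneg _) (hF1 n _)
    · simp only [hw, Set.indicator_of_notMem hxΩ, abs_zero]
      positivity
  have hum : ∀ n, MemLp (u n) 2 := fun n => by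
    -- Measurability is read off from a weak derivative, which requires a coordinate; for `d = 0`
    -- the space is a point.
    by_cases hd : Nonempty (Fin d)
    · obtain ⟨i⟩ := hd
      refine (testFunction_memLp hχ 2).mono ?_ (Eventually.of_forall (hule n))
      have := LocallyIntegrableOn.integrable_indicator (huw n i).1 (hK n) (hKΩ n)
      rw [hind (hu0 n)] at this
      exact this.aestronglyMeasurable
    · rw [not_nonempty_iff] at hd
      have : Subsingleton (Rd d) := ⟨fun x y => by ext i; exact isEmptyElim i⟩
      exact (testFunction_memLp hχ 2).mono
        (continuous_of_const fun x y => congrArg _ (Subsingleton.elim x y)).aestronglyMeasurable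
        (Eventually.of_forall (hule n))
  have hwm : ∀ n i, MemLp (w n i) 2 := fun n i => by
    have h0 := LocallyIntegrableOn.integrable_indicator (huw n i).2.1 (hK n) (hKΩ n)
    have h1 : MemLp (fun x => (K n).indicator (fun x => G x i) x * χ x) 2 :=
      memLp_bdd_mul (h.memLp_indicator_grad (hK n) (hKΩ n) i)
        hχ.1.continuous.aestronglyMeasurable hCχ
    have h2 := (h1.norm.const_mul L).add (testFunction_memLp (hpdχ i) 2).norm
    rw [hind (hw0 n i)] at h0
    refine h2.mono h0.aestronglyMeasurable (Eventually.of_forall fun x => ?_)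
    refine le_trans ?_ (le_abs_self _)
    simp only [Pi.add_apply, Real.norm_eq_abs]
    by_cases hx : x ∈ K n
    · rw [Set.indicator_of_mem hx]
      exact hwle n i x
    · rw [hw0 n i x hx, abs_zero]
      positivity
  have hχν : MemLp χ 2 ν := (testFunction_memLp hχ 2).of_measure_le_smul (ENNReal.mul_ne_top hB hc) hνv
  have hpdν : ∀ i, MemLp (pd i χ) 2 ν := fun i =>
    (testFunction_memLp (hpdχ i) 2).of_measure_le_smul (ENNReal.mul_ne_top hB hc) hνv
  -- Here `∇Φ` is integrated for `μ_Φ` over the whole support of `χ`, including near the boundary of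
  -- `{Φ < ∞}`. This is the dominating function for the limit.
  have hGν : ∀ i, MemLp (fun x => G x i * χ x) 2 ν := fun i => by
    have h1 := (memLp_indicator_iff_restrict (isClosed_tsupport χ).measurableSet).2
      (MemLp.coord (h.memLpLoc _ hχ.2.1.isCompact (Set.subset_univ _)) i)
    have h2 := memLp_bdd_mul h1 (u := χ) hχ.1.continuous.aestronglyMeasurable hCχ
    refine (h2.of_measure_le_smul hB hν).ae_eq (Eventually.of_forall fun x => ?_)
    by_cases hx : x ∈ tsupport χ
    · simp only [Set.indicator_of_mem hx]
    · simp only [image_eq_zero_of_notMem_tsupport hx, mul_zero]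
  have haeΩ : ∀ᵐ x ∂ν, x ∈ Ω := hνμ.ae_le h.isPotential.ae_lt_top
  have hlim1 : Tendsto (fun n => ∫ x, u n x ^ 2 ∂ν) atTop (𝓝 (∫ x, χ x ^ 2 ∂ν)) := by
    refine tendsto_integral_of_dominated_convergence (fun x => χ x ^ 2)
      (fun n => ((hum n).1.mono_ac hνac).pow 2) hχν.integrable_sq
      (fun n => Eventually.of_forall fun x => ?_) ?_
    · rw [Real.norm_eq_abs, abs_of_nonneg (sq_nonneg _)]
      exact sq_le_sq.2 (hule n x)
    · filter_upwards [haeΩ] with x hx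
      refine tendsto_const_nhds.congr' ?_
      filter_upwards [hFsmall (f x)] with n hn
      simp [u, Set.indicator_of_mem hx, hn.1]
  -- The term `F_n'(Φ) ∂ᵢΦ χ` is eventually zero at every point of `{Φ < ∞}` and dominated by `L
  -- |∂ᵢΦ χ|`, so it leaves no trace in the limit.
  have hlim2 : ∀ i, Tendsto (fun n => ∫ x, w n i x ^ 2 ∂ν) atTop (𝓝 (∫ x, pd i χ x ^ 2 ∂ν)) := fun i => by
    refine tendsto_integral_of_dominated_convergence
      (fun x => (L * |G x i * χ x| + |pd i χ x|) ^ 2)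
      (fun n => ((hwm n i).1.mono_ac hνac).pow 2)
      (((hGν i).norm.const_mul L).add (hpdν i).norm).integrable_sq
      (fun n => Eventually.of_forall fun x => ?_) ?_
    · rw [Real.norm_eq_abs, abs_of_nonneg (sq_nonneg _)]
      exact sq_le_sq.2 ((hwle n i x).trans (le_abs_self _))
    · filter_upwards [haeΩ] with x hx
      refine tendsto_const_nhds.congr' ?_
      filter_upwards [hFsmall (f x)] with n hn
      simp [w, Set.indicator_of_mem hx, hn.1, hn.2]
  exact le_of_tendsto_of_tendsto (hlim1.const_mul a)
    ((tendsto_finsetSum _ fun i _ => hlim2 i).const_mul b) (Eventually.of_forall fun n =>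
      integral_sq_le_of_isWeakPartial (ENNReal.mul_ne_top hB hc) hνv h.isOpen hab (hK n) (hKΩ n)
        (huw n) (hu0 n) (hw0 n) (hum n) (hwm n))

/-- Uniqueness for the dual resolvent equation. -/
lemma ae_eq_zero_of_dual_equation {Φ₁ Φ₂ : Rd d → EReal} {G₁ G₂ : Rd d → Rd d}
    {H₂ : Fin d → Rd d → ℝ} (h₁ : PositionPotential 2 Φ₁ G₁) (h₂ : VelocityPotential Φ₂ G₂ H₂)
    {c : ℝ} (hc : 0 < c) {h : Rd d × Rd d → ℝ} {M : ℝ} (hh : Measurable h) (hM : ∀ z, |h z| ≤ M)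
    (heq : ∀ f : testFunctions (finiteSet₂ Φ₁ Φ₂), ∫ z, h z * (c * (f : Rd d × Rd d → ℝ) z -
      langevinOperator G₁ G₂ (finiteSet₂ Φ₁ Φ₂) f z) ∂(phaseMeasure Φ₁ Φ₂) = 0) :
    ∀ᵐ z ∂(phaseMeasure Φ₁ Φ₂), h z = 0 := by
  have s₁ := h₁.isPotential.sigmaFinite
  have s₂ := h₂.finite
  obtain ⟨K, hK0, hK⟩ := exists_caccioppoli h₁ h₂ hc
  set μ₁ := expMeasure Φ₁
  set μ₂ := expMeasure Φ₂
  set m : Rd d → ℝ := fun x => ∫ v, h (x, v) ^ 2 ∂μ₂ with hm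
  have hmm : Measurable m :=
    ((hh.pow_const 2).stronglyMeasurable.integral_prod_right' (ν := μ₂)).measurable
  have hm0 : ∀ x, 0 ≤ m x := fun x => integral_nonneg fun v => sq_nonneg _
  have hsqb : ∀ z, ‖h z ^ 2‖ ≤ M ^ 2 := fun z => by
    rw [norm_pow]
    exact pow_le_pow_left₀ (norm_nonneg _) (hM z) 2
  have hsqi : ∀ x, Integrable (fun v => h (x, v) ^ 2) μ₂ := fun x =>
    Integrable.of_bound ((hh.comp (measurable_const.prodMk measurable_id)).pow_const
      2).aestronglyMeasurable (M ^ 2) (Eventually.of_forall fun v => hsqb _)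
  have hmB : ∀ x, m x ≤ M ^ 2 * μ₂.real Set.univ := fun x =>
    (le_abs_self _).trans (norm_integral_le_of_norm_le_const (Eventually.of_forall fun v => hsqb _))
  -- With the slice energies as density, the Caccioppoli inequality becomes a statement about a
  -- single measure on `ℝ^d`; boundedness of `h` and finiteness of `μ₂` bound the density.
  set ν := μ₁.withDensity fun x => ENNReal.ofReal (m x) with hν
  have hνle : ν ≤ ENNReal.ofReal (M ^ 2 * μ₂.real Set.univ) • μ₁ := by
    rw [← withDensity_const]
    exact withDensity_mono (Eventually.of_forall fun x => ENNReal.ofReal_le_ofReal (hmB x))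
  have hint : ∀ θ : Rd d → ℝ, ∫ x, θ x ^ 2 ∂ν = ∫ x, θ x ^ 2 * m x ∂μ₁ := fun θ => by
    rw [hν, integral_withDensity_eq_integral_toReal_smul hmm.ennreal_ofReal
      (Eventually.of_forall fun x => ENNReal.ofReal_lt_top)]
    refine integral_congr_ae (Eventually.of_forall fun x => ?_)
    simp only [ENNReal.toReal_ofReal (hm0 x), smul_eq_mul, mul_comm]
  obtain ⟨c₁, hc₁, hcμ⟩ := h₁.isPotential.exists_expMeasure_le
  have hνv : ν ≤ (ENNReal.ofReal (M ^ 2 * μ₂.real Set.univ) * c₁) • (volume : Measure (Rd d)) := by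
    rw [mul_smul]
    refine hνle.trans fun s => ?_
    simp only [Measure.smul_apply, smul_eq_mul]
    gcongr
    simpa using hcμ s
  have hν0 : ν = 0 := eq_zero_of_caccioppoli (ENNReal.mul_ne_top ENNReal.ofReal_ne_top hc₁) hνv
    (half_pos hc) hK0 fun χ hχ => h₁.integral_sq_le_of_testFunctions ENNReal.ofReal_ne_top hνle
      (fun ψ hψ => by
        simp only [hint]
        exact hK h M hh hM heq ψ hψ) hχ
  -- Vanishing of `ν` means that almost every slice of `h` has zero `L²` norm.
  rw [hν, withDensity_eq_zero_iff hmm.ennreal_ofReal.aemeasurable] at hν0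
  rw [phaseMeasure_eq_prod h₁.isPotential h₂.isPotential,
    Measure.ae_prod_iff_ae_ae (measurableSet_eq_fun hh measurable_const)]
  filter_upwards [hν0] with x hx
  have hmx : m x = 0 := le_antisymm (ENNReal.ofReal_eq_zero.1 hx) (hm0 x)
  filter_upwards [(integral_eq_zero_iff_of_nonneg (fun v => sq_nonneg (h (x, v))) (hsqi x)).1 hmx]
    with v hv
  exact pow_eq_zero_iff two_ne_zero |>.1 hv

end Uniqueness

end Langevin

end

/-- The operator `(L_𝚽, C_c^∞({Φ₁, Φ₂ < ∞}))` is well defined on `L¹(μ_𝚽)` and closable, and its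
closure generates a strongly continuous contraction semigroup, which is sub-Markovian. -/
theorem theorem2p12 (d : ℕ) (q : ℝ≥0∞) (hq : 2 ≤ q)
    (Φ₁ Φ₂ : Langevin.Rd d → EReal) (G₁ G₂ : Langevin.Rd d → Langevin.Rd d)
    (H₂ : Fin d → Langevin.Rd d → ℝ)
    (h₁ : Langevin.PositionPotential q Φ₁ G₁) (h₂ : Langevin.VelocityPotential Φ₂ G₂ H₂)
    (h : IsFiniteMeasure (Langevin.phaseMeasure Φ₁ Φ₂) ∨ (d : ℝ≥0∞) < q) :
    (∀ f : Langevin.testFunctions (Langevin.finiteSet₂ Φ₁ Φ₂),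
      MemLp (f : Langevin.Rd d × Langevin.Rd d → ℝ) 1 (Langevin.phaseMeasure Φ₁ Φ₂) ∧
      MemLp (Langevin.langevinOperator G₁ G₂ (Langevin.finiteSet₂ Φ₁ Φ₂) f) 1
        (Langevin.phaseMeasure Φ₁ Φ₂)) ∧
    (Langevin.langevinOperatorL1 Φ₁ Φ₂ G₁ G₂).IsClosable ∧
    ∃ T : ℝ≥0 → Lp ℝ 1 (Langevin.phaseMeasure Φ₁ Φ₂) →L[ℝ] Lp ℝ 1 (Langevin.phaseMeasure Φ₁ Φ₂),
      Langevin.IsStronglyContinuousContractionSemigroup T ∧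
      Langevin.IsGenerator T (Langevin.langevinOperatorL1 Φ₁ Φ₂ G₁ G₂).closure ∧
      Langevin.IsSubMarkovian T := by
  -- From here on only local square integrability of `∇Φ₁` matters.
  have h₁' := h₁.to_two hq
  refine ⟨fun f => ⟨Langevin.memLp_phase_testFunction h₁' h₂ f.2 one_le_two,
    Langevin.memLp_langevinOperator h₁' h₂ f one_le_two⟩, ?_⟩
  exact Langevin.exists_langevin_semigroup h₁' h₂ fun c g M hc hm hb heq =>
    Langevin.ae_eq_zero_of_dual_equation h₁' h₂ hc hm hb heq
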